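/- Let $\mathscr{M}=(\underline M,\otimes,I)$ be a (locally small) symmetric closed monoidal category. For a set $X$ let $\mathcal{S}_{\overline X}$ be the following strict semi-$2$-category (a $2$-category without identity $1$-morphisms). Its objects are the elements of $X$; a $1$-morphism $A\to B$ is a chain $(E_0,\dots,E_n)$ of elements of $X$ with $n\ge 1$, $E_0=A$, $E_n=B$; a $2$-morphism $t\to s$ between two chains from $A$ to $B$ is a way of deleting inner letters of $t$ so as to obtain $s$ (equivalently, a nondecreasing surjection from the steps of $t$ to the steps of $s$ such that $s$ arises from $t$ by composing, in the coarse category $\overline X$ on $X$, the steps in each fibre); horizontal composition $s\otimes t$ is concatenation of chains. A Pre-Co-Segal category with object set $X$ is a lax morphism $F:(\mathcal{S}_{\overline X})^{2\text{-op}}\to\mathscr{M}$, where $\mathscr{M}$ is viewed as a one-object bicategory: that is, functors $F_{AB}:\mathcal{S}_{\overline X}(A,B)^{\mathrm{op}}\to\underline M$ together with laxity maps $F(s)\otimes F(t)\to F(s\otimes t)$ that are natural in $s$ and $t$ and associative (there are no unit data). The category $\mathscr{M}_{\mathcal S}(X)$ has these as objects; a morphism $F\to G$ is a family of natural transformations $F_{AB}\to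 G_{AB}$ compatible with the laxity maps. A function $f:X\to Y$ acts on chains letterwise, and composition with this action gives a functor $f^\star:\mathscr{M}_{\mathcal S}(Y)\to\mathscr{M}_{\mathcal S}(X)$. The category $\mathscr{M}_{\mathcal S}(\mathrm{Set})$ has as objects the pairs $(X,F)$ with $X$ a (small, possibly empty) set and $F\in\mathscr{M}_{\mathcal S}(X)$, and as morphisms $(X,F)\to(Y,G)$ the pairs $(f,\sigma)$ with $f:X\to Y$ a function and $\sigma:F\to f^\star G$ a morphism of $\mathscr{M}_{\mathcal S}(X)$. Theorem. (1) If $\underline M$ is cocomplete, then $\mathscr{M}_{\mathcal S}(X)$ is cocomplete for every nonempty (small) set $X$, and $\mathscr{M}_{\mathcal S}(\mathrm{Set})$ is cocomplete. (2) If $\underline M$ is locally presentable, then $\mathscr{M}_{\mathcal S}(X)$ is locally presentable for every nonempty (small) set $X$, and $\mathscr{M}_{\mathcal S}(\mathrm{Set})$ is locally presentable. -/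

import Mathlib

open CategoryTheory MonoidalCategory Limits Opposite

universe w v u

namespace CoSegal

/-! ## The strict semi-2-category `S_X̄` of a set `X` -/

/-- `Del l l'` is the set of ways to obtain the word `l'` from the word `l` by deleting letters
(two deletions of different positions are different elements, even if the results agree). -/
inductive Del {X : Type w} : List X → List X → Type w
  | nil : Del [] []
  | keep (a : X) {l l' : List X} (u : Del l l') : Del (a :: l) (a :: l')
  | drop (a : X) {l l' : List X} (u : Del l l') : Del (a :: l) l'

namespace Del

variable {X : Type w} {Y : Type w}

/-- Delete nothing. -/
def id : (l : List X) → Del l l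
  | [] => nil
  | a :: l => keep a (id l)

/-- First delete according to `u`, then delete according to `v`. -/
def comp : {l l' l'' : List X} → Del l l' → Del l' l'' → Del l l''
  | _, _, _, nil, v => v
  | _, _, _, drop a u, v => drop a (comp u v)
  | _, _, _, keep a u, keep _ v => keep a (comp u v)
  | _, _, _, keep a u, drop _ v => drop a (comp u v)

/-- Delete letters independently in the two halves of a concatenated word. -/
def append : {l l' m m' : List X} → Del l l' → Del m m' → Del (l ++ m) (l' ++ m')
  | _, _, _, _, nil, v => v
  | _, _, _, _, keep a u, v => keep a (append u v)
  | _, _, _, _, drop a u, v => drop a (append u v)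

/-- Apply a function to all letters. -/
def map (f : X → Y) : {l l' : List X} → Del l l' → Del (l.map f) (l'.map f)
  | _, _, nil => nil
  | _, _, keep a u => keep (f a) (map f u)
  | _, _, drop a u => drop (f a) (map f u)

theorem id_comp {l l' : List X} (u : Del l l') : comp (id l) u = u := by
  induction u with
  | nil => rfl
  | keep a u ih => simp [id, comp, ih]
  | drop a u ih => simp [id, comp, ih]

theorem comp_id {l l' : List X} (u : Del l l') : comp u (id l') = u := by
  induction u with
  | nil => rfl
  | keep a u ih => simp [id, comp, ih]
  | drop a u ih => simp [comp, ih]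

theorem comp_assoc {l l' l'' l''' : List X} (u : Del l l') (v : Del l' l'') (t : Del l'' l''') :
    comp (comp u v) t = comp u (comp v t) := by
  induction u generalizing l'' l''' with
  | nil => rfl
  | drop a u ih => simp [comp, ih]
  | keep a u ih =>
    cases v with
    | drop _ v => simp [comp, ih]
    | keep _ v =>
      cases t with
      | drop _ t => simp [comp, ih]
      | keep _ t => simp [comp, ih]

theorem append_id (l m : List X) : append (id l) (id m) = id (l ++ m) := by
  induction l with
  | nil => rfl
  | cons a l ih => simp [id, append, ih]

theorem append_comp {l l' l'' m m' m'' : List X} (u : Del l l') (u' : Del l' l'')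
    (v : Del m m') (v' : Del m' m'') :
    append (comp u u') (comp v v') = comp (append u v) (append u' v') := by
  induction u generalizing l'' with
  | nil => cases u'; rfl
  | drop a u ih => simp [comp, append, ih]
  | keep a u ih =>
    cases u' with
    | drop _ u' => simp [comp, append, ih]
    | keep _ u' => simp [comp, append, ih]

theorem map_id (f : X → Y) (l : List X) : map f (id l) = id (l.map f) := by
  induction l with
  | nil => rfl
  | cons a l ih => exact congrArg (keep (f a)) ih

theorem map_comp (f : X → Y) {l l' l'' : List X} (u : Del l l') (v : Del l' l'') :
    map f (comp u v) = comp (map f u) (map f v) := by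
  induction u generalizing l'' with
  | nil => cases v; rfl
  | drop a u ih => simp [comp, map, ih]
  | keep a u ih =>
    cases v with
    | drop _ v => simp [comp, map, ih]
    | keep _ v => simp [comp, map, ih]

theorem keep_heq (a : X) {l l' m m' : List X} {u : Del l l'} {v : Del m m'}
    (h : l = m) (h' : l' = m') (e : HEq u v) : HEq (keep a u) (keep a v) := by
  subst h h' e; rfl

theorem drop_heq (a : X) {l l' m m' : List X} {u : Del l l'} {v : Del m m'}
    (h : l = m) (h' : l' = m') (e : HEq u v) : HEq (drop a u) (drop a v) := by
  subst h h' e; rfl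

theorem append_assoc {l l' m m' n n' : List X} (u : Del l l') (v : Del m m') (t : Del n n') :
    HEq (append (append u v) t) (append u (append v t)) := by
  induction u with
  | nil => rfl
  | keep a u ih => exact keep_heq a (List.append_assoc ..) (List.append_assoc ..) ih
  | drop a u ih => exact drop_heq a (List.append_assoc ..) (List.append_assoc ..) ih

theorem map_append (f : X → Y) {l l' m m' : List X} (u : Del l l') (v : Del m m') :
    HEq (map f (append u v)) (append (map f u) (map f v)) := by
  induction u with
  | nil => rfl
  | keep a u ih => exact keep_heq _ List.map_append List.map_append ih
  | drop a u ih => exact drop_heq _ List.map_append List.map_append ih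

theorem map_id_fun {l l' : List X} (u : Del l l') : HEq (map (fun x => x) u) u := by
  induction u with
  | nil => rfl
  | keep a u ih => exact keep_heq _ (List.map_id' _) (List.map_id' _) ih
  | drop a u ih => exact drop_heq _ (List.map_id' _) (List.map_id' _) ih

theorem map_map {Z : Type w} (f : X → Y) (g : Y → Z) {l l' : List X} (u : Del l l') :
    HEq (map g (map f u)) (map (fun x => g (f x)) u) := by
  induction u with
  | nil => rfl
  | keep a u ih => exact keep_heq _ List.map_map List.map_map ih
  | drop a u ih => exact drop_heq _ List.map_map List.map_map ih

end Del

/-- A 1-morphism `A → B` of `S_X̄`: a chain `(E_0, …, E_n)` of elements of `X` with `n ≥ 1`,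
`E_0 = A` and `E_n = B`. It is stored as the word `(E_1, …, E_{n-1})` of its inner letters;
its degree is the number of inner letters plus one. -/
@[ext]
structure Chain (X : Type w) (A B : X) where
  /-- The inner letters `E_1, …, E_{n-1}`. -/
  inner : List X

/-- The hom-category `S_X̄(A, B)`: a morphism `t ⟶ s` deletes some inner letters of `t` to get `s`.
Such a deletion is the same thing as a nondecreasing surjection `f` from the `n` steps of `t` to
the `m` steps of `s` (a morphism of `Δ_epi`) for which `s` is obtained from `t` by
composing the steps in each fibre of `f`: the retained letters are the ends of the fibres. -/
instance {X : Type w} (A B : X) : Category.{w} (Chain X A B) where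
  Hom t s := Del t.inner s.inner
  id t := Del.id t.inner
  comp u v := Del.comp u v
  id_comp := Del.id_comp
  comp_id := Del.comp_id
  assoc := Del.comp_assoc

namespace Chain

variable {X : Type w} {Y : Type w} {Z : Type w}

theorem comp_eqToHom_of_heq {A B : X} {s s' t t' : Chain X A B} (u : s ⟶ t) (u' : s' ⟶ t')
    (hs : s = s') (ht : t = t') (e : HEq u u') : u ≫ eqToHom ht = eqToHom hs ≫ u' := by
  subst hs ht e; simp

/-- Horizontal composition of 1-morphisms of `S_X̄`: concatenation of chains,
`(A, …, B) ⊗ (B, …, C) = (A, …, B, …, C)`. -/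
def hcomp {A B C : X} (s : Chain X A B) (t : Chain X B C) : Chain X A C :=
  ⟨s.inner ++ B :: t.inner⟩

/-- Horizontal composition of 2-morphisms of `S_X̄`: the letter `B` at the junction is kept. -/
def hcompHom {A B C : X} {s s' : Chain X A B} {t t' : Chain X B C} (u : s ⟶ s') (v : t ⟶ t') :
    s.hcomp t ⟶ s'.hcomp t' :=
  Del.append u (Del.keep B v)

theorem hcompHom_id {A B C : X} (s : Chain X A B) (t : Chain X B C) :
    hcompHom (𝟙 s) (𝟙 t) = 𝟙 (s.hcomp t) :=
  Del.append_id s.inner (B :: t.inner)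

theorem hcompHom_comp {A B C : X} {s s' s'' : Chain X A B} {t t' t'' : Chain X B C}
    (u : s ⟶ s') (u' : s' ⟶ s'') (v : t ⟶ t') (v' : t' ⟶ t'') :
    hcompHom (u ≫ u') (v ≫ v') = hcompHom u v ≫ hcompHom u' v' :=
  Del.append_comp u u' (Del.keep B v) (Del.keep B v')

theorem hcompHom_eqToHom {A B C : X} {s s' : Chain X A B} {t t' : Chain X B C}
    (hs : s = s') (ht : t = t') :
    hcompHom (eqToHom hs) (eqToHom ht) = eqToHom (by rw [hs, ht]) := by
  subst hs ht; exact hcompHom_id s t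

theorem hcomp_assoc {A B C D : X} (s : Chain X A B) (t : Chain X B C) (r : Chain X C D) :
    (s.hcomp t).hcomp r = s.hcomp (t.hcomp r) := by
  simp [hcomp]

theorem hcompHom_assoc {A B C D : X} {s s' : Chain X A B} {t t' : Chain X B C}
    {r r' : Chain X C D} (x : s ⟶ s') (y : t ⟶ t') (z : r ⟶ r') :
    hcompHom (hcompHom x y) z ≫ eqToHom (hcomp_assoc s' t' r') =
      eqToHom (hcomp_assoc s t r) ≫ hcompHom x (hcompHom y z) :=
  comp_eqToHom_of_heq _ _ _ _ (Del.append_assoc x (Del.keep B y) (Del.keep C z))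

/-- The strict semi-2-functor `S_f : S_X̄ → S_Ȳ` of a function `f : X → Y` on hom-categories:
apply `f` to every letter of a chain. -/
def mapFunctor (f : X → Y) (A B : X) : Chain X A B ⥤ Chain Y (f A) (f B) where
  obj t := ⟨t.inner.map f⟩
  map u := Del.map f u
  map_id t := Del.map_id f t.inner
  map_comp u v := Del.map_comp f u v

theorem map_hcomp (f : X → Y) {A B C : X} (s : Chain X A B) (t : Chain X B C) :
    (mapFunctor f A C).obj (s.hcomp t) =
      ((mapFunctor f A B).obj s).hcomp ((mapFunctor f B C).obj t) := by
  simp [hcomp, mapFunctor]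

theorem map_hcompHom (f : X → Y) {A B C : X} {s s' : Chain X A B} {t t' : Chain X B C}
    (u : s ⟶ s') (v : t ⟶ t') :
    (mapFunctor f A C).map (hcompHom u v) ≫ eqToHom (map_hcomp f s' t') =
      eqToHom (map_hcomp f s t) ≫
        hcompHom ((mapFunctor f A B).map u) ((mapFunctor f B C).map v) :=
  comp_eqToHom_of_heq _ _ _ _ (Del.map_append f u (Del.keep B v))

theorem map_id_obj {A B : X} (t : Chain X A B) : (mapFunctor (fun x => x) A B).obj t = t := by
  simp [mapFunctor]

theorem map_id_map {A B : X} {t t' : Chain X A B} (u : t ⟶ t') :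
    (mapFunctor (fun x => x) A B).map u ≫ eqToHom (map_id_obj t') =
      eqToHom (map_id_obj t) ≫ u :=
  comp_eqToHom_of_heq _ _ _ _ (Del.map_id_fun u)

theorem map_map_obj (f : X → Y) (g : Y → Z) {A B : X} (t : Chain X A B) :
    (mapFunctor (fun x => g (f x)) A B).obj t =
      (mapFunctor g (f A) (f B)).obj ((mapFunctor f A B).obj t) := by
  simp [mapFunctor]

theorem map_map_map (f : X → Y) (g : Y → Z) {A B : X} {t t' : Chain X A B} (u : t ⟶ t') :
    (mapFunctor (fun x => g (f x)) A B).map u ≫ eqToHom (map_map_obj f g t') =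
      eqToHom (map_map_obj f g t) ≫ (mapFunctor g (f A) (f B)).map ((mapFunctor f A B).map u) :=
  comp_eqToHom_of_heq _ _ _ _ (Del.map_map f g u).symm

end Chain

/-! ## Pre-Co-Segal categories with a fixed set of objects -/

section

variable (M : Type u) [Category.{v} M] [MonoidalCategory M]

/-- A Pre-Co-Segal category with set of objects `X`: a lax morphism of semi-bicategories
`(S_X̄)^{2-op} → M`, where `M` is regarded as a bicategory with one object. There is no unit
datum, as `S_X̄` has no identity 1-morphisms. -/
structure PreCoSegal (X : Type w) where
  /-- The components `F_{AB} : S_X̄(A, B)ᵒᵖ ⥤ M`. -/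
  obj (A B : X) : (Chain X A B)ᵒᵖ ⥤ M
  /-- The laxity maps `φ_{s,t} : F s ⊗ F t ⟶ F (s ⊗ t)`. -/
  lax {A B C : X} (s : Chain X A B) (t : Chain X B C) :
    (obj A B).obj (op s) ⊗ (obj B C).obj (op t) ⟶ (obj A C).obj (op (s.hcomp t))
  /-- The laxity maps are natural in `s` and `t`. -/
  lax_natural {A B C : X} {s s' : Chain X A B} {t t' : Chain X B C} (u : s ⟶ s') (v : t ⟶ t') :
    ((obj A B).map u.op ⊗ₘ (obj B C).map v.op) ≫ lax s t =
      lax s' t' ≫ (obj A C).map (Chain.hcompHom u v).op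
  /-- The laxity maps are associative. -/
  lax_assoc {A B C D : X} (s : Chain X A B) (t : Chain X B C) (r : Chain X C D) :
    lax s t ▷ (obj C D).obj (op r) ≫ lax (s.hcomp t) r =
      (α_ _ _ _).hom ≫ (obj A B).obj (op s) ◁ lax t r ≫ lax s (t.hcomp r) ≫
        (obj A D).map (eqToHom (Chain.hcomp_assoc s t r)).op

variable {M}

namespace PreCoSegal

/-- A morphism of `M_S(X)`: a simple transformation (icon) of lax morphisms. -/
@[ext]
structure Hom {X : Type w} (F G : PreCoSegal M X) where
  /-- The natural transformations `σ_{AB} : F_{AB} ⟶ G_{AB}`. -/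
  app (A B : X) : F.obj A B ⟶ G.obj A B
  /-- Compatibility with the laxity maps. -/
  lax_app {A B C : X} (s : Chain X A B) (t : Chain X B C) :
    F.lax s t ≫ (app A C).app (op (s.hcomp t)) =
      ((app A B).app (op s) ⊗ₘ (app B C).app (op t)) ≫ G.lax s t

/-- The category `M_S(X)` of Pre-Co-Segal categories with set of objects `X`. -/
instance {X : Type w} : Category.{max w v} (PreCoSegal M X) where
  Hom F G := Hom F G
  id F := { app := fun A B => 𝟙 (F.obj A B), lax_app := by intros; simp }
  comp σ τ :=
    { app := fun A B => σ.app A B ≫ τ.app A B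
      lax_app := fun s t => by
        simp only [NatTrans.comp_app]
        rw [← Category.assoc, σ.lax_app, Category.assoc, τ.lax_app, ← Category.assoc,
          MonoidalCategory.tensorHom_comp_tensorHom] }
  id_comp σ := by apply Hom.ext; funext A B; exact Category.id_comp _
  comp_id σ := by apply Hom.ext; funext A B; exact Category.comp_id _
  assoc σ τ ρ := by apply Hom.ext; funext A B; exact Category.assoc _ _ _

theorem lax_eqToHom {X : Type w} (F : PreCoSegal M X) {A B C : X} {s s' : Chain X A B}
    {t t' : Chain X B C} (hs : s = s') (ht : t = t') :
    ((F.obj A B).map (eqToHom hs).op ⊗ₘ (F.obj B C).map (eqToHom ht).op) ≫ F.lax s t =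
      F.lax s' t' ≫ (F.obj A C).map (eqToHom (show s.hcomp t = s'.hcomp t' by rw [hs, ht])).op := by
  rw [F.lax_natural, Chain.hcompHom_eqToHom]

theorem lax_eqToHom_left {X : Type w} (F : PreCoSegal M X) {A B C : X} {s s' : Chain X A B}
    (hs : s = s') (t : Chain X B C) :
    (F.obj A B).map (eqToHom hs).op ▷ (F.obj B C).obj (op t) ≫ F.lax s t =
      F.lax s' t ≫ (F.obj A C).map (eqToHom (show s.hcomp t = s'.hcomp t by rw [hs])).op := by
  subst hs; simp

theorem lax_eqToHom_right {X : Type w} (F : PreCoSegal M X) {A B C : X} (s : Chain X A B)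
    {t t' : Chain X B C} (ht : t = t') :
    (F.obj A B).obj (op s) ◁ (F.obj B C).map (eqToHom ht).op ≫ F.lax s t =
      F.lax s t' ≫ (F.obj A C).map (eqToHom (show s.hcomp t = s.hcomp t' by rw [ht])).op := by
  subst ht; simp

/-- The pullback `f^⋆ G` of a Pre-Co-Segal category along a function `f : X → Y`: the composite
of `G` with the strict semi-2-functor `S_f`. -/
def pullback {X Y : Type w} (f : X → Y) (G : PreCoSegal M Y) : PreCoSegal M X where
  obj A B := (Chain.mapFunctor f A B).op ⋙ G.obj (f A) (f B)
  lax {A B C} s t :=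
    G.lax ((Chain.mapFunctor f A B).obj s) ((Chain.mapFunctor f B C).obj t) ≫
      (G.obj (f A) (f C)).map (eqToHom (Chain.map_hcomp f s t)).op
  lax_natural {A B C s s' t t'} u v := by
    have h := congrArg (fun x => (G.obj (f A) (f C)).map (Quiver.Hom.op x))
      (Chain.map_hcompHom f u v)
    simp only [op_comp, Functor.map_comp] at h
    simp only [Functor.comp_map, Functor.op_map, Quiver.Hom.unop_op, Category.assoc]
    erw [h, ← Category.assoc, ← Category.assoc, G.lax_natural]
  lax_assoc {A B C D} s t r := by
    simp only [Functor.comp_obj, Functor.op_obj, Functor.comp_map, Functor.op_map,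
      Quiver.Hom.unop_op, comp_whiskerRight, MonoidalCategory.whiskerLeft_comp, Category.assoc]
    slice_lhs 2 3 => rw [lax_eqToHom_left]
    slice_rhs 3 4 => rw [lax_eqToHom_right]
    slice_lhs 1 2 => rw [G.lax_assoc]
    simp only [Category.assoc, ← Functor.map_comp, ← op_comp, eqToHom_trans, eqToHom_map]

@[simp]
theorem id_app {X : Type w} (F : PreCoSegal M X) (A B : X) : Hom.app (𝟙 F) A B = 𝟙 (F.obj A B) :=
  rfl

@[simp]
theorem comp_app {X : Type w} {F G H : PreCoSegal M X} (σ : F ⟶ G) (τ : G ⟶ H) (A B : X) :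
    Hom.app (σ ≫ τ) A B = Hom.app σ A B ≫ Hom.app τ A B :=
  rfl

/-- The pullback `f^⋆` on morphisms. -/
def pullbackMap {X Y : Type w} (f : X → Y) {G H : PreCoSegal M Y} (σ : G ⟶ H) :
    pullback f G ⟶ pullback f H :=
  Hom.mk (fun A B => Functor.whiskerLeft (Chain.mapFunctor f A B).op (Hom.app σ (f A) (f B)))
    (fun {A B C} s t => by
      simp only [pullback, Functor.whiskerLeft_app, Functor.op_obj, Category.assoc]
      have h := (Hom.app σ (f A) (f C)).naturality (eqToHom (Chain.map_hcomp f s t)).op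
      erw [h, ← Category.assoc, Hom.lax_app σ]
      simp only [Category.assoc])

/-- The canonical map `F ⟶ id^⋆ F` (an equality on components). -/
def toPullbackId {X : Type w} (F : PreCoSegal M X) : F ⟶ pullback (fun x => x) F :=
  Hom.mk
    (fun A B =>
      { app := fun t => (F.obj A B).map (eqToHom (Chain.map_id_obj t.unop)).op
        naturality := fun t t' u => by
          have h := congrArg (fun x => (F.obj A B).map (Quiver.Hom.op x))
            (Chain.map_id_map u.unop)
          simp only [op_comp, Functor.map_comp] at h
          exact h.symm })
    (fun {A B C} s t => by
      simp only [pullback]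
      erw [← Category.assoc, F.lax_eqToHom]
      simp only [Category.assoc, ← Functor.map_comp, ← op_comp, eqToHom_trans])

/-- The canonical map `f^⋆ (g^⋆ H) ⟶ (g ∘ f)^⋆ H` (an equality on components). -/
def pullbackComp {X Y Z : Type w} (f : X → Y) (g : Y → Z) (H : PreCoSegal M Z) :
    pullback f (pullback g H) ⟶ pullback (fun x => g (f x)) H :=
  Hom.mk
    (fun A B =>
      { app := fun t =>
          (H.obj (g (f A)) (g (f B))).map (eqToHom (Chain.map_map_obj f g t.unop)).op
        naturality := fun t t' u => by
          have h := congrArg (fun x => (H.obj (g (f A)) (g (f B))).map (Quiver.Hom.op x))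
            (Chain.map_map_map f g u.unop)
          simp only [op_comp, Functor.map_comp] at h
          exact h.symm })
    (fun {A B C} s t => by
      simp only [pullback, Functor.op_map, Functor.comp_map, Quiver.Hom.unop_op, eqToHom_map,
        Category.assoc]
      erw [← Category.assoc (_ ⊗ₘ _), H.lax_eqToHom]
      simp only [Category.assoc, ← Functor.map_comp, ← op_comp, eqToHom_trans])

end PreCoSegal

/-! ## The total category `M_S(Set)` -/

variable (M) in
/-- An object `(X, F)` of `M_S(Set)`: a (possibly empty) set `X` together with a Pre-Co-Segal
category `F` with set of objects `X`. -/
structure TotalPreCoSegal where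
  /-- The set of objects. -/
  carrier : Type w
  /-- The Pre-Co-Segal category. -/
  diagram : PreCoSegal M carrier

namespace TotalPreCoSegal

/-- A morphism `(f, σ) : (X, F) ⟶ (Y, G)` of `M_S(Set)`: a function `f : X → Y` and a morphism
`σ : F ⟶ f^⋆ G` of `M_S(X)`. -/
structure Hom (F G : TotalPreCoSegal.{w} M) where
  /-- The function on objects. -/
  base : F.carrier → G.carrier
  /-- The morphism to the pullback. -/
  fiber : F.diagram ⟶ PreCoSegal.pullback base G.diagram

theorem Hom.mk_eq {F G : TotalPreCoSegal.{w} M} (f : F.carrier → G.carrier)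
    (σ τ : F.diagram ⟶ PreCoSegal.pullback f G.diagram)
    (h : ∀ (A B : F.carrier) (t : Chain F.carrier A B),
      (PreCoSegal.Hom.app σ A B).app (op t) = (PreCoSegal.Hom.app τ A B).app (op t)) :
    Hom.mk f σ = Hom.mk f τ := by
  congr 1
  apply PreCoSegal.Hom.ext
  funext A B
  ext t
  exact h A B t.unop

theorem comp_aux₁ {C : Type u} [Category.{v} C] {a b c d : C} {e : a ⟶ b} {r : b ⟶ c} {r' : a ⟶ d} {e' : d ⟶ c} {k : c ⟶ d}
    (h : e ≫ r = r' ≫ e') (hk : e' ≫ k = 𝟙 d) : e ≫ r ≫ k = r' := by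
  rw [← Category.assoc, h, Category.assoc, hk, Category.comp_id]

theorem comp_aux₂ {C : Type u} [Category.{v} C] {a b c d x y z p : C} {s : x ⟶ y} {t : y ⟶ a} {e : a ⟶ b} {r : b ⟶ c}
    {r' : a ⟶ d} {e' : d ⟶ c} {k₁ : c ⟶ z} {k₂ : d ⟶ p} {k₃ : p ⟶ z}
    (h : e ≫ r = r' ≫ e') (hk : e' ≫ k₁ = k₂ ≫ k₃) :
    (s ≫ t ≫ e) ≫ r ≫ k₁ = s ≫ (t ≫ r' ≫ k₂) ≫ k₃ := by
  simp only [Category.assoc]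
  rw [← Category.assoc e, h, Category.assoc, hk]

/-- The category `M_S(Set)` of all Pre-Co-Segal categories. -/
instance : Category.{max w v} (TotalPreCoSegal.{w} M) where
  Hom F G := Hom F G
  id F := ⟨fun x => x, PreCoSegal.toPullbackId F.diagram⟩
  comp {_ _ H} σ τ := ⟨fun x => τ.base (σ.base x),
    σ.fiber ≫ PreCoSegal.pullbackMap σ.base τ.fiber ≫
      PreCoSegal.pullbackComp σ.base τ.base H.diagram⟩
  id_comp {F G} σ := by
    refine Hom.mk_eq σ.base _ σ.fiber fun A B t => ?_
    refine comp_aux₁ ((PreCoSegal.Hom.app σ.fiber A B).naturality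
      (eqToHom (Chain.map_id_obj t)).op) ?_
    dsimp only [PreCoSegal.pullback, Functor.comp_map, Functor.op_map, Quiver.Hom.unop_op]
    rw [eqToHom_map]
    refine ((G.diagram.obj (σ.base A) (σ.base B)).map_comp _ _).symm.trans ?_
    rw [← op_comp, eqToHom_trans]
    exact (G.diagram.obj (σ.base A) (σ.base B)).map_id _
  comp_id {F G} σ := by
    refine Hom.mk_eq σ.base _ σ.fiber fun A B t => ?_
    refine (congrArg (fun x => (PreCoSegal.Hom.app σ.fiber A B).app (op t) ≫ x) ?_).trans
      (Category.comp_id _)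
    refine ((G.diagram.obj (σ.base A) (σ.base B)).map_comp _ _).symm.trans ?_
    dsimp only
    rw [← op_comp, eqToHom_trans]
    exact (G.diagram.obj (σ.base A) (σ.base B)).map_id _
  assoc {F G H K} σ τ ρ := by
    refine Hom.mk_eq _ _ _ fun A B t => ?_
    refine comp_aux₂ ((PreCoSegal.Hom.app ρ.fiber (τ.base (σ.base A))
      (τ.base (σ.base B))).naturality (eqToHom (Chain.map_map_obj σ.base τ.base t)).op) ?_
    refine ((K.diagram.obj _ _).map_comp _ _).symm.trans
      (Eq.trans ?_ ((K.diagram.obj _ _).map_comp _ _))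
    congr 1
    dsimp only [Functor.op_map, Quiver.Hom.unop_op]
    rw [← op_comp, ← op_comp, eqToHom_map, eqToHom_trans, eqToHom_trans]

end TotalPreCoSegal

end

end CoSegal

namespace CoSegal

/-! ### Deletions, and images of chains under functions -/

namespace Del

variable {X Y Z : Type w}

/-! Colimits. Given a diagram of Pre-Co-Segal categories and a cocone on their sets of objects with
vertex `b.pt`, there is a universal Pre-Co-Segal category on `b.pt` receiving the diagram. It is
given by generators and relations. A generator on a chain `t` is a lift of `t` to a chain at some
stage, contributing the value at that lift; the relations express compatibility with transition
maps, laxity maps and restrictions. A presented object exists because its value at `t` can be taken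
to be the colimit, in the base category, of a graph whose vertices are the formal composites (trees)
on `t` and whose edges are the relations closed under the axioms. Closedness and symmetry make the
tensor product preserve colimits in each variable, so grafting trees induces the laxity maps
(`Presentation.exists_presented`). For the colimit cocone of sets this gives colimits in the total
category; for the constant cocone with vertex `X` it gives colimits in the fibre over `X`. If the
indexing category is connected, the constant cocone is a colimit of sets, so the inclusion of a
fibre preserves connected colimits.

Local presentability. The criterion used is cocompleteness together with a small strong generator of
`κ`-presentable objects. The generators are free objects: a morphism from the free object on `G` at
a chain `t₀` of letters in `X` to `(Y, H)` is a function `f : X → Y` with a morphism from `G` to the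
value of `H` at `f(t₀)`. Such an object is `κ`-presentable when `G` is and `X` has fewer than `κ`
elements, because `κ`-filtered colimits can be computed chain by chain: the value at `t` is the
colimit over the category of lifts of `t`, which is itself `κ`-filtered. The difficulty is that
lifts of adjacent chains need not live at one stage or share their junction letter. Functions from
the vertex to one stage which are sections over a finite list of letters (`Sec`) lift several chains
at once and are cofinal among lifts.

For the total category, free objects at the universal chains with `n` inner letters suffice. The
initial object of the base category is added to the generators, since its free object detects
elements of the set of objects. All letter sets are finite, so the cardinal does not change. In the
fibre over `X` free objects at all chains of `X` are used, and `κ` is first enlarged beyond the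
cardinality of `X`. -/

/-- A deletion with given source and target words is determined by its sequence of keeps and drops,
which relabelling does not change. This holds even when `f` is not injective. -/
theorem map_injective (f : X → Y) {l l' : List X} (u v : Del l l') (h : map f u = map f v) :
    u = v := by
  induction u with
  | nil => cases v; rfl
  | keep a u ih =>
    cases v with
    | keep _ v => rw [ih v (by injection h)]
    | drop _ v => simp [map] at h
  | drop a u ih =>
    cases v with
    | keep _ v => simp [map] at h
    | drop _ v => rw [ih v (by injection h)]

theorem append_heq {l l' m m' k k' n n' : List X} {u : Del l l'} {v : Del m m'} {u' : Del k k'}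
    {v' : Del n n'} (h₁ : l = m) (h₂ : l' = m') (h₃ : k = n) (h₄ : k' = n') (e : HEq u v)
    (e' : HEq u' v') : HEq (append u u') (append v v') := by
  subst h₁ h₂ h₃ h₄ e e'; rfl

theorem map_heq (f : X → Y) {l l' m m' : List X} {u : Del l l'} {v : Del m m'}
    (h₁ : l = m) (h₂ : l' = m') (e : HEq u v) : HEq (map f u) (map f v) := by
  subst h₁ h₂ e; rfl

theorem id_heq {l m : List X} (h : l = m) : HEq (id l) (id m) := by
  subst h; rfl

/-- Deletions lift along maps of letters. -/
theorem exists_lift (f : X → Y) {m m' : List Y} (u : Del m m') (l : List X) (h : l.map f = m) :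
    ∃ (l' : List X) (v : Del l l'), l'.map f = m' ∧ HEq (map f v) u := by
  induction u generalizing l with
  | nil =>
    obtain rfl : l = [] := by simpa using h
    exact ⟨[], nil, rfl, HEq.rfl⟩
  | keep a u ih =>
    cases l with
    | nil => simp at h
    | cons b l =>
      simp only [List.map_cons, List.cons.injEq] at h
      obtain ⟨rfl, h⟩ := h
      obtain ⟨l', v, h', e⟩ := ih l h
      exact ⟨b :: l', keep b v, by simp [h'], keep_heq _ h h' e⟩
  | drop a u ih =>
    cases l with
    | nil => simp at h
    | cons b l =>
      simp only [List.map_cons, List.cons.injEq] at h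
      obtain ⟨rfl, h⟩ := h
      obtain ⟨l', v, h', e⟩ := ih l h
      exact ⟨l', drop b v, h', drop_heq _ h h' e⟩

end Del

namespace Chain

variable {X Y Z : Type w}

/-- The chain `t` in `Y` is the image of the chain `s` in `X` under `f : X → Y`. -/
structure MapsTo (f : X → Y) {A B : X} (s : Chain X A B) {A' B' : Y} (t : Chain Y A' B') :
    Prop where
  left : f A = A'
  right : f B = B'
  inner : s.inner.map f = t.inner

namespace MapsTo

theorem refl (f : X → Y) {A B : X} (s : Chain X A B) :
    MapsTo f s ((mapFunctor f A B).obj s) := ⟨rfl, rfl, rfl⟩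

theorem id {A B : X} (s : Chain X A B) : MapsTo (fun x => x) s s := ⟨rfl, rfl, by simp⟩

theorem comp {f : X → Y} {g : Y → Z} {A B : X} {s : Chain X A B} {A' B' : Y} {t : Chain Y A' B'}
    {A'' B'' : Z} {r : Chain Z A'' B''} (h : MapsTo f s t) (h' : MapsTo g t r) :
    MapsTo (fun x => g (f x)) s r :=
  ⟨by rw [h.left, h'.left], by rw [h.right, h'.right], by
    rw [← h'.inner, ← h.inner, List.map_map]; rfl⟩

theorem hcomp {f : X → Y} {A B C : X} {s : Chain X A B} {r : Chain X B C} {A' B' C' : Y}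
    {t : Chain Y A' B'} {q : Chain Y B' C'} (h : MapsTo f s t) (h' : MapsTo f r q) :
    MapsTo f (s.hcomp r) (t.hcomp q) :=
  ⟨h.left, h'.right, by simp [Chain.hcomp, h.inner, h'.inner, h.right]⟩

/-- Lets the transports along strict equalities of chains be treated as naturality with respect to
an identity deletion upstairs. -/
theorem heq_id {f : X → Y} {A B : X} {s : Chain X A B} {A' B' : Y} {t t' : Chain Y A' B'}
    (h : MapsTo f s t) (p : t = t') : HEq (Del.map f (𝟙 s)) (eqToHom p) := by
  subst p
  exact (heq_of_eq (Del.map_id f s.inner)).trans (Del.id_heq h.inner)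

theorem congr_fun {f g : X → Y} (hfg : f = g) {A B : X} {s : Chain X A B} {A' B' : Y}
    {t : Chain Y A' B'} (h : MapsTo f s t) : MapsTo g s t := hfg ▸ h

/-- Two chains with the same image under `g` have the same image under `f` as soon as
`f` factors through the image. -/
theorem factor {f : X → Y} {g : Y → Z} {k : X → Z} (hk : ∀ x, g (f x) = k x) {A B : X}
    {s : Chain X A B} {A' B' : Y} {t : Chain Y A' B'} {A'' B'' : Z} {r : Chain Z A'' B''}
    (h : MapsTo f s t) (h' : MapsTo k s r) : MapsTo g t r := by
  refine ⟨by rw [← h.left, hk, h'.left], by rw [← h.right, hk, h'.right], ?_⟩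
  rw [← h.inner, ← h'.inner, List.map_map]
  exact List.map_congr_left fun x _ => hk x

end MapsTo

end Chain

variable {M : Type u} [Category.{v} M] [MonoidalCategory M]

/-! ### Values on chains and morphisms over a fixed set of objects -/

namespace PreCoSegal

variable {X Y : Type w}

/-- The value of a Pre-Co-Segal category on a chain. -/
abbrev val (F : PreCoSegal M X) {A B : X} (s : Chain X A B) : M := (F.obj A B).obj (op s)

/-- The action of a Pre-Co-Segal category on a deletion. -/
abbrev res (F : PreCoSegal M X) {A B : X} {s s' : Chain X A B} (u : s ⟶ s') :
    F.val s' ⟶ F.val s := (F.obj A B).map u.op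

/-- The component of a morphism at a chain. -/
abbrev appAt {F G : PreCoSegal M X} (σ : F ⟶ G) {A B : X} (s : Chain X A B) :
    F.val s ⟶ G.val s := (Hom.app σ A B).app (op s)

theorem res_id (F : PreCoSegal M X) {A B : X} (s : Chain X A B) : F.res (𝟙 s) = 𝟙 (F.val s) :=
  (F.obj A B).map_id _

theorem res_comp (F : PreCoSegal M X) {A B : X} {s s' s'' : Chain X A B} (u : s ⟶ s')
    (v : s' ⟶ s'') : F.res (u ≫ v) = F.res v ≫ F.res u :=
  (F.obj A B).map_comp v.op u.op

theorem res_eqToHom (F : PreCoSegal M X) {A B : X} {s s' : Chain X A B} (h : s = s') :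
    F.res (eqToHom h) = eqToHom (by rw [h]) := by
  subst h
  exact F.res_id s

theorem appAt_res {F G : PreCoSegal M X} (σ : F ⟶ G) {A B : X} {s s' : Chain X A B}
    (u : s ⟶ s') : F.res u ≫ appAt σ s = appAt σ s' ≫ G.res u :=
  (Hom.app σ A B).naturality u.op

theorem appAt_lax {F G : PreCoSegal M X} (σ : F ⟶ G) {A B C : X} (s : Chain X A B)
    (t : Chain X B C) :
    F.lax s t ≫ appAt σ (s.hcomp t) = (appAt σ s ⊗ₘ appAt σ t) ≫ G.lax s t :=
  Hom.lax_app σ s t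

@[ext]
theorem hom_ext {F G : PreCoSegal M X} {σ τ : F ⟶ G}
    (h : ∀ {A B : X} (s : Chain X A B), appAt σ s = appAt τ s) : σ = τ := by
  apply Hom.ext
  funext A B
  ext s
  exact h s.unop

@[simp]
theorem appAt_comp {F G H : PreCoSegal M X} (σ : F ⟶ G) (τ : G ⟶ H) {A B : X}
    (s : Chain X A B) : appAt (σ ≫ τ) s = appAt σ s ≫ appAt τ s := rfl

/-- Build a morphism of `M_S(X)` from its components at chains. -/
def homMk {F G : PreCoSegal M X} (app : ∀ {A B : X} (s : Chain X A B), F.val s ⟶ G.val s)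
    (nat : ∀ {A B : X} {s s' : Chain X A B} (u : s ⟶ s'), F.res u ≫ app s = app s' ≫ G.res u)
    (lax : ∀ {A B C : X} (s : Chain X A B) (t : Chain X B C),
      F.lax s t ≫ app (s.hcomp t) = (app s ⊗ₘ app t) ≫ G.lax s t) : F ⟶ G :=
  Hom.mk (fun A B => { app := fun s => app s.unop, naturality := fun _ _ u => nat u.unop })
    (fun s t => lax s t)

@[simp]
theorem appAt_homMk {F G : PreCoSegal M X} (app : ∀ {A B : X} (s : Chain X A B), F.val s ⟶ G.val s)
    (nat) (lax) {A B : X} (s : Chain X A B) : appAt (homMk (F := F) (G := G) app nat lax) s = app s :=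
  rfl

/-- Build a Pre-Co-Segal category from its values on chains. -/
@[simps]
def mk' (val : ∀ {A B : X}, Chain X A B → M)
    (res : ∀ {A B : X} {s s' : Chain X A B}, (s ⟶ s') → (val s' ⟶ val s))
    (res_id : ∀ {A B : X} (s : Chain X A B), res (𝟙 s) = 𝟙 _)
    (res_comp : ∀ {A B : X} {s s' s'' : Chain X A B} (u : s ⟶ s') (v : s' ⟶ s''),
      res (u ≫ v) = res v ≫ res u)
    (lax : ∀ {A B C : X} (s : Chain X A B) (t : Chain X B C), val s ⊗ val t ⟶ val (s.hcomp t))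
    (lax_natural : ∀ {A B C : X} {s s' : Chain X A B} {t t' : Chain X B C} (u : s ⟶ s')
      (v : t ⟶ t'), (res u ⊗ₘ res v) ≫ lax s t = lax s' t' ≫ res (Chain.hcompHom u v))
    (lax_assoc : ∀ {A B C D : X} (s : Chain X A B) (t : Chain X B C) (r : Chain X C D),
      lax s t ▷ val r ≫ lax (s.hcomp t) r =
        (α_ _ _ _).hom ≫ val s ◁ lax t r ≫ lax s (t.hcomp r) ≫
          res (eqToHom (Chain.hcomp_assoc s t r))) : PreCoSegal M X where
  obj A B :=
    { obj := fun s => val s.unop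
      map := fun u => res u.unop
      map_id := fun s => res_id s.unop
      map_comp := fun u v => res_comp v.unop u.unop }
  lax s t := lax s t
  lax_natural u v := lax_natural u v
  lax_assoc s t r := lax_assoc s t r

end PreCoSegal

/-! ### Components of morphisms of the total category at chains -/

namespace TotalPreCoSegal

open Chain

variable {F G H : TotalPreCoSegal.{w} M}

/-- The component of a morphism of `M_S(Set)` at a chain `s`, with values at any chain `t` equal
to the image of `s`. -/
def Hom.at (φ : F ⟶ G) {A B : F.carrier} (s : Chain F.carrier A B) {A' B' : G.carrier}
    (t : Chain G.carrier A' B') (h : MapsTo (Hom.base φ) s t) :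
    F.diagram.val s ⟶ G.diagram.val t :=
  PreCoSegal.appAt (Hom.fiber φ) s ≫ eqToHom (by
    obtain ⟨m⟩ := t
    obtain ⟨rfl, rfl, rfl⟩ := h
    rfl)

theorem at_refl (φ : F ⟶ G) {A B : F.carrier} (s : Chain F.carrier A B) :
    Hom.at φ s _ (MapsTo.refl (Hom.base φ) s) = PreCoSegal.appAt (Hom.fiber φ) s :=
  Category.comp_id _

theorem hom_ext {φ ψ : F ⟶ G} (hb : Hom.base φ = Hom.base ψ)
    (h : ∀ {A B : F.carrier} (s : Chain F.carrier A B) {A' B' : G.carrier}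
      (t : Chain G.carrier A' B') (h₁ : MapsTo (Hom.base φ) s t) (h₂ : MapsTo (Hom.base ψ) s t),
      Hom.at φ s t h₁ = Hom.at ψ s t h₂) : φ = ψ := by
  obtain ⟨f, σ⟩ := φ
  obtain ⟨g, τ⟩ := ψ
  obtain rfl : f = g := hb
  refine Hom.mk_eq f σ τ fun A B s => ?_
  have := h s _ (MapsTo.refl f s) (MapsTo.refl f s)
  rwa [at_refl, at_refl] at this

theorem at_congr {φ ψ : F ⟶ G} (e : φ = ψ) {A B : F.carrier} (s : Chain F.carrier A B)
    {A' B' : G.carrier} (t : Chain G.carrier A' B') (h : MapsTo (Hom.base φ) s t) :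
    Hom.at φ s t h = Hom.at ψ s t (e ▸ h) := by
  subst e; rfl

/-- Once the three equalities in `MapsTo` are substituted, the target chains are literal images and
this is naturality of the fibre morphism. The form with `HEq` lets `t` and `t'` be any chains equal
to the images, so that later arguments need no transports. -/
theorem at_res (φ : F ⟶ G) {A B : F.carrier} {s s' : Chain F.carrier A B} (v : s ⟶ s')
    {A' B' : G.carrier} {t t' : Chain G.carrier A' B'} (u : t ⟶ t')
    (h : MapsTo (Hom.base φ) s t) (h' : MapsTo (Hom.base φ) s' t')
    (e : HEq (Del.map (Hom.base φ) v) u) :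
    Hom.at φ s' t' h' ≫ G.diagram.res u = F.diagram.res v ≫ Hom.at φ s t h := by
  obtain ⟨m⟩ := t
  obtain ⟨m'⟩ := t'
  have h₁ := h.left
  have h₂ := h.right
  have h₃ : s.inner.map _ = m := h.inner
  subst h₁ h₂ h₃
  have h₄ : s'.inner.map _ = m' := h'.inner
  subst h₄
  cases e
  have := PreCoSegal.appAt_res (Hom.fiber φ) v
  have e₁ := at_refl φ s
  have e₂ := at_refl φ s'
  erw [e₁, e₂]
  exact this.symm

theorem at_lax (φ : F ⟶ G) {A B C : F.carrier} (s : Chain F.carrier A B)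
    (r : Chain F.carrier B C) {A' B' C' : G.carrier} (t : Chain G.carrier A' B')
    (q : Chain G.carrier B' C') (h : MapsTo (Hom.base φ) s t) (h' : MapsTo (Hom.base φ) r q) :
    (Hom.at φ s t h ⊗ₘ Hom.at φ r q h') ≫ G.diagram.lax t q =
      F.diagram.lax s r ≫ Hom.at φ (s.hcomp r) (t.hcomp q) (h.hcomp h') := by
  obtain ⟨m⟩ := t
  obtain ⟨m'⟩ := q
  have h₁ := h.left
  have h₂ := h.right
  have h₃ : s.inner.map _ = m := h.inner
  subst h₁ h₂ h₃
  have h₄ := h'.right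
  have h₅ : r.inner.map _ = m' := h'.inner
  subst h₄ h₅
  have h := PreCoSegal.appAt_lax (Hom.fiber φ) s r
  have e₁ := at_refl φ s
  have e₂ := at_refl φ r
  erw [e₁, e₂]
  -- The image of a concatenation and the concatenation of the images are equal chains but not
  -- definitionally so. This compares the two components; `hinv` then cancels the transport built
  -- into the laxity of a pullback.
  have e₃ := at_res φ (𝟙 (s.hcomp r)) (eqToHom (map_hcomp (Hom.base φ) s r))
    (MapsTo.refl _ _) ((MapsTo.refl _ s).hcomp (MapsTo.refl _ r)) ((MapsTo.refl _ _).heq_id _)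
  rw [PreCoSegal.res_id, Category.id_comp, at_refl] at e₃
  rw [← e₃] at h
  simp only [PreCoSegal.pullback] at h
  have hinv : G.diagram.res (eqToHom (map_hcomp (Hom.base φ) s r)) ≫
      G.diagram.res (eqToHom (map_hcomp (Hom.base φ) s r).symm) = 𝟙 _ := by
    rw [← PreCoSegal.res_comp, eqToHom_trans, eqToHom_refl, PreCoSegal.res_id]
  have h2 := congrArg (· ≫ G.diagram.res (eqToHom (map_hcomp (Hom.base φ) s r).symm)) h
  simp only [Category.assoc] at h2
  erw [hinv] at h2
  simp only [Category.comp_id] at h2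
  exact h2.symm

theorem at_id {A B : F.carrier} (s : Chain F.carrier A B) (h : MapsTo (Hom.base (𝟙 F)) s s) :
    Hom.at (𝟙 F) s s h = 𝟙 _ := by
  change F.diagram.res (eqToHom (map_id_obj s)) ≫ eqToHom _ = _
  rw [PreCoSegal.res_eqToHom]
  exact eqToHom_trans _ _

theorem comp_eqToHom_eqToHom {C : Type*} [Category* C] {a b c d : C} (x : a ⟶ b) (y : b ⟶ c)
    (p : c = d) (q : d = c) : (x ≫ y ≫ eqToHom p) ≫ eqToHom q = x ≫ y := by
  subst p; simp

/-- Composition in the total category inserts the comparison `pullbackComp`, which is a transport at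
each chain. Since `Hom.at` ends in a transport of its own, the two cancel and composites are
computed plainly. -/
theorem at_comp (φ : F ⟶ G) (ψ : G ⟶ H) {A B : F.carrier} (s : Chain F.carrier A B)
    {A' B' : G.carrier} (t : Chain G.carrier A' B') {A'' B'' : H.carrier}
    (r : Chain H.carrier A'' B'') (h : MapsTo (Hom.base φ) s t) (h' : MapsTo (Hom.base ψ) t r)
    (h'' : MapsTo (Hom.base (φ ≫ ψ)) s r) :
    Hom.at (φ ≫ ψ) s r h'' = Hom.at φ s t h ≫ Hom.at ψ t r h' := by
  obtain ⟨m⟩ := t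
  obtain ⟨m'⟩ := r
  have h₁ := h.left
  have h₂ := h.right
  have h₃ : s.inner.map _ = m := h.inner
  subst h₁ h₂ h₃
  have h₄ := h'.left
  have h₅ := h'.right
  have h₆ : List.map _ (s.inner.map _) = m' := h'.inner
  subst h₄ h₅ h₆
  have e₁ := at_refl φ s
  have e₂ := at_refl ψ ((mapFunctor (Hom.base φ) A B).obj s)
  erw [e₁, e₂]
  change (PreCoSegal.appAt (Hom.fiber φ) s ≫
    PreCoSegal.appAt (Hom.fiber ψ) ((mapFunctor (Hom.base φ) A B).obj s) ≫
      H.diagram.res (eqToHom _)) ≫ eqToHom _ = _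
  rw [PreCoSegal.res_eqToHom]
  exact comp_eqToHom_eqToHom _ _ _ _

/-- Build a morphism of `M_S(Set)` from its components at chains. -/
def homMk (f : F.carrier → G.carrier)
    (app : ∀ {A B : F.carrier} (s : Chain F.carrier A B) {A' B' : G.carrier}
      (t : Chain G.carrier A' B'), MapsTo f s t → (F.diagram.val s ⟶ G.diagram.val t))
    (nat : ∀ {A B : F.carrier} {s s' : Chain F.carrier A B} (v : s ⟶ s') {A' B' : G.carrier}
      {t t' : Chain G.carrier A' B'} (u : t ⟶ t') (h : MapsTo f s t) (h' : MapsTo f s' t'),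
      HEq (Del.map f v) u → app s' t' h' ≫ G.diagram.res u = F.diagram.res v ≫ app s t h)
    (lax : ∀ {A B C : F.carrier} (s : Chain F.carrier A B) (r : Chain F.carrier B C)
      {A' B' C' : G.carrier} (t : Chain G.carrier A' B') (q : Chain G.carrier B' C')
      (h : MapsTo f s t) (h' : MapsTo f r q),
      (app s t h ⊗ₘ app r q h') ≫ G.diagram.lax t q =
        F.diagram.lax s r ≫ app (s.hcomp r) (t.hcomp q) (h.hcomp h')) : F ⟶ G :=
  Hom.mk f (PreCoSegal.homMk (G := PreCoSegal.pullback f G.diagram)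
    (fun s => app s _ (MapsTo.refl f s))
    (fun u => (nat u _ _ _ HEq.rfl).symm)
    (fun {A B C} s r => by
      have e := nat (𝟙 (s.hcomp r)) (eqToHom (map_hcomp f s r))
        (MapsTo.refl _ _) ((MapsTo.refl _ s).hcomp (MapsTo.refl _ r)) ((MapsTo.refl _ _).heq_id _)
      rw [PreCoSegal.res_id, Category.id_comp] at e
      change F.diagram.lax s r ≫ app (s.hcomp r) ((mapFunctor f A C).obj (s.hcomp r)) _ =
        (app s _ _ ⊗ₘ app r _ _) ≫ G.diagram.lax _ _ ≫
          G.diagram.res (eqToHom (map_hcomp f s r))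
      rw [← e, ← Category.assoc, ← lax, Category.assoc]))

theorem homMk_at (f : F.carrier → G.carrier)
    (app : ∀ {A B : F.carrier} (s : Chain F.carrier A B) {A' B' : G.carrier}
      (t : Chain G.carrier A' B'), MapsTo f s t → (F.diagram.val s ⟶ G.diagram.val t)) (nat) (lax)
    {A B : F.carrier} (s : Chain F.carrier A B) {A' B' : G.carrier} (t : Chain G.carrier A' B')
    (h : MapsTo f s t) :
    Hom.at (homMk (F := F) (G := G) f app nat lax) s t h = app s t h := by
  obtain ⟨m⟩ := t
  have h₁ := h.left
  have h₂ := h.right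
  have h₃ : s.inner.map _ = m := h.inner
  subst h₁ h₂ h₃
  exact at_refl (homMk (F := F) (G := G) f app nat lax) s

@[simp]
theorem base_comp (φ : F ⟶ G) (ψ : G ⟶ H) (x : F.carrier) :
    Hom.base (φ ≫ ψ) x = Hom.base ψ (Hom.base φ x) := rfl

end TotalPreCoSegal

/-! ## Colimits of graphs of objects, and tensor products -/

section Graph

variable {C : Type u} [Category.{v} C]

/-- A family of morphisms with the same codomain is jointly epimorphic. -/
def JointlyEpi {V : Type*} {x : V → C} {K : C} (i : ∀ a, x a ⟶ K) : Prop :=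
  ∀ ⦃Z : C⦄ (d d' : K ⟶ Z), (∀ a, i a ≫ d = i a ≫ d') → d = d'

/-- `K` is the colimit of a graph of objects and morphisms. -/
structure IsGraphColimit {V : Type*} {x : V → C} {E : V → V → Type*}
    (m : ∀ ⦃a b : V⦄, E a b → (x a ⟶ x b)) {K : C} (i : ∀ a, x a ⟶ K) : Prop where
  w : ∀ {a b : V} (e : E a b), m e ≫ i b = i a
  exists_desc : ∀ {Z : C} (φ : ∀ a, x a ⟶ Z), (∀ {a b : V} (e : E a b), m e ≫ φ b = φ a) →
    ∃ d : K ⟶ Z, ∀ a, i a ≫ d = φ a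
  jointlyEpi : JointlyEpi i

/-- The multicoequalizer imposing, for each edge out of `a`, that the identity of `x a` and the edge
morphism become equal. No composition of edges is required, which suits relations given inductively.
-/
theorem exists_isGraphColimit [HasColimitsOfSize.{w, w} C] {V : Type w} {x : V → C}
    {E : V → V → Type w}
    (m : ∀ ⦃a b : V⦄, E a b → (x a ⟶ x b)) :
    ∃ (K : C) (i : ∀ a, x a ⟶ K), IsGraphColimit m i := by
  let S : MultispanShape.{w, w} :=
    { L := Σ a b : V, E a b, R := V, fst := fun e => e.1, snd := fun e => e.2.1 }
  let I : MultispanIndex S C :=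
    { left := fun e => x e.1, right := x, fst := fun _ => 𝟙 _, snd := fun e => m e.2.2 }
  refine ⟨multicoequalizer I, Multicoequalizer.π I, ?_, ?_, ?_⟩
  · intro a b e
    have := Multicoequalizer.condition I ⟨a, b, e⟩
    exact this.symm.trans (Category.id_comp _)
  · intro Z φ h
    exact ⟨Multicoequalizer.desc I Z φ (fun e => (Category.id_comp _).trans (h e.2.2).symm),
      fun a => Multicoequalizer.π_desc _ _ _ _ _⟩
  · intro Z d d' h
    exact Multicoequalizer.hom_ext _ _ _ h

theorem IsGraphColimit.of_isColimit {J : Type*} [Category* J] {F : J ⥤ C} {c : Cocone F}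
    (hc : IsColimit c) :
    IsGraphColimit (x := F.obj) (E := fun a b => a ⟶ b) (fun _ _ f => F.map f) c.ι.app where
  w f := c.w f
  exists_desc φ h := ⟨hc.desc ⟨_, { app := φ, naturality := fun a b f => by simp [h f] }⟩,
    fun a => hc.fac _ a⟩
  jointlyEpi _ _ _ h := hc.hom_ext h

variable [MonoidalCategory C] [SymmetricCategory C] [MonoidalClosed C]

-- Tensoring on the left with `Y` is a left adjoint, so the test on `Y ⊗ K` is curried to a test on
-- `K`.
omit [SymmetricCategory C] in
theorem JointlyEpi.whiskerLeft {V : Type*} {x : V → C} {K : C} {i : ∀ a, x a ⟶ K}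
    (h : JointlyEpi i) (Y : C) : JointlyEpi fun a => Y ◁ i a := by
  intro Z d d' hd
  apply MonoidalClosed.curry_injective
  apply h
  intro a
  rw [← MonoidalClosed.curry_natural_left, ← MonoidalClosed.curry_natural_left, hd]

theorem JointlyEpi.whiskerRight {V : Type*} {x : V → C} {K : C} {i : ∀ a, x a ⟶ K}
    (h : JointlyEpi i) (Y : C) : JointlyEpi fun a => i a ▷ Y := by
  intro Z d d' hd
  rw [← cancel_epi (β_ Y K).hom]
  refine h.whiskerLeft Y _ _ fun a => ?_
  have := hd a
  simp only [BraidedCategory.braiding_naturality_right_assoc]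
  rw [this]

theorem JointlyEpi.tensor {V W : Type*} {x : V → C} {y : W → C} {K L : C} {i : ∀ a, x a ⟶ K}
    {j : ∀ b, y b ⟶ L} (hi : JointlyEpi i) (hj : JointlyEpi j) :
    JointlyEpi fun p : V × W => i p.1 ⊗ₘ j p.2 := by
  intro Z d d' hd
  refine hi.whiskerRight L _ _ fun a => ?_
  refine hj.whiskerLeft _ _ _ fun b => ?_
  simpa [tensorHom_def'] using hd (a, b)

omit [SymmetricCategory C] in
theorem IsGraphColimit.exists_whiskerLeft_desc {V : Type*} {x : V → C} {E : V → V → Type*}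
    {m : ∀ ⦃a b : V⦄, E a b → (x a ⟶ x b)} {K : C} {i : ∀ a, x a ⟶ K} (h : IsGraphColimit m i)
    {Y Z : C} (φ : ∀ a, Y ⊗ x a ⟶ Z) (hφ : ∀ {a b : V} (e : E a b), Y ◁ m e ≫ φ b = φ a) :
    ∃ d : Y ⊗ K ⟶ Z, ∀ a, Y ◁ i a ≫ d = φ a := by
  obtain ⟨d, hd⟩ := h.exists_desc (fun a => MonoidalClosed.curry (φ a)) (fun e => by
    rw [← MonoidalClosed.curry_natural_left, hφ])
  exact ⟨MonoidalClosed.uncurry d, fun a => by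
    rw [← MonoidalClosed.uncurry_natural_left, hd, MonoidalClosed.uncurry_curry]⟩

theorem IsGraphColimit.exists_whiskerRight_desc {V : Type*} {x : V → C} {E : V → V → Type*}
    {m : ∀ ⦃a b : V⦄, E a b → (x a ⟶ x b)} {K : C} {i : ∀ a, x a ⟶ K} (h : IsGraphColimit m i)
    {Y Z : C} (φ : ∀ a, x a ⊗ Y ⟶ Z) (hφ : ∀ {a b : V} (e : E a b), m e ▷ Y ≫ φ b = φ a) :
    ∃ d : K ⊗ Y ⟶ Z, ∀ a, i a ▷ Y ≫ d = φ a := by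
  obtain ⟨d, hd⟩ := h.exists_whiskerLeft_desc (fun a => (β_ Y (x a)).hom ≫ φ a) (fun e => by
    rw [BraidedCategory.braiding_naturality_right_assoc, hφ])
  exact ⟨(β_ Y K).inv ≫ d, fun a => by
    rw [BraidedCategory.braiding_inv_naturality_left_assoc, hd, Iso.inv_hom_id_assoc]⟩

/-- The tensor product preserves colimits in each variable: descend in the second variable for each
fixed `a`, then in the first. The compatibility needed for the second descent is checked on the
jointly epimorphic family of the first. -/
theorem IsGraphColimit.exists_tensor_desc {V W : Type*} {x : V → C} {y : W → C}
    {E : V → V → Type*} {E' : W → W → Type*} {m : ∀ ⦃a b : V⦄, E a b → (x a ⟶ x b)}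
    {n : ∀ ⦃a b : W⦄, E' a b → (y a ⟶ y b)} {K L : C} {i : ∀ a, x a ⟶ K} {j : ∀ b, y b ⟶ L}
    (hi : IsGraphColimit m i) (hj : IsGraphColimit n j) {Z : C} (φ : ∀ a b, x a ⊗ y b ⟶ Z)
    (h₁ : ∀ {a a' : V} (e : E a a') (b : W), m e ▷ y b ≫ φ a' b = φ a b)
    (h₂ : ∀ (a : V) {b b' : W} (e : E' b b'), x a ◁ n e ≫ φ a b' = φ a b) :
    ∃ d : K ⊗ L ⟶ Z, ∀ a b, (i a ⊗ₘ j b) ≫ d = φ a b := by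
  choose θ hθ using fun a => hj.exists_whiskerLeft_desc (φ a) (h₂ a)
  obtain ⟨d, hd⟩ := hi.exists_whiskerRight_desc θ (fun {a a'} e => by
    refine hj.jointlyEpi.whiskerLeft _ _ _ fun b => ?_
    rw [hθ, ← Category.assoc, whisker_exchange, Category.assoc, hθ, h₁])
  exact ⟨d, fun a b => by rw [tensorHom_def', Category.assoc, hd, hθ]⟩

end Graph

/-! ## Pre-Co-Segal categories given by generators and relations -/

section Presentation

variable {M : Type u} [Category.{v} M] [MonoidalCategory M] {X : Type w}

/-- Formal composites of generators sitting on chains. -/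
inductive Tree (Gen : ∀ ⦃A B : X⦄, Chain X A B → Type w) : ∀ {A B : X}, Chain X A B → Type w
  | leaf {A B : X} {t : Chain X A B} (g : Gen t) : Tree Gen t
  | node {A B C : X} {s : Chain X A B} {t : Chain X B C} (τ : Tree Gen s) (σ : Tree Gen t) :
      Tree Gen (s.hcomp t)
  | res {A B : X} {s t : Chain X A B} (u : s ⟶ t) (τ : Tree Gen t) : Tree Gen s

/-- The value of a formal composite: the tensor product of the values of the generators. -/
@[reducible]
def Tree.val {Gen : ∀ ⦃A B : X⦄, Chain X A B → Type w}
    (val : ∀ ⦃A B : X⦄ ⦃t : Chain X A B⦄, Gen t → M) :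
    ∀ {A B : X} {t : Chain X A B}, Tree Gen t → M
  | _, _, _, .leaf g => val g
  | _, _, _, .node τ σ => τ.val val ⊗ σ.val val
  | _, _, _, .res _ τ => τ.val val

/-- Evaluate a formal composite in a Pre-Co-Segal category. -/
def Tree.eval {Gen : ∀ ⦃A B : X⦄, Chain X A B → Type w}
    {val : ∀ ⦃A B : X⦄ ⦃t : Chain X A B⦄, Gen t → M} {H : PreCoSegal M X}
    (φ : ∀ ⦃A B : X⦄ ⦃t : Chain X A B⦄ (g : Gen t), val g ⟶ H.val t) :
    ∀ {A B : X} {t : Chain X A B} (τ : Tree Gen t), τ.val val ⟶ H.val t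
  | _, _, _, .leaf g => φ g
  | _, _, _, .node τ σ => (τ.eval φ ⊗ₘ σ.eval φ) ≫ H.lax _ _
  | _, _, _, .res u τ => τ.eval φ ≫ H.res u

variable (M X) in
/-- Generators and relations for a Pre-Co-Segal category. A relation between two formal
composites consists of a morphism between their values. -/
structure Presentation where
  /-- The generators on a chain. -/
  Gen : ∀ ⦃A B : X⦄, Chain X A B → Type w
  /-- The object of `M` freely adjoined by a generator. -/
  val : ∀ ⦃A B : X⦄ ⦃t : Chain X A B⦄, Gen t → M
  /-- The relations. -/
  Rel : ∀ ⦃A B : X⦄ ⦃t : Chain X A B⦄, Tree Gen t → Tree Gen t → Type w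
  /-- The morphisms of the relations. -/
  map : ∀ {A B : X} {t : Chain X A B} {τ σ : Tree Gen t}, Rel τ σ → (τ.val val ⟶ σ.val val)

namespace Presentation

variable (P : Presentation M X)

/-- The relations between formal composites generated by those of a presentation and the axioms
of Pre-Co-Segal categories. -/
inductive Edge : ∀ ⦃A B : X⦄ ⦃t : Chain X A B⦄, Tree P.Gen t → Tree P.Gen t → Type w
  | rel {A B : X} {t : Chain X A B} {τ σ : Tree P.Gen t} (r : P.Rel τ σ) : Edge τ σ
  | left {A B C : X} {s : Chain X A B} {t : Chain X B C} {τ τ' : Tree P.Gen s} (e : Edge τ τ')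
      (σ : Tree P.Gen t) : Edge (.node τ σ) (.node τ' σ)
  | right {A B C : X} {s : Chain X A B} {t : Chain X B C} (τ : Tree P.Gen s)
      {σ σ' : Tree P.Gen t} (e : Edge σ σ') : Edge (.node τ σ) (.node τ σ')
  | res {A B : X} {s t : Chain X A B} (u : s ⟶ t) {τ τ' : Tree P.Gen t} (e : Edge τ τ') :
      Edge (.res u τ) (.res u τ')
  | res_id {A B : X} {t : Chain X A B} (τ : Tree P.Gen t) : Edge (.res (𝟙 t) τ) τ
  | res_comp {A B : X} {s t r : Chain X A B} (u : s ⟶ t) (v : t ⟶ r) (τ : Tree P.Gen r) :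
      Edge (.res (u ≫ v) τ) (.res u (.res v τ))
  | natural {A B C : X} {s s' : Chain X A B} {t t' : Chain X B C} (u : s ⟶ s') (v : t ⟶ t')
      (τ : Tree P.Gen s') (σ : Tree P.Gen t') :
      Edge (.node (.res u τ) (.res v σ)) (.res (Chain.hcompHom u v) (.node τ σ))
  | assoc {A B C D : X} {s : Chain X A B} {t : Chain X B C} {r : Chain X C D}
      (τ : Tree P.Gen s) (σ : Tree P.Gen t) (ρ : Tree P.Gen r) :
      Edge (.node (.node τ σ) ρ)
        (.res (eqToHom (Chain.hcomp_assoc s t r)) (.node τ (.node σ ρ)))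

variable {P} in
/-- The morphism of a generated relation. -/
def Edge.map : ∀ {A B : X} {t : Chain X A B} {τ σ : Tree P.Gen t}, P.Edge τ σ →
    (τ.val P.val ⟶ σ.val P.val)
  | _, _, _, _, _, .rel r => P.map r
  | _, _, _, _, _, .left e σ => e.map ▷ σ.val P.val
  | _, _, _, _, _, .right τ e => τ.val P.val ◁ e.map
  | _, _, _, _, _, .res _ e => e.map
  | _, _, _, _, _, .res_id _ => 𝟙 _
  | _, _, _, _, _, .res_comp _ _ _ => 𝟙 _
  | _, _, _, _, _, .natural _ _ _ _ => 𝟙 _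
  | _, _, _, _, _, .assoc _ _ _ => (α_ _ _ _).hom

/-- A family of morphisms from the generators to a Pre-Co-Segal category that respects the
relations. -/
structure Model (H : PreCoSegal M X) where
  /-- The morphisms. -/
  app : ∀ ⦃A B : X⦄ ⦃t : Chain X A B⦄ (g : P.Gen t), P.val g ⟶ H.val t
  /-- The relations hold. -/
  rel : ∀ {A B : X} {t : Chain X A B} {τ σ : Tree P.Gen t} (r : P.Rel τ σ),
    P.map r ≫ σ.eval app = τ.eval app

variable {P}

/-- Apart from the given relations and the closure under tree constructors, each kind of edge is an
axiom of Pre-Co-Segal categories, and `H` satisfies these axioms. Hence evaluation of trees is a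
cocone on the graph. -/
theorem Model.edge {H : PreCoSegal M X} (φ : P.Model H) {A B : X} {t : Chain X A B}
    {τ σ : Tree P.Gen t} (e : P.Edge τ σ) : e.map ≫ σ.eval φ.app = τ.eval φ.app := by
  induction e with
  | rel r => exact φ.rel r
  | left e σ ih =>
    simp only [Edge.map, Tree.eval]
    rw [← ih, ← Category.assoc, ← tensorHom_id, tensorHom_comp_tensorHom, Category.id_comp]
  | right τ e ih =>
    simp only [Edge.map, Tree.eval]
    rw [← ih, ← Category.assoc, ← id_tensorHom, tensorHom_comp_tensorHom, Category.id_comp]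
  | res u e ih =>
    simp only [Edge.map, Tree.eval]
    rw [← ih, Category.assoc]
  | res_id τ =>
    simp only [Edge.map, Tree.eval, PreCoSegal.res_id]
    exact (Category.id_comp _).trans (Category.comp_id _).symm
  | res_comp u v τ =>
    simp only [Edge.map, Tree.eval, PreCoSegal.res_comp]
    exact (Category.id_comp _).trans (Category.assoc _ _ _)
  | natural u v τ σ =>
    simp only [Edge.map, Tree.eval]
    rw [← tensorHom_comp_tensorHom, Category.assoc, Category.assoc, H.lax_natural]
    exact Category.id_comp _
  | assoc τ σ ρ =>
    simp only [Edge.map, Tree.eval]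
    have e₁ : ((τ.eval φ.app ⊗ₘ σ.eval φ.app) ≫ H.lax _ _) ⊗ₘ ρ.eval φ.app =
        ((τ.eval φ.app ⊗ₘ σ.eval φ.app) ⊗ₘ ρ.eval φ.app) ≫ H.lax _ _ ▷ _ := by
      rw [← tensorHom_id, tensorHom_comp_tensorHom, Category.comp_id]
    have e₂ : τ.eval φ.app ⊗ₘ ((σ.eval φ.app ⊗ₘ ρ.eval φ.app) ≫ H.lax _ _) =
        (τ.eval φ.app ⊗ₘ (σ.eval φ.app ⊗ₘ ρ.eval φ.app)) ≫ _ ◁ H.lax _ _ := by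
      rw [← id_tensorHom, tensorHom_comp_tensorHom, Category.comp_id]
    rw [e₁, e₂]
    simp only [Category.assoc]
    rw [H.lax_assoc, ← associator_naturality_assoc]

/-- The value at `t` is the graph colimit over all trees on `t`. The tree constructors `res` and
`node` induce restriction and laxity, the latter because tensor products of two such colimits are
colimits over pairs of trees. Each axiom can be tested on trees, where it is one of the edges. -/
theorem exists_presented_aux [SymmetricCategory M] [MonoidalClosed M]
    [HasColimitsOfSize.{w, w} M] (P : Presentation M X) :
    ∃ (K : PreCoSegal M X)
      (i : ∀ {A B : X} {t : Chain X A B} (τ : Tree P.Gen t), τ.val P.val ⟶ K.val t),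
      (∀ {A B : X} (t : Chain X A B), IsGraphColimit (x := fun τ : Tree P.Gen t => τ.val P.val)
        (E := fun τ σ => P.Edge τ σ) (fun _ _ e => e.map) (K := K.val t) i) ∧
      (∀ {A B : X} {s t : Chain X A B} (u : s ⟶ t) (τ : Tree P.Gen t),
        i τ ≫ K.res u = i (.res u τ)) ∧
      (∀ {A B C : X} {s : Chain X A B} {t : Chain X B C} (τ : Tree P.Gen s) (σ : Tree P.Gen t),
        (i τ ⊗ₘ i σ) ≫ K.lax s t = i (.node τ σ)) := by
  choose K i hK using fun (A B : X) (t : Chain X A B) =>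
    exists_isGraphColimit (x := fun τ : Tree P.Gen t => τ.val P.val) (E := fun τ σ => P.Edge τ σ)
      (fun _ _ e => e.map)
  replace hK : ∀ {A B : X} (t : Chain X A B), IsGraphColimit
    (x := fun τ : Tree P.Gen t => τ.val P.val) (E := fun τ σ => P.Edge τ σ) (fun _ _ e => e.map) (i A B t) :=
    fun t => hK _ _ t
  choose res hres using fun {A B : X} {s t : Chain X A B} (u : s ⟶ t) =>
    (hK t).exists_desc (fun τ => i A B s (.res u τ)) (fun e => (hK s).w (.res u e))
  choose lax hlax using fun {A B C : X} (s : Chain X A B) (t : Chain X B C) =>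
    (hK s).exists_tensor_desc (hK t) (fun τ σ => i A C (s.hcomp t) (.node τ σ))
      (fun e σ => (hK _).w (.left e σ)) (fun τ _ _ e => (hK _).w (.right τ e))
  let K' : PreCoSegal M X := PreCoSegal.mk' (fun t => K _ _ t) (fun u => res u)
    (fun {A B} t => (hK t).jointlyEpi _ _ fun τ => by
      rw [hres, Category.comp_id, ← (hK t).w (.res_id τ)]
      exact Category.id_comp _)
    (fun {A B s t r} u v => (hK r).jointlyEpi _ _ fun τ => by
      rw [hres, ← Category.assoc, hres, hres, ← (hK s).w (.res_comp u v τ)]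
      exact (Category.id_comp _))
    (fun s t => lax s t)
    (fun {A B C s s' t t'} u v => ((hK s').jointlyEpi.tensor (hK t').jointlyEpi) _ _ (by
      rintro ⟨τ, σ⟩
      simp only []
      rw [tensorHom_comp_tensorHom_assoc, hres, hres, hlax, ← Category.assoc, hlax, hres,
        ← (hK (s.hcomp t)).w (.natural u v τ σ)]
      exact (Category.id_comp _)))
    (fun {A B C D} s t r =>
      (((hK s).jointlyEpi.tensor (hK t).jointlyEpi).tensor (hK r).jointlyEpi) _ _ (by
      rintro ⟨⟨τ, σ⟩, ρ⟩
      simp only []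
      rw [associator_naturality_assoc, ← tensorHom_id, tensorHom_comp_tensorHom_assoc, hlax,
        Category.comp_id, hlax, ← id_tensorHom, tensorHom_comp_tensorHom_assoc, hlax,
        Category.comp_id, ← Category.assoc (_ ⊗ₘ _), hlax, hres,
        ← (hK ((s.hcomp t).hcomp r)).w (.assoc τ σ ρ)]
      rfl))
  exact ⟨K', fun τ => i _ _ _ τ, fun t => hK t, fun u τ => hres u τ, fun τ σ => hlax _ _ τ σ⟩

/-- A model in `H` evaluates every tree, compatibly with the edges, and so descends to the graph
colimits. Uniqueness is an induction on trees: compatibility with laxity and restriction fixes a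
morphism once it is known on leaves. -/
theorem exists_presented [SymmetricCategory M] [MonoidalClosed M] [HasColimitsOfSize.{w, w} M]
    (P : Presentation M X) :
    ∃ (K : PreCoSegal M X) (κ : P.Model K), ∀ (H : PreCoSegal M X) (φ : P.Model H),
      ∃! m : K ⟶ H, ∀ {A B : X} {t : Chain X A B} (g : P.Gen t),
        κ.app g ≫ PreCoSegal.appAt m t = φ.app g := by
  obtain ⟨K, i, hK, hres, hlax⟩ := P.exists_presented_aux
  -- Evaluating a tree by the leaf inclusions returns the inclusion of that tree, so the edges
  -- coming from the given relations show that the leaf inclusions form a model.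
  have hi : ∀ {A B : X} {t : Chain X A B} (τ : Tree P.Gen t),
      τ.eval (fun _ _ _ g => i (.leaf g)) = i τ := by
    intro A B t τ
    induction τ with
    | leaf g => rfl
    | node τ σ ih₁ ih₂ => simp only [Tree.eval, ih₁, ih₂, hlax]
    | res u τ ih =>
      simp only [Tree.eval, ih]
      exact hres _ _
  refine ⟨K, ⟨fun _ _ _ g => i (.leaf g), fun r => by rw [hi, hi]; exact (hK _).w (.rel r)⟩,
    fun H φ => ?_⟩
  choose m hm using fun {A B : X} (t : Chain X A B) =>
    (hK t).exists_desc (fun τ => τ.eval φ.app) (fun e => φ.edge e)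
  refine ⟨PreCoSegal.homMk m ?_ ?_, fun g => hm _ (.leaf g), ?_⟩
  · intro A B s s' u
    refine (hK s').jointlyEpi _ _ fun τ => ?_
    rw [← Category.assoc, hres, hm, ← Category.assoc, hm]
    rfl
  · intro A B C s t
    refine ((hK s).jointlyEpi.tensor (hK t).jointlyEpi) _ _ ?_
    rintro ⟨τ, σ⟩
    rw [← Category.assoc, hlax, hm, ← Category.assoc, tensorHom_comp_tensorHom, hm, hm]
    rfl
  · intro m' hm'
    apply PreCoSegal.hom_ext
    intro A B t
    refine (hK t).jointlyEpi _ _ fun τ => ?_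
    rw [PreCoSegal.appAt_homMk, hm]
    induction τ with
    | leaf g => exact hm' g
    | node τ σ ih₁ ih₂ =>
      rw [← hlax, Category.assoc, PreCoSegal.appAt_lax, ← Category.assoc,
        tensorHom_comp_tensorHom, ih₁, ih₂]
      rfl
    | res u τ ih =>
      rw [← hres, Category.assoc, PreCoSegal.appAt_res, ← Category.assoc, ih]
      rfl

end Presentation

end Presentation

variable {M : Type u} [Category.{v} M] [MonoidalCategory M]

/-! ### Relative colimits over a cocone of sets of objects -/

namespace Chain

variable {X Y Z : Type w}

theorem MapsTo.map_comp_heq {f : X → Y} {g : Y → Z} {k : X → Z} (hk : ∀ x, k x = g (f x))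
    {A B : X} {s s' : Chain X A B} {A' B' : Y} {t t' : Chain Y A' B'} (h : MapsTo f s t)
    (h' : MapsTo f s' t') {v : s ⟶ s'} {u : t ⟶ t'} (e : HEq (Del.map f v) u) :
    HEq (Del.map k v) (Del.map g u) := by
  obtain rfl : k = fun x => g (f x) := funext hk
  exact (Del.map_map f g v).symm.trans (Del.map_heq g h.inner h'.inner e)

theorem MapsTo.comp' {f : X → Y} {g : Y → Z} {k : X → Z} (hk : ∀ x, k x = g (f x)) {A B : X}
    {s : Chain X A B} {A' B' : Y} {t : Chain Y A' B'} {A'' B'' : Z} {r : Chain Z A'' B''}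
    (h : MapsTo f s t) (h' : MapsTo g t r) : MapsTo k s r := by
  obtain rfl : k = fun x => g (f x) := funext hk
  exact h.comp h'

/-- Reduces statements about any chain equal to the image of `s` to the literal image, where
`Hom.at` is the component of the fibre morphism. -/
theorem MapsTo.ind {f : X → Y} {A B : X} {s : Chain X A B}
    {motive : ∀ {A' B' : Y} (t : Chain Y A' B'), MapsTo f s t → Prop}
    (refl : motive _ (MapsTo.refl f s)) {A' B' : Y} {t : Chain Y A' B'} (h : MapsTo f s t) :
    motive t h := by
  obtain ⟨m⟩ := t
  have h₁ := h.left
  have h₂ := h.right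
  have h₃ : s.inner.map _ = m := h.inner
  subst h₁ h₂ h₃
  exact refl

end Chain

open Chain

namespace TotalPreCoSegal

theorem at_eqToHom {F G : TotalPreCoSegal.{w} M} (φ : F ⟶ G) {A B : F.carrier}
    (s : Chain F.carrier A B) {A' B' : G.carrier} {t t' : Chain G.carrier A' B'} (p : t = t')
    (h : MapsTo (Hom.base φ) s t) (h' : MapsTo (Hom.base φ) s t') :
    Hom.at φ s t' h' ≫ G.diagram.res (eqToHom p) = Hom.at φ s t h := by
  subst p
  rw [eqToHom_refl, PreCoSegal.res_id, Category.comp_id]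

/-- The forgetful functor from Pre-Co-Segal categories to sets. -/
@[simps obj]
def carrierFunctor : TotalPreCoSegal.{w} M ⥤ Type w where
  obj F := F.carrier
  map φ := ↾(Hom.base φ)
  map_id _ := rfl
  map_comp _ _ := rfl

end TotalPreCoSegal

open TotalPreCoSegal

variable {J : Type w} [Category.{w} J] {D : J ⥤ TotalPreCoSegal.{w} M}

/-- A cocone under the sets of objects of a diagram of Pre-Co-Segal categories. -/
structure BaseCocone (D : J ⥤ TotalPreCoSegal.{w} M) where
  /-- The vertex. -/
  pt : Type w
  /-- The legs. -/
  ι (j : J) : (D.obj j).carrier → pt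
  w {i j : J} (f : i ⟶ j) (x : (D.obj i).carrier) : ι j (Hom.base (D.map f) x) = ι i x

/-- A lift of a chain in the vertex of a base cocone to some stage of the diagram. -/
structure Lift (b : BaseCocone D) {A B : b.pt} (t : Chain b.pt A B) where
  /-- The stage. -/
  stage : J
  /-- The start of the lift. -/
  src : (D.obj stage).carrier
  /-- The end of the lift. -/
  tgt : (D.obj stage).carrier
  /-- The lift. -/
  chain : Chain (D.obj stage).carrier src tgt
  mapsTo : MapsTo (b.ι stage) chain t

/-- A cocone in the category of Pre-Co-Segal categories over a given base cocone. -/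
structure RelCocone (b : BaseCocone D) where
  /-- The Pre-Co-Segal category at the vertex. -/
  diagram : PreCoSegal M b.pt
  /-- The legs. -/
  leg (j : J) : D.obj j ⟶ TotalPreCoSegal.mk b.pt diagram
  base_leg (j : J) : Hom.base (leg j) = b.ι j
  w {i j : J} (f : i ⟶ j) : D.map f ≫ leg j = leg i

/-- The universal property of a colimit relative to the base cocone. -/
def RelCocone.IsUniversal {b : BaseCocone D} (c : RelCocone b) : Prop :=
  ∀ ⦃H : TotalPreCoSegal.{w} M⦄ (f : b.pt → H.carrier) (d : ∀ j, D.obj j ⟶ H),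
    (∀ {i j : J} (g : i ⟶ j), D.map g ≫ d j = d i) →
      (∀ j x, Hom.base (d j) x = f (b.ι j x)) →
        ∃! m : TotalPreCoSegal.mk b.pt c.diagram ⟶ H, Hom.base m = f ∧ ∀ j, c.leg j ≫ m = d j

namespace BaseCocone

/-- The relations in a colimit. -/
inductive ColimitRel (b : BaseCocone D) : ∀ ⦃A B : b.pt⦄ ⦃t : Chain b.pt A B⦄,
    Tree (fun _ _ t => Lift b t) t → Tree (fun _ _ t => Lift b t) t → Type w
  | trans {A B : b.pt} {t : Chain b.pt A B} (x y : Lift b t) (f : x.stage ⟶ y.stage)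
      (h : MapsTo (Hom.base (D.map f)) x.chain y.chain) : ColimitRel b (.leaf x) (.leaf y)
  | lax (j : J) {x y z : (D.obj j).carrier} (s : Chain _ x y) (r : Chain _ y z)
      {A B C : b.pt} (t : Chain b.pt A B) (q : Chain b.pt B C) (h : MapsTo (b.ι j) s t)
      (h' : MapsTo (b.ι j) r q) :
      ColimitRel b (.node (.leaf ⟨j, x, y, s, h⟩) (.leaf ⟨j, y, z, r, h'⟩))
        (.leaf ⟨j, x, z, s.hcomp r, h.hcomp h'⟩)
  | res (j : J) {x y : (D.obj j).carrier} {s s' : Chain _ x y} (v : s ⟶ s')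
      {A B : b.pt} {t t' : Chain b.pt A B} (u : t ⟶ t') (h : MapsTo (b.ι j) s t)
      (h' : MapsTo (b.ι j) s' t') (e : HEq (Del.map (b.ι j) v) u) :
      ColimitRel b (.res u (.leaf ⟨j, x, y, s', h'⟩)) (.leaf ⟨j, x, y, s, h⟩)

/-- The morphisms of the relations in a colimit. -/
def ColimitRel.map {b : BaseCocone D} : ∀ {A B : b.pt} {t : Chain b.pt A B}
    {τ σ : Tree (fun _ _ t => Lift b t) t}, b.ColimitRel τ σ →
      (τ.val (M := M) (fun _ _ _ x => (D.obj x.stage).diagram.val x.chain) ⟶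
        σ.val (fun _ _ _ x => (D.obj x.stage).diagram.val x.chain))
  | _, _, _, _, _, .trans x y f h => Hom.at (D.map f) x.chain y.chain h
  | _, _, _, _, _, .lax j s r _ _ _ _ => (D.obj j).diagram.lax s r
  | _, _, _, _, _, .res j v _ _ _ _ => (D.obj j).diagram.res v

/-- The presentation of a colimit relative to a base cocone. -/
@[reducible]
def colimitPresentation (b : BaseCocone D) : Presentation M b.pt where
  Gen _ _ t := Lift b t
  val _ _ _ x := (D.obj x.stage).diagram.val x.chain
  Rel := b.ColimitRel
  map r := r.map

/-- The legs of the cocone given by a model of the presentation. -/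
def legOfModel {b : BaseCocone D} {K : PreCoSegal M b.pt} (κ : b.colimitPresentation.Model K)
    (j : J) : D.obj j ⟶ TotalPreCoSegal.mk b.pt K :=
  TotalPreCoSegal.homMk (b.ι j) (fun s _ _ t h => κ.app (t := t) ⟨j, _, _, s, h⟩)
    (fun v _ _ _ _ u h h' e => (κ.rel (.res j v u h h' e)).symm)
    (fun s r _ _ _ t q h h' => (κ.rel (.lax j s r t q h h')).symm)

theorem at_legOfModel {b : BaseCocone D} {K : PreCoSegal M b.pt}
    (κ : b.colimitPresentation.Model K) (j : J) {x y : (D.obj j).carrier} (s : Chain _ x y)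
    {A B : b.pt} (t : Chain b.pt A B) (h : MapsTo (b.ι j) s t) :
    Hom.at (legOfModel κ j) s t h = κ.app (t := t) ⟨j, x, y, s, h⟩ :=
  homMk_at (G := TotalPreCoSegal.mk b.pt K) _ _ _ _ s t h

/-- The cocone given by a model of the presentation. -/
@[reducible]
def coconeOfModel {b : BaseCocone D} {K : PreCoSegal M b.pt} (κ : b.colimitPresentation.Model K) :
    RelCocone b where
  diagram := K
  leg j := legOfModel κ j
  base_leg _ := rfl
  w {i j} f := by
    refine TotalPreCoSegal.hom_ext (funext (b.w f)) fun s A' B' t h₁ h₂ => ?_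
    rw [at_comp (D.map f) (legOfModel κ j) s _ t (MapsTo.refl _ s)
      ((MapsTo.refl _ s).factor (b.w f) h₂)]
    rw [at_legOfModel, at_legOfModel κ i s t h₂]
    exact κ.rel (ColimitRel.trans (b := b) (t := t) ⟨i, _, _, s, h₂⟩
      ⟨j, _, _, _, (MapsTo.refl _ s).factor (b.w f) h₂⟩ f (MapsTo.refl _ s))

/-- A compatible family `d` lying over `f` is the same as a model of the presentation in the
pullback of `H` along `f`. The three kinds of relation become functoriality, compatibility with
laxity, and naturality of `d`. An initial model therefore yields a universal cocone. -/
theorem coconeOfModel_isUniversal {b : BaseCocone D} {K : PreCoSegal M b.pt}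
    (κ : b.colimitPresentation.Model K)
    (hK : ∀ (H : PreCoSegal M b.pt) (φ : b.colimitPresentation.Model H),
      ∃! m : K ⟶ H, ∀ {A B : b.pt} {t : Chain b.pt A B} (g : b.colimitPresentation.Gen t),
        κ.app g ≫ PreCoSegal.appAt m t = φ.app g) : (coconeOfModel κ).IsUniversal := by
  let leg := legOfModel κ
  have hleg (j : J) {x y : (D.obj j).carrier} (s : Chain _ x y) {A B : b.pt} (t : Chain b.pt A B)
      (h : MapsTo (b.ι j) s t) : Hom.at (leg j) s t h = κ.app (t := t) ⟨j, x, y, s, h⟩ :=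
    at_legOfModel κ j s t h
  intro H f d hd hf
  -- All lifts of `t` are sent by `d` to the one chain `f(t)`, so their components share the target
  -- required of a model in the pullback.
  have hx {A B : b.pt} {t : Chain b.pt A B} (x : Lift b t) :
      MapsTo (Hom.base (d x.stage)) x.chain ((mapFunctor f A B).obj t) :=
    x.mapsTo.comp' (hf x.stage) (MapsTo.refl f t)
  obtain ⟨σ, hm, hm'⟩ := hK (PreCoSegal.pullback f H.diagram)
    ⟨fun _ _ _ x => Hom.at (d x.stage) x.chain _ (hx x), fun {A B t τ σ} r => by
      cases r with
      | trans x y g h =>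
        exact (at_comp (D.map g) (d y.stage) x.chain y.chain ((mapFunctor f A B).obj t) h (hx y)
          (by rw [hd]; exact hx x)).symm.trans
          (at_congr (hd g) _ _ _)
      | lax j s r t q h h' =>
        have e := at_lax (d j) s r _ _ (hx ⟨j, _, _, s, h⟩) (hx ⟨j, _, _, r, h'⟩)
        have e' := at_eqToHom (d j) (s.hcomp r) (map_hcomp f t q)
          (hx ⟨j, _, _, s.hcomp r, h.hcomp h'⟩)
          ((hx ⟨j, _, _, s, h⟩).hcomp (hx ⟨j, _, _, r, h'⟩))
        refine Eq.trans ?_ (Category.assoc _ _ _)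
        refine Eq.trans ?_ (congrArg (· ≫ H.diagram.res (eqToHom (map_hcomp f t q))) e).symm
        refine Eq.trans ?_ (Category.assoc _ _ _).symm
        exact congrArg (fun z => (D.obj j).diagram.lax s r ≫ z) e'.symm
      | res j v u h h' e =>
        exact (at_res (d j) v ((mapFunctor f _ _).map u) (hx ⟨j, _, _, _, h⟩)
          (hx ⟨j, _, _, _, h'⟩) (h.map_comp_heq (hf j) h' e)).symm⟩
  -- Translates factorization through the legs into equations on generators; it serves both
  -- existence and uniqueness of `m`.
  have key (j : J) (m : TotalPreCoSegal.mk b.pt K ⟶ H) (hmf : Hom.base m = f) :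
      leg j ≫ m = d j ↔ ∀ {x y : (D.obj j).carrier} (s : Chain _ x y) {A B : b.pt}
        (t : Chain b.pt A B) (h : MapsTo (b.ι j) s t),
        κ.app (t := t) ⟨j, x, y, s, h⟩ ≫ Hom.at m t _ (hmf ▸ MapsTo.refl f t) =
          Hom.at (d j) s _ (hx ⟨j, x, y, s, h⟩) := by
    subst hmf
    constructor
    · intro e x y s A B t h
      have h₁ : MapsTo (Hom.base (leg j ≫ m)) s ((mapFunctor (Hom.base m) A B).obj t) :=
        h.comp (MapsTo.refl _ t)
      exact (congrArg (· ≫ _) (hleg j s t h)).symm.trans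
        ((at_comp (leg j) m s t _ h (MapsTo.refl _ t) h₁).symm.trans (at_congr e s _ h₁))
    · intro e
      refine TotalPreCoSegal.hom_ext (funext fun x => (hf j x).symm) fun s A' B' r h₁ h₂ => ?_
      have h₃ : MapsTo (Hom.base m) ((mapFunctor (b.ι j) _ _).obj s) r :=
        (MapsTo.refl (b.ι j) s).factor (fun _ => rfl) h₁
      refine (at_comp (leg j) m s _ r (MapsTo.refl (b.ι j) s) h₃ h₁).trans ?_
      refine (congrArg (· ≫ Hom.at m _ r h₃) (hleg j s _ (MapsTo.refl (b.ι j) s))).trans ?_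
      revert h₁ h₂
      induction h₃ using MapsTo.ind with
      | refl =>
        intro h₁ h₂
        exact e s _ (MapsTo.refl _ s)
  refine ⟨Hom.mk f σ, ⟨rfl, fun j => (key j _ rfl).2 fun s A B t h => ?_⟩, ?_⟩
  · have := hm (t := t) ⟨j, _, _, s, h⟩
    have e := at_refl (F := TotalPreCoSegal.mk b.pt K) (G := H) (Hom.mk f σ) t
    exact (congrArg (κ.app (t := t) ⟨j, _, _, s, h⟩ ≫ ·) e).trans this
  · rintro ⟨f', m'⟩ ⟨hf', hm''⟩
    obtain rfl : f' = f := hf'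
    congr 1
    refine hm' m' fun {A B t} x => ?_
    obtain ⟨j, a, b', s, h⟩ := x
    have := (key j _ rfl).1 (hm'' j) s t h
    have e := at_refl (F := TotalPreCoSegal.mk b.pt K) (G := H) (Hom.mk f' m') t
    exact (congrArg (κ.app (t := t) ⟨j, _, _, s, h⟩ ≫ ·) e).symm.trans this

theorem exists_isUniversal [SymmetricCategory M] [MonoidalClosed M] [HasColimitsOfSize.{w, w} M]
    (b : BaseCocone D) : ∃ c : RelCocone b, c.IsUniversal := by
  obtain ⟨K, κ, hK⟩ := b.colimitPresentation.exists_presented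
  exact ⟨coconeOfModel κ, coconeOfModel_isUniversal κ hK⟩

end BaseCocone

variable {M : Type u} [Category.{v} M] [MonoidalCategory M]

open Chain TotalPreCoSegal

/-! ## Colimits -/

section Total

variable {J : Type w} [Category.{w} J] {D : J ⥤ TotalPreCoSegal.{w} M}

/-- A base cocone is a colimit of sets. -/
def BaseCocone.IsColimit (b : BaseCocone D) : Prop :=
  ∀ ⦃Z : Type w⦄ (g : ∀ j, (D.obj j).carrier → Z),
    (∀ {i j : J} (f : i ⟶ j) (x : (D.obj i).carrier), g j (Hom.base (D.map f) x) = g i x) →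
      ∃! f : b.pt → Z, ∀ j x, f (b.ι j x) = g j x

variable (D) in
theorem exists_baseCocone_isColimit : ∃ b : BaseCocone D, b.IsColimit := by
  let F := D ⋙ carrierFunctor
  refine ⟨⟨colimit F, fun j => colimit.ι F j, fun f x =>
    congrArg (fun φ : F.obj _ ⟶ _ => φ x) (colimit.w F f)⟩, fun Z g hg => ?_⟩
  let s : Cocone F :=
    { pt := Z
      ι := { app := fun j => ↾(g j), naturality := fun i j f => by ext x; exact hg f x } }
  refine ⟨colimit.desc F s, fun j x =>
    congrArg (fun φ : F.obj _ ⟶ _ => φ x) (colimit.ι_desc s j), fun f hf => ?_⟩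
  have : ↾f = colimit.desc F s := by
    refine colimit.hom_ext fun j => ?_
    rw [colimit.ι_desc]
    ext x
    exact hf j x
  rw [← this]
  rfl

namespace RelCocone

variable {b : BaseCocone D}

/-- The underlying cocone. -/
def cocone (c : RelCocone b) : Cocone D where
  pt := TotalPreCoSegal.mk b.pt c.diagram
  ι := { app := c.leg, naturality := fun i j f => (c.w f).trans (Category.comp_id _).symm }

/-- The function on objects comes uniquely from the colimit of sets; over it, relative universality
gives a unique morphism. -/
theorem IsUniversal.nonempty_isColimit {c : RelCocone b} (hc : c.IsUniversal)
    (hb : b.IsColimit) : Nonempty (Limits.IsColimit c.cocone) := by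
  refine ⟨IsColimit.ofExistsUnique fun s => ?_⟩
  obtain ⟨f, hf, hf'⟩ := hb (fun j => Hom.base (s.ι.app j)) (fun g x =>
    congrArg (fun φ : D.obj _ ⟶ s.pt => Hom.base φ x) (s.w g))
  obtain ⟨m, ⟨-, hm⟩, hm'⟩ := hc f s.ι.app (fun g => s.w g) (fun j x => (hf j x).symm)
  refine ⟨m, hm, fun m' h => hm' m' ⟨hf' _ fun j x => ?_, h⟩⟩
  rw [← h j, ← c.base_leg]
  rfl

end RelCocone

end Total

instance [SymmetricCategory M] [MonoidalClosed M] [HasColimitsOfSize.{w, w} M] :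
    HasColimitsOfSize.{w, w} (TotalPreCoSegal.{w} M) where
  has_colimits_of_shape J _ :=
    { has_colimit := fun D => by
        obtain ⟨b, hb⟩ := exists_baseCocone_isColimit D
        obtain ⟨c, hc⟩ := b.exists_isUniversal
        obtain ⟨h⟩ := hc.nonempty_isColimit hb
        exact ⟨⟨c.cocone, h⟩⟩ }

/-! ## Pre-Co-Segal categories with a fixed set of objects -/

section Fiber

variable {X : Type w}

theorem Chain.MapsTo.ind_id {A B : X} {s : Chain X A B}
    {motive : ∀ {A' B' : X} (t : Chain X A' B'), MapsTo (fun x => x) s t → Prop}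
    (id : motive s (MapsTo.id s)) {A' B' : X} {t : Chain X A' B'}
    (h : MapsTo (fun x => x) s t) : motive t h := by
  obtain ⟨m⟩ := s
  obtain ⟨m'⟩ := t
  have h₁ := h.left
  have h₂ := h.right
  have h₃ : m.map _ = m' := h.inner
  subst h₁ h₂
  rw [List.map_id'] at h₃
  subst h₃
  exact id

/-- A morphism over a fixed set of objects as a morphism of `M_S(Set)`. -/
def inclusionMap {F G : PreCoSegal M X} (σ : F ⟶ G) :
    TotalPreCoSegal.mk X F ⟶ TotalPreCoSegal.mk X G :=
  Hom.mk (fun x => x) (σ ≫ PreCoSegal.toPullbackId G)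

theorem at_inclusionMap {F G : PreCoSegal M X} (σ : F ⟶ G) {A B : X} (s : Chain X A B)
    (h : MapsTo (Hom.base (inclusionMap σ)) s s) :
    Hom.at (inclusionMap σ) s s h = PreCoSegal.appAt σ s := by
  change (PreCoSegal.appAt σ s ≫ G.res (eqToHom (map_id_obj s))) ≫ eqToHom _ = _
  rw [PreCoSegal.res_eqToHom, Category.assoc]
  exact (congrArg (PreCoSegal.appAt σ s ≫ ·) (eqToHom_trans _ _)).trans (Category.comp_id _)

theorem hom_ext_of_base_id {F G : PreCoSegal M X}
    {φ ψ : TotalPreCoSegal.mk X F ⟶ TotalPreCoSegal.mk X G} (hφ : Hom.base φ = fun x => x)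
    (hψ : Hom.base ψ = fun x => x)
    (h : ∀ {A B : X} (s : Chain X A B), Hom.at φ s s (hφ ▸ MapsTo.id s) =
      Hom.at ψ s s (hψ ▸ MapsTo.id s)) : φ = ψ := by
  refine TotalPreCoSegal.hom_ext (hφ.trans hψ.symm) fun s A' B' t h₁ h₂ => ?_
  have h₃ : MapsTo (fun x => x) s t := hφ ▸ h₁
  induction h₃ using Chain.MapsTo.ind_id with
  | id => exact h s

variable (M X) in
/-- The inclusion of the Pre-Co-Segal categories with set of objects `X` in all of them. -/
def inclusion : PreCoSegal M X ⥤ TotalPreCoSegal.{w} M where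
  obj F := TotalPreCoSegal.mk X F
  map σ := inclusionMap σ
  map_id F := congrArg (TotalPreCoSegal.Hom.mk (fun x => x)) (Category.id_comp _)
  map_comp {F G H} σ τ := by
    refine hom_ext_of_base_id rfl rfl fun s => ?_
    refine Eq.trans ?_ (at_comp (inclusionMap σ) (inclusionMap τ) s s s (MapsTo.id s)
      (MapsTo.id s) (MapsTo.id s)).symm
    rw [at_inclusionMap]
    exact (congrArg₂ (· ≫ ·) (at_inclusionMap σ s (MapsTo.id s))
      (at_inclusionMap τ s (MapsTo.id s))).symm

instance : (inclusion M X).Faithful where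
  map_injective {F G σ τ} h := PreCoSegal.hom_ext fun s => by
    rw [← at_inclusionMap σ s (MapsTo.id s), ← at_inclusionMap τ s (MapsTo.id s)]
    exact at_congr h s s (MapsTo.id s)

/-- The inclusion is not assumed full, but it hits every morphism whose function on objects is the
identity. This is what brings constructions in the total category back to the fibre. -/
theorem exists_inclusion_map {F G : PreCoSegal M X}
    (φ : TotalPreCoSegal.mk X F ⟶ TotalPreCoSegal.mk X G) (hφ : Hom.base φ = fun x => x) :
    ∃ σ : F ⟶ G, (inclusion M X).map σ = φ := by
  have h {A B : X} (s : Chain X A B) : MapsTo (Hom.base φ) s s := hφ ▸ MapsTo.id s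
  refine ⟨PreCoSegal.homMk (fun s => Hom.at φ s s (h s)) (fun u => ?_) (fun s r => ?_), ?_⟩
  · refine (at_res φ u u (h _) (h _) ?_).symm
    rw [hφ]
    exact Del.map_id_fun _
  · exact (at_lax φ s r s r (h s) (h r)).symm
  · refine hom_ext_of_base_id rfl hφ fun s => ?_
    exact at_inclusionMap _ s _

variable {J : Type w} [Category.{w} J]

/-- The constant base cocone of a diagram of Pre-Co-Segal categories with the same set of
objects. -/
@[reducible]
def fiberBaseCocone (K : J ⥤ PreCoSegal M X) : BaseCocone (K ⋙ inclusion M X) where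
  pt := X
  ι _ x := x
  w _ _ := rfl

/-- The legs lie over the identity and so come from the fibre. The universal property there is the
relative one tested only against the identity function. -/
theorem exists_fiber_isColimit {K : J ⥤ PreCoSegal M X} {c : RelCocone (fiberBaseCocone K)}
    (hc : c.IsUniversal) : ∃ c' : Cocone K, Nonempty (IsColimit c') ∧
      Nonempty ((inclusion M X).mapCocone c' ≅ c.cocone) := by
  choose ι hι using fun j => exists_inclusion_map (F := K.obj j) (G := c.diagram) (c.leg j)
    (c.base_leg j)
  have hw {i j : J} (f : i ⟶ j) : K.map f ≫ ι j = ι i := (inclusion M X).map_injective (by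
    rw [Functor.map_comp, hι, hι]
    exact c.w f)
  refine ⟨⟨c.diagram, { app := ι, naturality := fun i j f => ?_ }⟩,
    ⟨IsColimit.ofExistsUnique fun s => ?_⟩, ⟨Cocone.ext (Iso.refl _) fun j => ?_⟩⟩
  · exact (hw f).trans (Category.comp_id _).symm
  · obtain ⟨m, ⟨hm, hm'⟩, hm''⟩ := hc (H := TotalPreCoSegal.mk X s.pt) (fun x => x)
      (fun j => (inclusion M X).map (s.ι.app j))
      (fun g => ((inclusion M X).map_comp _ _).symm.trans
        (congrArg (inclusion M X).map (s.w g))) (fun _ _ => rfl)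
    obtain ⟨σ, rfl⟩ := exists_inclusion_map m hm
    refine ⟨σ, fun j => (inclusion M X).map_injective ?_,
      fun τ hτ => (inclusion M X).map_injective (hm'' _ ⟨rfl, fun j => ?_⟩)⟩
    · exact ((inclusion M X).map_comp (ι j) σ).trans
        ((congrArg (· ≫ (inclusion M X).map σ) (hι j)).trans (hm' j))
    · exact (congrArg (· ≫ (inclusion M X).map τ) (hι j)).symm.trans
        (((inclusion M X).map_comp (ι j) τ).symm.trans (congrArg (inclusion M X).map (hτ j)))
  · exact (Category.comp_id _).trans (hι j)

instance [SymmetricCategory M] [MonoidalClosed M] [HasColimitsOfSize.{w, w} M] :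
    HasColimitsOfSize.{w, w} (PreCoSegal M X) where
  has_colimits_of_shape J _ :=
    { has_colimit := fun K => by
        obtain ⟨c, hc⟩ := (fiberBaseCocone K).exists_isUniversal
        obtain ⟨c', ⟨h⟩, -⟩ := exists_fiber_isColimit hc
        exact ⟨⟨c', h⟩⟩ }

/-- All transition functions are the identity of `X`, so a compatible family of functions out of `X`
is constant along a connected `J`. -/
theorem fiberBaseCocone_isColimit [IsConnected J] (K : J ⥤ PreCoSegal M X) :
    (fiberBaseCocone K).IsColimit := by
  intro Z g hg
  have j₀ : J := Classical.arbitrary J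
  refine ⟨g j₀, fun j x => ?_, fun f hf => funext fun x => hf j₀ x⟩
  exact constant_of_preserves_morphisms (fun i => g i x) (fun i j f => (hg f x).symm) _ _

/-- The same relative colimit over the constant base cocone is then a colimit both in the fibre and
in the total category. Filtered colimits are the case needed for presentability in the fibre. -/
instance [SymmetricCategory M] [MonoidalClosed M] [HasColimitsOfSize.{w, w} M] [IsConnected J] :
    PreservesColimitsOfShape J (inclusion M X) where
  preservesColimit {K} := by
    obtain ⟨c, hc⟩ := (fiberBaseCocone K).exists_isUniversal
    obtain ⟨c', ⟨h⟩, ⟨e⟩⟩ := exists_fiber_isColimit hc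
    obtain ⟨h'⟩ := hc.nonempty_isColimit (fiberBaseCocone_isColimit K)
    exact preservesColimit_of_preserves_colimit_cocone h (h'.ofIsoColimit e.symm)

end Fiber

/-! ## Filtered colimits -/

section Glue

variable {C : Type u} [Category.{v} C]

/-- A morphism out of a colimit may be prescribed on a family of indices that receives a map from
every index, provided any two ways of reaching the family agree. The family carries no category
structure; it will consist of partial sections. -/
theorem IsGraphColimit.exists_glue {I : Type*} [Category* I] {Φ : I ⥤ C} {K : C}
    {i : ∀ x, Φ.obj x ⟶ K}
    (hi : IsGraphColimit (x := Φ.obj) (E := fun a b => a ⟶ b) (fun _ _ f => Φ.map f) i)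
    {W : Type*} (p : W → I) {Z : C} (φ : ∀ a, Φ.obj (p a) ⟶ Z)
    (hp : ∀ x, ∃ a, Nonempty (x ⟶ p a))
    (hφ : ∀ {x : I} {a a' : W} (f : x ⟶ p a) (f' : x ⟶ p a'),
      Φ.map f ≫ φ a = Φ.map f' ≫ φ a') :
    ∃ d : K ⟶ Z, ∀ {x : I} {a : W} (f : x ⟶ p a), i x ≫ d = Φ.map f ≫ φ a := by
  choose a ha using hp
  obtain ⟨d, hd⟩ := hi.exists_desc (fun x => Φ.map (ha x).some ≫ φ (a x)) (fun {x y} e => by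
    rw [← Category.assoc, ← Φ.map_comp]
    exact hφ _ _)
  exact ⟨d, fun f => (hd _).trans (hφ _ _)⟩

/-- The two-variable form, where one and the same `a` dominates both indices. Laxity is only
available for lifts of two chains along a common section, so independent choices in the two
variables would not do. -/
theorem IsGraphColimit.exists_glue_tensor [MonoidalCategory C] [SymmetricCategory C]
    [MonoidalClosed C] {I I' : Type*} [Category* I] [Category* I'] {Φ : I ⥤ C} {Φ' : I' ⥤ C}
    {K K' : C} {i : ∀ x, Φ.obj x ⟶ K} {i' : ∀ x, Φ'.obj x ⟶ K'}
    (hi : IsGraphColimit (x := Φ.obj) (E := fun a b => a ⟶ b) (fun _ _ f => Φ.map f) i)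
    (hi' : IsGraphColimit (x := Φ'.obj) (E := fun a b => a ⟶ b) (fun _ _ f => Φ'.map f) i')
    {W : Type*} (p : W → I) (p' : W → I') {Z : C} (φ : ∀ a, Φ.obj (p a) ⊗ Φ'.obj (p' a) ⟶ Z)
    (hp : ∀ x y, ∃ a, Nonempty (x ⟶ p a) ∧ Nonempty (y ⟶ p' a))
    (hφ : ∀ {x : I} {y : I'} {a a' : W} (f : x ⟶ p a) (g : y ⟶ p' a) (f' : x ⟶ p a')
      (g' : y ⟶ p' a'), (Φ.map f ⊗ₘ Φ'.map g) ≫ φ a = (Φ.map f' ⊗ₘ Φ'.map g') ≫ φ a') :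
    ∃ d : K ⊗ K' ⟶ Z, ∀ {x : I} {y : I'} {a : W} (f : x ⟶ p a) (g : y ⟶ p' a),
      (i x ⊗ₘ i' y) ≫ d = (Φ.map f ⊗ₘ Φ'.map g) ≫ φ a := by
  choose a ha ha' using hp
  obtain ⟨d, hd⟩ := hi.exists_tensor_desc hi'
    (fun x y => (Φ.map (ha x y).some ⊗ₘ Φ'.map (ha' x y).some) ≫ φ (a x y))
    (fun {x x'} e y => by
      rw [← Category.assoc, ← tensorHom_id, tensorHom_comp_tensorHom, Category.id_comp,
        ← Φ.map_comp]
      exact hφ _ _ _ _)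
    (fun x y y' e => by
      rw [← Category.assoc, ← id_tensorHom, tensorHom_comp_tensorHom, Category.id_comp,
        ← Φ'.map_comp]
      exact hφ _ _ _ _)
  exact ⟨d, fun f g => (hd _ _).trans (hφ _ _ _ _)⟩

end Glue

/-! ### Lifts of chains and finite partial sections -/

namespace Del

variable {X Y : Type w}

theorem keep_heq' {a b : X} (hab : a = b) {l l' m m' : List X} {u : Del l l'} {v : Del m m'}
    (h : l = m) (h' : l' = m') (e : HEq u v) : HEq (keep a u) (keep b v) := by
  subst hab h h' e; rfl

theorem drop_heq' {a b : X} (hab : a = b) {l l' m m' : List X} {u : Del l l'} {v : Del m m'}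
    (h : l = m) (h' : l' = m') (e : HEq u v) : HEq (drop a u) (drop b v) := by
  subst hab h h' e; rfl

theorem mem_of_mem {l l' : List X} (u : Del l l') {x : X} (hx : x ∈ l') : x ∈ l := by
  induction u with
  | nil => exact hx
  | keep a u ih =>
    rcases List.mem_cons.1 hx with rfl | hx
    · exact List.mem_cons_self
    · exact List.mem_cons_of_mem _ (ih hx)
  | drop a u ih => exact List.mem_cons_of_mem _ (ih hx)

theorem map_congr {f g : X → Y} {l l' : List X} (u : Del l l') (h : ∀ x ∈ l, f x = g x) :
    HEq (map f u) (map g u) := by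
  induction u with
  | nil => rfl
  | @keep a l l' u ih =>
    have h' : ∀ x ∈ l, f x = g x := fun x hx => h x (List.mem_cons_of_mem _ hx)
    exact keep_heq' (h a List.mem_cons_self) (List.map_congr_left h')
      (List.map_congr_left fun x hx => h' x (u.mem_of_mem hx)) (ih h')
  | @drop a l l' u ih =>
    have h' : ∀ x ∈ l, f x = g x := fun x hx => h x (List.mem_cons_of_mem _ hx)
    exact drop_heq' (h a List.mem_cons_self) (List.map_congr_left h')
      (List.map_congr_left fun x hx => h' x (u.mem_of_mem hx)) (ih h')

theorem heq_of_map_heq (f : X → Y) {l l' m m' : List X} {u : Del l l'} {v : Del m m'}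
    (h : l = m) (h' : l' = m') (e : HEq (map f u) (map f v)) : HEq u v := by
  subst h h'
  exact heq_of_eq (map_injective f u v (eq_of_heq e))

end Del

open Chain TotalPreCoSegal

variable {M : Type u} [Category.{v} M] [MonoidalCategory M]

variable {J : Type w} [Category.{w} J] {D : J ⥤ TotalPreCoSegal.{w} M} {b : BaseCocone D}

namespace Lift

/-- A morphism of lifts of a chain. -/
@[ext]
structure Hom {A B : b.pt} {t : Chain b.pt A B} (x y : Lift b t) where
  /-- The morphism of stages. -/
  hom : x.stage ⟶ y.stage
  mapsTo : MapsTo (Hom.base (D.map hom)) x.chain y.chain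

instance {A B : b.pt} {t : Chain b.pt A B} : Category.{w} (Lift b t) where
  Hom x y := Hom x y
  id x := ⟨𝟙 _, by rw [D.map_id]; exact MapsTo.id _⟩
  comp f g := ⟨f.hom ≫ g.hom, by rw [D.map_comp]; exact f.mapsTo.comp g.mapsTo⟩
  id_comp f := Hom.ext (Category.id_comp _)
  comp_id f := Hom.ext (Category.comp_id _)
  assoc f g h := Hom.ext (Category.assoc _ _ _)

variable (b) in
/-- The values on the lifts of a chain. -/
@[reducible]
def functor {A B : b.pt} (t : Chain b.pt A B) : Lift b t ⥤ M where
  obj x := (D.obj x.stage).diagram.val x.chain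
  map {x y} f := Hom.at (D.map (Hom.hom f)) x.chain y.chain f.mapsTo
  map_id x := (at_congr (D.map_id _) _ _ _).trans (at_id _ _)
  map_comp {x y z} f g := (at_congr (D.map_comp (Hom.hom f) (Hom.hom g)) _ _ _).trans
    (at_comp _ _ _ _ _ f.mapsTo g.mapsTo _)

end Lift

/-- The conditions on a base cocone that hold for filtered colimits of sets. -/
structure BaseCocone.IsFilteredColimit (b : BaseCocone D) : Prop where
  exists_lift (x : b.pt) : ∃ j y, b.ι j y = x
  exists_eq {j : J} {x y : (D.obj j).carrier} (h : b.ι j x = b.ι j y) :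
    ∃ (k : J) (f : j ⟶ k), Hom.base (D.map f) x = Hom.base (D.map f) y

/-- The letters of a chain belong to a list. -/
structure Chain.Within {X : Type w} (S : List X) {A B : X} (t : Chain X A B) : Prop where
  left : A ∈ S
  right : B ∈ S
  inner : ∀ x ∈ t.inner, x ∈ S

/-- A map from the vertex of a base cocone to a stage which is a section over finitely many
elements. -/
structure Sec (b : BaseCocone D) (S : List b.pt) where
  /-- The stage. -/
  stage : J
  /-- The map. -/
  fn : b.pt → (D.obj stage).carrier
  eq : ∀ x ∈ S, b.ι stage (fn x) = x

theorem base_map_comp {i j k : J} (f : i ⟶ j) (g : j ⟶ k) (x : (D.obj i).carrier) :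
    Hom.base (D.map (f ≫ g)) x = Hom.base (D.map g) (Hom.base (D.map f) x) := by
  rw [D.map_comp]; rfl

namespace Sec

variable {S : List b.pt}

/-- A morphism of partial sections. -/
structure Hom (σ τ : Sec b S) where
  /-- The morphism of stages. -/
  hom : σ.stage ⟶ τ.stage
  eq : ∀ x ∈ S, TotalPreCoSegal.Hom.base (D.map hom) (σ.fn x) = τ.fn x

/-- Composition of morphisms of partial sections. -/
def Hom.comp {σ τ ρ : Sec b S} (m : Hom σ τ) (n : Hom τ ρ) : Hom σ ρ where
  hom := m.hom ≫ n.hom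
  eq x hx := by rw [base_map_comp, m.eq x hx, n.eq x hx]

/-- Move a partial section to a later stage. -/
@[reducible]
def push (σ : Sec b S) {k : J} (g : σ.stage ⟶ k) : Sec b S where
  stage := k
  fn x := TotalPreCoSegal.Hom.base (D.map g) (σ.fn x)
  eq x hx := (b.w g _).trans (σ.eq x hx)

/-- The morphism to a later stage. -/
def toPush (σ : Sec b S) {k : J} (g : σ.stage ⟶ k) : Hom σ (σ.push g) := ⟨g, fun _ _ => rfl⟩

variable {A B C : b.pt} {t t' : Chain b.pt A B}

theorem mapsTo (σ : Sec b S) (ht : t.Within S) :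
    MapsTo (b.ι σ.stage) ((mapFunctor σ.fn A B).obj t) t :=
  ⟨σ.eq _ ht.left, σ.eq _ ht.right, by
    refine (List.map_map).trans ((List.map_congr_left fun x hx => ?_).trans (List.map_id _))
    exact σ.eq x (ht.inner x hx)⟩

/-- The lift of a chain along a partial section. -/
@[reducible]
def lift (σ : Sec b S) (ht : t.Within S) : Lift b t :=
  ⟨σ.stage, σ.fn A, σ.fn B, (mapFunctor σ.fn A B).obj t, σ.mapsTo ht⟩

theorem Hom.mapsTo {σ τ : Sec b S} (m : Hom σ τ) (ht : t.Within S) :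
    MapsTo (TotalPreCoSegal.Hom.base (D.map m.hom)) ((mapFunctor σ.fn A B).obj t)
      ((mapFunctor τ.fn A B).obj t) :=
  ⟨m.eq _ ht.left, m.eq _ ht.right, (List.map_map).trans
    (List.map_congr_left fun x hx => m.eq x (ht.inner x hx))⟩

/-- A morphism of partial sections induces morphisms of lifts. -/
@[reducible]
def Hom.lift {σ τ : Sec b S} (m : Hom σ τ) (ht : t.Within S) : σ.lift ht ⟶ τ.lift ht :=
  Lift.Hom.mk m.hom (m.mapsTo ht)

theorem map_heq (σ : Sec b S) (ht : t.Within S) (u : t ⟶ t') :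
    HEq (Del.map (b.ι σ.stage) (Del.map σ.fn u)) u :=
  (Del.map_map _ _ u).trans ((Del.map_congr u fun x hx => σ.eq x (ht.inner x hx)).trans
    (Del.map_id_fun u))

theorem Hom.map_heq {σ τ : Sec b S} (m : Hom σ τ) (ht : t.Within S) (u : t ⟶ t') :
    HEq (Del.map (TotalPreCoSegal.Hom.base (D.map m.hom)) (Del.map σ.fn u)) (Del.map τ.fn u) :=
  (Del.map_map _ _ u).trans (Del.map_congr u fun x hx => m.eq x (ht.inner x hx))

/-- Both deletions become `u` at the vertex, and a deletion between given words is determined by its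
relabelling. Unlike letters, deletions thus need no passage to a later stage in order to agree. -/
theorem map_heq_of_mapsTo {j : J} {x y : (D.obj j).carrier} {s s' : Chain _ x y} {v : s ⟶ s'}
    {u : t ⟶ t'} (e : HEq (Del.map (b.ι j) v) u) (σ : Sec b S) (ht : t.Within S)
    (ht' : t'.Within S) {f : j ⟶ σ.stage}
    (h : MapsTo (TotalPreCoSegal.Hom.base (D.map f)) s (σ.lift ht).chain)
    (h' : MapsTo (TotalPreCoSegal.Hom.base (D.map f)) s' (σ.lift ht').chain) :
    HEq (Del.map (TotalPreCoSegal.Hom.base (D.map f)) v) (Del.map σ.fn u) := by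
  refine Del.heq_of_map_heq (b.ι σ.stage) h.inner h'.inner ?_
  refine (Del.map_map _ _ v).trans ((Del.map_congr v fun x _ => b.w f x).trans (e.trans ?_))
  exact (σ.map_heq ht u).symm

end Sec

namespace BaseCocone.IsFilteredColimit

variable [IsFiltered J] (hb : b.IsFilteredColimit)

include hb

/-- Finitely many equalities of letters at the vertex hold together at one later stage, by
filteredness and induction on the word. -/
theorem exists_map_eq {j : J} (l l' : List (D.obj j).carrier)
    (h : l.map (b.ι j) = l'.map (b.ι j)) : ∃ (k : J) (f : j ⟶ k),
      l.map (Hom.base (D.map f)) = l'.map (Hom.base (D.map f)) := by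
  induction l generalizing l' with
  | nil =>
    obtain rfl : l' = [] := by simpa using h.symm
    exact ⟨j, 𝟙 j, rfl⟩
  | cons x l ih =>
    cases l' with
    | nil => simp at h
    | cons y l' =>
      simp only [List.map_cons, List.cons.injEq] at h
      obtain ⟨k₁, f₁, h₁⟩ := hb.exists_eq h.1
      obtain ⟨k₂, f₂, h₂⟩ := ih l' h.2
      obtain ⟨k, g₁, g₂, hg⟩ := IsFiltered.span f₁ f₂
      have e (m : List (D.obj j).carrier) : m.map (Hom.base (D.map (f₁ ≫ g₁))) =
          (m.map (Hom.base (D.map f₂))).map (Hom.base (D.map g₂)) := by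
        rw [hg, List.map_map]
        exact List.map_congr_left fun x _ => base_map_comp _ _ x
      refine ⟨k, f₁ ≫ g₁, ?_⟩
      rw [List.map_cons, List.map_cons, e, e, h₂, base_map_comp, base_map_comp, h₁]

theorem nonempty_sec (S : List b.pt) : Nonempty (Sec b S) := by
  classical
  induction S with
  | nil =>
    -- A section is a total function on the vertex, so a stage with a letter is needed for the junk
    -- values unless the vertex is empty.
    rcases isEmpty_or_nonempty b.pt with _ | ⟨⟨x⟩⟩
    · exact ⟨⟨IsFiltered.nonempty.some, isEmptyElim, by simp⟩⟩
    · obtain ⟨j, y, -⟩ := hb.exists_lift x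
      exact ⟨⟨j, fun _ => y, by simp⟩⟩
  | cons x S ih =>
    obtain ⟨σ⟩ := ih
    obtain ⟨j, y, hy⟩ := hb.exists_lift x
    obtain ⟨k, f, g, -⟩ := IsFilteredOrEmpty.cocone_objs j σ.stage
    refine ⟨⟨k, Function.update (σ.push g).fn x (Hom.base (D.map f) y), fun z hz => ?_⟩⟩
    by_cases h : z = x
    · subst h
      rw [Function.update_self, b.w, hy]
    · rw [Function.update_of_ne h]
      exact (σ.push g).eq z ((List.mem_cons.1 hz).resolve_left h)

variable {S : List b.pt} {A B : b.pt} {t : Chain b.pt A B}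

/-- Cofinality of sections: move `x` and `σ` to a common stage. There the two lifts of `t` have the
same image at the vertex, hence coincide after one more step. Starting from a given `σ` allows
several lifts to be absorbed in turn. -/
theorem exists_secHom (σ : Sec b S) (ht : t.Within S) (x : Lift b t) :
    ∃ (τ : Sec b S) (_ : Sec.Hom σ τ), Nonempty (x ⟶ τ.lift ht) := by
  obtain ⟨k, f, g, -⟩ := IsFilteredOrEmpty.cocone_objs x.stage σ.stage
  obtain ⟨k', h, e⟩ := hb.exists_map_eq
    ((x.src :: x.tgt :: x.chain.inner).map (Hom.base (D.map f)))
    ((A :: B :: t.inner).map (σ.push g).fn) (by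
      have e₁ := x.mapsTo.left
      have e₂ := x.mapsTo.right
      have e₃ := x.mapsTo.inner
      have e₄ := ((σ.push g).mapsTo ht).inner
      have e₅ : (x.chain.inner.map (Hom.base (D.map f))).map (b.ι k) = t.inner := by
        rw [← e₃, List.map_map]
        exact List.map_congr_left fun z _ => b.w f z
      simp only [List.map_cons]
      rw [e₅, b.w f, b.w f, e₁, e₂]
      congr 1
      · exact ((σ.push g).eq _ ht.left).symm
      congr 1
      · exact ((σ.push g).eq _ ht.right).symm
      · exact e₄.symm)
  simp only [List.map_cons, List.cons.injEq] at e
  refine ⟨(σ.push g).push h, (σ.toPush g).comp ((σ.push g).toPush h), ⟨⟨f ≫ h, ⟨?_, ?_, ?_⟩⟩⟩⟩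
  · exact (base_map_comp f h _).trans e.1
  · exact (base_map_comp f h _).trans e.2.1
  · refine Eq.trans ?_ (e.2.2.trans List.map_map)
    rw [List.map_map]
    exact List.map_congr_left fun z _ => base_map_comp f h z

theorem exists_sec {A' B' : b.pt} {t' : Chain b.pt A' B'} (ht : t.Within S) (ht' : t'.Within S)
    {j : J} {x y x' y' : (D.obj j).carrier} {s : Chain _ x y} {s' : Chain _ x' y'}
    (h : MapsTo (b.ι j) s t) (h' : MapsTo (b.ι j) s' t') : ∃ (σ : Sec b S) (f : j ⟶ σ.stage),
      MapsTo (Hom.base (D.map f)) s (σ.lift ht).chain ∧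
        MapsTo (Hom.base (D.map f)) s' (σ.lift ht').chain := by
  obtain ⟨σ₀⟩ := hb.nonempty_sec S
  obtain ⟨σ₁, -, ⟨f₁⟩⟩ := hb.exists_secHom σ₀ ht ⟨j, _, _, s, h⟩
  obtain ⟨σ₂, m, ⟨f₂⟩⟩ := hb.exists_secHom σ₁ ht' ⟨j, _, _, s', h'⟩
  let g₁ := f₁ ≫ m.lift ht
  -- The two lifts have been absorbed along possibly different morphisms of stages; coequalizing
  -- them leaves a single `f`, as required to apply `D.map f` to both chains.
  obtain ⟨k, n, hn⟩ := IsFilteredOrEmpty.cocone_maps g₁.hom f₂.hom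
  refine ⟨σ₂.push n, g₁.hom ≫ n, ?_, ?_⟩
  · exact (g₁ ≫ (σ₂.toPush n).lift ht).mapsTo
  · exact (congrArg (fun q => MapsTo (Hom.base (D.map q)) s' ((σ₂.push n).lift ht').chain)
      hn).mpr (f₂ ≫ (σ₂.toPush n).lift ht').mapsTo

/-- Supplies the independence of choices in gluing: a bowtie in `J` makes the stage morphisms agree,
after which the two sections agree on `S` at a later stage because both are sections there. -/
theorem exists_secHom₂ {i i' : J} (σ₁ σ₂ : Sec b S) (f₁ : i ⟶ σ₁.stage) (g₁ : i' ⟶ σ₁.stage)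
    (f₂ : i ⟶ σ₂.stage) (g₂ : i' ⟶ σ₂.stage) :
    ∃ (τ : Sec b S) (m₁ : Sec.Hom σ₁ τ) (m₂ : Sec.Hom σ₂ τ),
      f₁ ≫ m₁.hom = f₂ ≫ m₂.hom ∧ g₁ ≫ m₁.hom = g₂ ≫ m₂.hom := by
  obtain ⟨k, α, β, h₁, h₂⟩ := IsFiltered.bowtie f₁ f₂ g₁ g₂
  obtain ⟨k', h, e⟩ := hb.exists_map_eq (S.map (σ₁.push α).fn) (S.map (σ₂.push β).fn) (by
    rw [List.map_map, List.map_map]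
    exact List.map_congr_left fun x hx =>
      ((σ₁.push α).eq x hx).trans ((σ₂.push β).eq x hx).symm)
  rw [List.map_map, List.map_map, List.map_inj_left] at e
  refine ⟨(σ₁.push α).push h, (σ₁.toPush α).comp ((σ₁.push α).toPush h), ⟨β ≫ h, fun x hx => ?_⟩,
    ?_, ?_⟩
  · exact (base_map_comp β h _).trans (e x hx).symm
  · change f₁ ≫ α ≫ h = f₂ ≫ β ≫ h
    rw [← Category.assoc, h₁, Category.assoc]
  · change g₁ ≫ α ≫ h = g₂ ≫ β ≫ h
    rw [← Category.assoc, h₂, Category.assoc]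

end BaseCocone.IsFilteredColimit

open Chain TotalPreCoSegal

variable {M : Type u} [Category.{v} M] [MonoidalCategory M]

variable {J : Type w} [Category.{w} J] {D : J ⥤ TotalPreCoSegal.{w} M} {b : BaseCocone D}

/-! ### Filtered colimits computed chain by chain -/

namespace Lift

variable [HasColimitsOfSize.{w, w} M]

variable (b) in
/-- The value at a chain of a filtered colimit of Pre-Co-Segal categories. -/
noncomputable def colim {A B : b.pt} (t : Chain b.pt A B) : M := colimit (functor b t)

/-- The canonical morphisms to the value of a filtered colimit. -/
noncomputable def toColim {A B : b.pt} {t : Chain b.pt A B} (x : Lift b t) :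
    (D.obj x.stage).diagram.val x.chain ⟶ colim b t := colimit.ι (functor b t) x

theorem isGraphColimit_colim {A B : b.pt} (t : Chain b.pt A B) :
    IsGraphColimit (x := (functor b t).obj) (E := fun a b => a ⟶ b)
      (fun _ _ f => (functor b t).map f) (K := colim b t) toColim :=
  IsGraphColimit.of_isColimit (colimit.isColimit (functor b t))

theorem at_toColim {A B : b.pt} {t : Chain b.pt A B} {j k : J} (f : j ⟶ k)
    {x y : (D.obj j).carrier} {s : Chain _ x y} {x' y' : (D.obj k).carrier} {s' : Chain _ x' y'}
    (h : MapsTo (TotalPreCoSegal.Hom.base (D.map f)) s s') (h₁ : MapsTo (b.ι j) s t)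
    (h₂ : MapsTo (b.ι k) s' t) :
    Hom.at (D.map f) s s' h ≫ toColim ⟨k, x', y', s', h₂⟩ = toColim ⟨j, x, y, s, h₁⟩ :=
  colimit.w (functor b t) (Lift.Hom.mk f h : (⟨j, x, y, s, h₁⟩ : Lift b t) ⟶ ⟨k, x', y', s', h₂⟩)

end Lift

theorem HEq.hcompHom {X Y : Type w} {f : X → Y} {A B C : X} {s s' : Chain X A B}
    {r r' : Chain X B C} {A' B' C' : Y} {t t' : Chain Y A' B'} {q q' : Chain Y B' C'}
    {u : s ⟶ s'} {u' : r ⟶ r'} {v : t ⟶ t'} {v' : q ⟶ q'} (h₁ : MapsTo f s t)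
    (h₂ : MapsTo f s' t') (h₃ : MapsTo f r q) (h₄ : MapsTo f r' q') (e : HEq (Del.map f u) v)
    (e' : HEq (Del.map f u') v') :
    HEq (Del.map f (Chain.hcompHom u u')) (Chain.hcompHom v v') := by
  refine (Del.map_append f u (Del.keep B u')).trans (Del.append_heq h₁.inner h₂.inner
    (by simp [h₃.inner, h₃.left]) (by simp [h₄.inner, h₃.left]) e ?_)
  exact Del.keep_heq' h₃.left h₃.inner h₄.inner e'

theorem HEq.map_eqToHom {X Y : Type w} {f : X → Y} {A B : X} {s s' : Chain X A B} (p : s = s')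
    {A' B' : Y} {t t' : Chain Y A' B'} (q : t = t') (h : MapsTo f s t) :
    HEq (Del.map f (eqToHom p)) (eqToHom q) := by
  subst p
  exact h.heq_id q

namespace BaseCocone.IsFilteredColimit

open Lift

variable [IsFiltered J] (hb : b.IsFilteredColimit) [HasColimitsOfSize.{w, w} M]

include hb

variable {S : List b.pt} {A B C E : b.pt} {t t' : Chain b.pt A B} {r : Chain b.pt B C}
  {q : Chain b.pt C E}

theorem jointlyEpi (ht : t.Within S) : JointlyEpi fun σ : Sec b S => toColim (σ.lift ht) := by
  intro Z d d' h
  refine (isGraphColimit_colim t).jointlyEpi _ _ fun x => ?_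
  obtain ⟨σ₀⟩ := hb.nonempty_sec S
  obtain ⟨σ, -, ⟨f⟩⟩ := hb.exists_secHom σ₀ ht x
  rw [← (isGraphColimit_colim t).w f, Category.assoc, Category.assoc, h]

/-- A pair of lifts at unrelated stages is dominated by the pair of lifts along one section. These
two share the stage and the junction letter, so they are composable. -/
theorem jointlyEpi_tensor [SymmetricCategory M] [MonoidalClosed M] (ht : t.Within S)
    (hr : r.Within S) : JointlyEpi fun σ : Sec b S =>
      toColim (σ.lift ht) ⊗ₘ toColim (σ.lift hr) := by
  intro Z d d' h
  refine ((isGraphColimit_colim t).jointlyEpi.tensor (isGraphColimit_colim r).jointlyEpi) _ _ ?_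
  rintro ⟨x, y⟩
  obtain ⟨σ₀⟩ := hb.nonempty_sec S
  obtain ⟨σ₁, -, ⟨f⟩⟩ := hb.exists_secHom σ₀ ht x
  obtain ⟨σ, m, ⟨g⟩⟩ := hb.exists_secHom σ₁ hr y
  simp only []
  rw [← (isGraphColimit_colim t).w (f ≫ m.lift ht), ← (isGraphColimit_colim r).w g,
    ← tensorHom_comp_tensorHom, Category.assoc, Category.assoc]
  exact congrArg _ (h σ)

theorem jointlyEpi_tensor₃ [SymmetricCategory M] [MonoidalClosed M] (ht : t.Within S)
    (hr : r.Within S) (hq : q.Within S) : JointlyEpi fun σ : Sec b S =>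
      (toColim (σ.lift ht) ⊗ₘ toColim (σ.lift hr)) ⊗ₘ toColim (σ.lift hq) := by
  intro Z d d' h
  refine ((hb.jointlyEpi_tensor ht hr).tensor (isGraphColimit_colim q).jointlyEpi) _ _ ?_
  rintro ⟨σ₁, z⟩
  obtain ⟨σ, m, ⟨g⟩⟩ := hb.exists_secHom σ₁ hq z
  simp only []
  rw [← (isGraphColimit_colim t).w (m.lift ht), ← (isGraphColimit_colim r).w (m.lift hr),
    ← (isGraphColimit_colim q).w g, ← tensorHom_comp_tensorHom, ← tensorHom_comp_tensorHom,
    Category.assoc, Category.assoc]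
  exact congrArg _ (h σ)

/-- Along a section `σ` the deletion `u` lifts to `Del.map σ.fn u`, and restriction along it defines
the morphism. Cofinality and confluence of sections glue these. The formula is then extended from
sections to any stage at which a lift of `u` is given. -/
theorem exists_res (u : t ⟶ t') : ∃ d : colim b t' ⟶ colim b t, ∀ {j : J}
    {x y : (D.obj j).carrier} {s s' : Chain _ x y} (v : s ⟶ s') (h : MapsTo (b.ι j) s t)
    (h' : MapsTo (b.ι j) s' t') (_ : HEq (Del.map (b.ι j) v) u),
      toColim ⟨j, x, y, s', h'⟩ ≫ d = (D.obj j).diagram.res v ≫ toColim ⟨j, x, y, s, h⟩ := by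
  let S : List b.pt := A :: B :: (t.inner ++ t'.inner)
  have ht : t.Within S := ⟨by simp [S], by simp [S], fun x hx => by simp [S, hx]⟩
  have ht' : t'.Within S := ⟨by simp [S], by simp [S], fun x hx => by simp [S, hx]⟩
  obtain ⟨φ, hφ₀⟩ : ∃ φ : ∀ σ : Sec b S, (functor b t').obj (σ.lift ht') ⟶ colim b t, ∀ σ,
      φ σ = (D.obj σ.stage).diagram.res (s := (σ.lift ht).chain) (s' := (σ.lift ht').chain)
        (Del.map σ.fn u) ≫ toColim (σ.lift ht) := ⟨_, fun _ => rfl⟩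
  have hφ {σ τ : Sec b S} (m : Sec.Hom σ τ) : (functor b t').map (m.lift ht') ≫ φ τ = φ σ := by
    have e := at_res (D.map m.hom) (s := (σ.lift ht).chain) (s' := (σ.lift ht').chain)
      (t := (τ.lift ht).chain) (t' := (τ.lift ht').chain) (Del.map σ.fn u) (Del.map τ.fn u)
      (m.mapsTo ht) (m.mapsTo ht') (m.map_heq ht u)
    have e' := at_toColim m.hom (m.mapsTo ht) (σ.mapsTo ht) (τ.mapsTo ht)
    rw [hφ₀, hφ₀]
    refine (Category.assoc _ _ _).symm.trans ?_
    refine (congrArg (· ≫ toColim (τ.lift ht)) e).trans ((Category.assoc _ _ _).trans ?_)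
    exact congrArg (_ ≫ ·) e'
  obtain ⟨σ₀⟩ := hb.nonempty_sec S
  obtain ⟨d, hd⟩ := (isGraphColimit_colim t').exists_glue (fun σ : Sec b S => σ.lift ht') φ
    (fun x => by
      obtain ⟨σ, -, h⟩ := hb.exists_secHom σ₀ ht' x
      exact ⟨σ, h⟩)
    (fun {x σ₁ σ₂} f₁ f₂ => by
      -- Only one lift is involved, so the same pair of stage morphisms is supplied twice.
      obtain ⟨τ, m₁, m₂, e, -⟩ := hb.exists_secHom₂ σ₁ σ₂ f₁.hom f₁.hom f₂.hom f₂.hom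
      have e' : f₁ ≫ m₁.lift ht' = f₂ ≫ m₂.lift ht' := Lift.Hom.ext e
      rw [← hφ m₁, ← hφ m₂, ← Category.assoc, ← Category.assoc, ← Functor.map_comp,
        ← Functor.map_comp, e'])
  refine ⟨d, fun {j x y s s'} v h h' e => ?_⟩
  obtain ⟨σ, f, hf, hf'⟩ := hb.exists_sec ht ht' h h'
  have e₁ := at_res (D.map f) v (Del.map σ.fn u) hf hf' (σ.map_heq_of_mapsTo e ht ht' hf hf')
  refine (hd (x := ⟨j, x, y, s', h'⟩) (a := σ) (Lift.Hom.mk f hf')).trans ?_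
  rw [hφ₀]
  refine (Category.assoc _ _ _).symm.trans ?_
  refine (congrArg (· ≫ toColim (σ.lift ht)) e₁).trans ((Category.assoc _ _ _).trans ?_)
  exact congrArg (_ ≫ ·) (at_toColim f hf h (σ.mapsTo ht))

/-- Lifts of `t` and `r` along one section can be concatenated, and the laxity of that stage
applies. These morphisms glue over pairs of lifts. -/
theorem exists_lax [SymmetricCategory M] [MonoidalClosed M] (t : Chain b.pt A B)
    (r : Chain b.pt B C) : ∃ d : colim b t ⊗ colim b r ⟶ colim b (t.hcomp r), ∀ {j : J}
    {x y z : (D.obj j).carrier} (s : Chain _ x y) (p : Chain _ y z) (h : MapsTo (b.ι j) s t)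
    (h' : MapsTo (b.ι j) p r), (toColim ⟨j, x, y, s, h⟩ ⊗ₘ toColim ⟨j, y, z, p, h'⟩) ≫ d =
      (D.obj j).diagram.lax s p ≫ toColim ⟨j, x, z, s.hcomp p, h.hcomp h'⟩ := by
  let S : List b.pt := A :: B :: C :: (t.inner ++ r.inner)
  have ht : t.Within S := ⟨by simp [S], by simp [S], fun x hx => by simp [S, hx]⟩
  have hr : r.Within S := ⟨by simp [S], by simp [S], fun x hx => by simp [S, hx]⟩
  let φ (σ : Sec b S) : (D.obj σ.stage).diagram.val (σ.lift ht).chain ⊗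
      (D.obj σ.stage).diagram.val (σ.lift hr).chain ⟶ colim b (t.hcomp r) :=
    (D.obj σ.stage).diagram.lax (σ.lift ht).chain (σ.lift hr).chain ≫
      toColim ⟨σ.stage, _, _, (σ.lift ht).chain.hcomp (σ.lift hr).chain,
        (σ.mapsTo ht).hcomp (σ.mapsTo hr)⟩
  have hφ {σ τ : Sec b S} (m : Sec.Hom σ τ) :
      ((functor b t).map (m.lift ht) ⊗ₘ (functor b r).map (m.lift hr)) ≫ φ τ = φ σ := by
    have e := at_lax (D.map m.hom) _ _ _ _ (m.mapsTo ht) (m.mapsTo hr)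
    have e' := at_toColim m.hom ((m.mapsTo ht).hcomp (m.mapsTo hr))
      ((σ.mapsTo ht).hcomp (σ.mapsTo hr)) ((τ.mapsTo ht).hcomp (τ.mapsTo hr))
    refine (Category.assoc _ _ _).symm.trans ?_
    refine (congrArg (· ≫ _) e).trans ((Category.assoc _ _ _).trans ?_)
    exact congrArg (_ ≫ ·) e'
  obtain ⟨σ₀⟩ := hb.nonempty_sec S
  obtain ⟨d, hd⟩ := (isGraphColimit_colim t).exists_glue_tensor (isGraphColimit_colim r)
    (fun σ : Sec b S => σ.lift ht) (fun σ : Sec b S => σ.lift hr) φ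
    (fun x y => by
      obtain ⟨σ₁, -, ⟨f⟩⟩ := hb.exists_secHom σ₀ ht x
      obtain ⟨σ, m, ⟨g⟩⟩ := hb.exists_secHom σ₁ hr y
      exact ⟨σ, ⟨f ≫ m.lift ht⟩, ⟨g⟩⟩)
    (fun {x y σ₁ σ₂} f₁ g₁ f₂ g₂ => by
      obtain ⟨τ, m₁, m₂, e₁, e₂⟩ := hb.exists_secHom₂ σ₁ σ₂ f₁.hom g₁.hom f₂.hom g₂.hom
      have e₁' : f₁ ≫ m₁.lift ht = f₂ ≫ m₂.lift ht := Lift.Hom.ext e₁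
      have e₂' : g₁ ≫ m₁.lift hr = g₂ ≫ m₂.lift hr := Lift.Hom.ext e₂
      rw [← hφ m₁, ← hφ m₂, tensorHom_comp_tensorHom_assoc, tensorHom_comp_tensorHom_assoc,
        ← Functor.map_comp, ← Functor.map_comp, ← Functor.map_comp, ← Functor.map_comp, e₁', e₂'])
  refine ⟨d, fun {j x y z} s p h h' => ?_⟩
  obtain ⟨σ, f, hf, hf'⟩ := hb.exists_sec ht hr h h'
  have e₁ := at_lax (D.map f) s p _ _ hf hf'
  refine (hd (x := ⟨j, x, y, s, h⟩) (y := ⟨j, y, z, p, h'⟩) (a := σ) (Lift.Hom.mk f hf)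
    (Lift.Hom.mk f hf')).trans ?_
  refine (Category.assoc _ _ _).symm.trans ?_
  refine (congrArg (· ≫ _) e₁).trans ((Category.assoc _ _ _).trans ?_)
  exact congrArg (_ ≫ ·) (at_toColim f (hf.hcomp hf') (h.hcomp h')
    ((σ.mapsTo ht).hcomp (σ.mapsTo hr)))

end BaseCocone.IsFilteredColimit

open Chain TotalPreCoSegal

variable {M : Type u} [Category.{v} M] [MonoidalCategory M]

variable {J : Type w} [Category.{w} J] {D : J ⥤ TotalPreCoSegal.{w} M} {b : BaseCocone D}

theorem RelCocone.mapsTo_leg (c : RelCocone b) {A B : b.pt} {t : Chain b.pt A B} (x : Lift b t) :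
    MapsTo (Hom.base (c.leg x.stage)) x.chain t := by
  rw [c.base_leg]; exact x.mapsTo

/-- The cocone on the values at the lifts of a chain. -/
def RelCocone.eval (c : RelCocone b) {A B : b.pt} (t : Chain b.pt A B) :
    Cocone (Lift.functor b t) where
  pt := c.diagram.val t
  ι :=
    { app := fun x => Hom.at (c.leg x.stage) x.chain t (c.mapsTo_leg x)
      naturality := fun x y f => by
        have h : MapsTo (Hom.base (D.map (Lift.Hom.hom f) ≫ c.leg y.stage)) x.chain t := by
          rw [c.w]; exact c.mapsTo_leg x
        refine Eq.trans ?_ (Category.comp_id _).symm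
        exact (at_comp (D.map (Lift.Hom.hom f)) (c.leg y.stage) x.chain y.chain t f.mapsTo
          (c.mapsTo_leg y) h).symm.trans (at_congr (c.w _) _ _ h) }

namespace BaseCocone.IsFilteredColimit

open Lift

variable [IsFiltered J] (hb : b.IsFilteredColimit) [HasColimitsOfSize.{w, w} M]
  [SymmetricCategory M] [MonoidalClosed M]

include hb

/-- Every axiom involves finitely many chains. Taking `S` to contain all their letters, it is tested
on lifts along a section, where it is the same axiom at a single stage. -/
theorem exists_preCoSegal : ∃ (K : PreCoSegal M b.pt)
    (i : ∀ ⦃A B : b.pt⦄ ⦃t : Chain b.pt A B⦄ (x : Lift b t),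
      (D.obj x.stage).diagram.val x.chain ⟶ K.val t),
    (∀ {A B : b.pt} (t : Chain b.pt A B), ∃ e : K.val t ≅ colim b t,
      ∀ x : Lift b t, i x ≫ e.hom = toColim x) ∧
    (∀ {A B : b.pt} {t t' : Chain b.pt A B} (u : t ⟶ t') {j : J}
      {x y : (D.obj j).carrier} {s s' : Chain _ x y} (v : s ⟶ s') (h : MapsTo (b.ι j) s t)
      (h' : MapsTo (b.ι j) s' t') (_ : HEq (Del.map (b.ι j) v) u),
        i ⟨j, x, y, s', h'⟩ ≫ K.res u = (D.obj j).diagram.res v ≫ i ⟨j, x, y, s, h⟩) ∧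
    (∀ {A B C : b.pt} (t : Chain b.pt A B) (r : Chain b.pt B C) {j : J}
      {x y z : (D.obj j).carrier} (s : Chain _ x y) (p : Chain _ y z) (h : MapsTo (b.ι j) s t)
      (h' : MapsTo (b.ι j) p r), (i ⟨j, x, y, s, h⟩ ⊗ₘ i ⟨j, y, z, p, h'⟩) ≫ K.lax t r =
        (D.obj j).diagram.lax s p ≫ i ⟨j, x, z, s.hcomp p, h.hcomp h'⟩) := by
  choose res hres using fun {A B : b.pt} {t t' : Chain b.pt A B} (u : t ⟶ t') => hb.exists_res u
  choose lax hlax using fun {A B C : b.pt} (t : Chain b.pt A B) (r : Chain b.pt B C) =>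
    hb.exists_lax t r
  let K : PreCoSegal M b.pt := PreCoSegal.mk' (fun t => colim b t) (fun u => res u)
    (fun {A B} t => by
      let S : List b.pt := A :: B :: t.inner
      have ht : t.Within S := ⟨by simp [S], by simp [S], fun x hx => by simp [S, hx]⟩
      refine hb.jointlyEpi ht _ _ fun σ => ?_
      have e := hres (𝟙 t) (𝟙 (σ.lift ht).chain) (σ.mapsTo ht) (σ.mapsTo ht)
        ((σ.mapsTo ht).heq_id rfl)
      rw [PreCoSegal.res_id, Category.id_comp] at e
      exact e.trans (Category.comp_id _).symm)
    (fun {A B s t r} u v => by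
      let S : List b.pt := A :: B :: (s.inner ++ t.inner ++ r.inner)
      have hs : s.Within S := ⟨by simp [S], by simp [S], fun x hx => by simp [S, hx]⟩
      have ht : t.Within S := ⟨by simp [S], by simp [S], fun x hx => by simp [S, hx]⟩
      have hr : r.Within S := ⟨by simp [S], by simp [S], fun x hx => by simp [S, hx]⟩
      refine hb.jointlyEpi hr _ _ fun σ => ?_
      let u' : (σ.lift hs).chain ⟶ (σ.lift ht).chain := Del.map σ.fn u
      let v' : (σ.lift ht).chain ⟶ (σ.lift hr).chain := Del.map σ.fn v
      have e₁ := hres u u' (σ.mapsTo hs) (σ.mapsTo ht) (σ.map_heq hs u)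
      have e₂ := hres v v' (σ.mapsTo ht) (σ.mapsTo hr) (σ.map_heq ht v)
      have e₃ := hres (u ≫ v) (u' ≫ v') (σ.mapsTo hs) (σ.mapsTo hr) (by
        have := σ.map_heq hs (u ≫ v)
        have h : Del.map σ.fn (u ≫ v) = u' ≫ v' := Del.map_comp _ _ _
        rwa [h] at this)
      refine e₃.trans ?_
      rw [PreCoSegal.res_comp, Category.assoc, ← e₁, ← Category.assoc, ← e₂, Category.assoc])
    (fun s t => lax s t)
    (fun {A B C s s' t t'} u v => by
      let S : List b.pt := A :: B :: C :: (s.inner ++ s'.inner ++ t.inner ++ t'.inner)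
      have hs : s.Within S := ⟨by simp [S], by simp [S], fun x hx => by simp [S, hx]⟩
      have hs' : s'.Within S := ⟨by simp [S], by simp [S], fun x hx => by simp [S, hx]⟩
      have ht : t.Within S := ⟨by simp [S], by simp [S], fun x hx => by simp [S, hx]⟩
      have ht' : t'.Within S := ⟨by simp [S], by simp [S], fun x hx => by simp [S, hx]⟩
      refine hb.jointlyEpi_tensor hs' ht' _ _ fun σ => ?_
      let u' : (σ.lift hs).chain ⟶ (σ.lift hs').chain := Del.map σ.fn u
      let v' : (σ.lift ht).chain ⟶ (σ.lift ht').chain := Del.map σ.fn v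
      have e₁ := hres u u' (σ.mapsTo hs) (σ.mapsTo hs') (σ.map_heq hs u)
      have e₂ := hres v v' (σ.mapsTo ht) (σ.mapsTo ht') (σ.map_heq ht v)
      have e₃ := hlax s t _ _ (σ.mapsTo hs) (σ.mapsTo ht)
      have e₄ := hlax s' t' _ _ (σ.mapsTo hs') (σ.mapsTo ht')
      have e₅ := hres (Chain.hcompHom u v) (Chain.hcompHom u' v')
        ((σ.mapsTo hs).hcomp (σ.mapsTo ht)) ((σ.mapsTo hs').hcomp (σ.mapsTo ht'))
        (HEq.hcompHom (σ.mapsTo hs) (σ.mapsTo hs') (σ.mapsTo ht) (σ.mapsTo ht')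
          (σ.map_heq hs u) (σ.map_heq ht v))
      simp only []
      rw [tensorHom_comp_tensorHom_assoc, e₁, e₂, ← tensorHom_comp_tensorHom, Category.assoc, e₃,
        ← Category.assoc _ (lax s' t'), e₄, Category.assoc, e₅, ← Category.assoc, ← Category.assoc,
        (D.obj σ.stage).diagram.lax_natural u' v'])
    (fun {A B C E} s t r => by
      let S : List b.pt := A :: B :: C :: E :: (s.inner ++ t.inner ++ r.inner)
      have hs : s.Within S := ⟨by simp [S], by simp [S], fun x hx => by simp [S, hx]⟩
      have ht : t.Within S := ⟨by simp [S], by simp [S], fun x hx => by simp [S, hx]⟩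
      have hr : r.Within S := ⟨by simp [S], by simp [S], fun x hx => by simp [S, hx]⟩
      refine hb.jointlyEpi_tensor₃ hs ht hr _ _ fun σ => ?_
      let s' := (σ.lift hs).chain
      let t' := (σ.lift ht).chain
      let r' := (σ.lift hr).chain
      have hst : MapsTo (b.ι σ.stage) (s'.hcomp t') (s.hcomp t) :=
        (σ.mapsTo hs).hcomp (σ.mapsTo ht)
      have htr : MapsTo (b.ι σ.stage) (t'.hcomp r') (t.hcomp r) :=
        (σ.mapsTo ht).hcomp (σ.mapsTo hr)
      have e₁ := hlax s t s' t' (σ.mapsTo hs) (σ.mapsTo ht)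
      have e₂ := hlax t r t' r' (σ.mapsTo ht) (σ.mapsTo hr)
      have e₃ := hlax (s.hcomp t) r (s'.hcomp t') r' hst (σ.mapsTo hr)
      have e₄ := hlax s (t.hcomp r) s' (t'.hcomp r') (σ.mapsTo hs) htr
      have e₅ := hres (eqToHom (hcomp_assoc s t r)) (eqToHom (hcomp_assoc s' t' r'))
        (hst.hcomp (σ.mapsTo hr)) ((σ.mapsTo hs).hcomp htr)
        (HEq.map_eqToHom _ _ (hst.hcomp (σ.mapsTo hr)))
      have e₆ := (D.obj σ.stage).diagram.lax_assoc s' t' r'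
      have l₁ : ((toColim (σ.lift hs) ⊗ₘ toColim (σ.lift ht)) ⊗ₘ toColim (σ.lift hr)) ≫
          lax s t ▷ colim b r = ((D.obj σ.stage).diagram.lax s' t' ▷ _) ≫
            (toColim ⟨σ.stage, _, _, s'.hcomp t', hst⟩ ⊗ₘ toColim (σ.lift hr)) := by
        rw [← tensorHom_id, ← tensorHom_id, tensorHom_comp_tensorHom, tensorHom_comp_tensorHom,
          e₁, Category.id_comp, Category.comp_id]
      have l₂ : (toColim (σ.lift hs) ⊗ₘ (toColim (σ.lift ht) ⊗ₘ toColim (σ.lift hr))) ≫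
          colim b s ◁ lax t r = (_ ◁ (D.obj σ.stage).diagram.lax t' r') ≫
            (toColim (σ.lift hs) ⊗ₘ toColim ⟨σ.stage, _, _, t'.hcomp r', htr⟩) := by
        rw [← id_tensorHom, ← id_tensorHom, tensorHom_comp_tensorHom, tensorHom_comp_tensorHom,
          e₂, Category.id_comp, Category.comp_id]
      simp only []
      rw [← Category.assoc, l₁, Category.assoc, e₃, associator_naturality_assoc,
        ← Category.assoc (toColim (σ.lift hs) ⊗ₘ _), l₂, Category.assoc, ← Category.assoc _ (lax _ _),
        e₄, Category.assoc, e₅, ← Category.assoc, e₆]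
      simp only [Category.assoc]
      rfl)
  exact ⟨K, fun _ _ _ x => toColim x, fun t => ⟨Iso.refl _, fun x => Category.comp_id _⟩,
    fun u => fun v h h' e => hres u v h h' e, fun t r => fun s p h h' => hlax t r s p h h'⟩

/-- The chainwise colimit is an initial model of the colimit presentation: maps out of it are given
on lifts by the relation `trans`, and the other two relations, tested along sections, make them a
morphism. Thus the universal cocone exists together with the formula for its values. -/
theorem exists_isUniversal : ∃ c : RelCocone b, c.IsUniversal ∧
    ∀ {A B : b.pt} (t : Chain b.pt A B), Nonempty (Limits.IsColimit (c.eval t)) := by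
  obtain ⟨K, i, hi, hres, hlax⟩ := hb.exists_preCoSegal
  have hw {A B : b.pt} {t : Chain b.pt A B} {x y : Lift b t} (f : x ⟶ y) :
      (functor b t).map f ≫ i y = i x := by
    obtain ⟨e, he⟩ := hi t
    rw [← cancel_mono e.hom, Category.assoc, he, he]
    exact (isGraphColimit_colim t).w f
  have hepi {S : List b.pt} {A B : b.pt} {t : Chain b.pt A B} (ht : t.Within S) :
      JointlyEpi fun σ : Sec b S => i (σ.lift ht) := fun Z d d' h => by
    obtain ⟨e, he⟩ := hi t
    rw [← cancel_epi e.inv]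
    refine hb.jointlyEpi ht _ _ fun σ => ?_
    have h' := h σ
    have e' : toColim (σ.lift ht) ≫ e.inv = i (σ.lift ht) := by rw [← he, Category.assoc]; simp
    rw [← Category.assoc, ← Category.assoc, e']
    exact h'
  have hepi₂ {S : List b.pt} {A B C : b.pt} {t : Chain b.pt A B} {r : Chain b.pt B C}
      (ht : t.Within S) (hr : r.Within S) :
      JointlyEpi fun σ : Sec b S => i (σ.lift ht) ⊗ₘ i (σ.lift hr) := fun Z d d' h => by
    obtain ⟨e, he⟩ := hi t
    obtain ⟨e', he'⟩ := hi r
    rw [← cancel_epi (e.inv ⊗ₘ e'.inv)]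
    refine hb.jointlyEpi_tensor ht hr _ _ fun σ => ?_
    have h' := h σ
    have h₁ : toColim (σ.lift ht) ≫ e.inv = i (σ.lift ht) := by rw [← he, Category.assoc]; simp
    have h₂ : toColim (σ.lift hr) ≫ e'.inv = i (σ.lift hr) := by rw [← he', Category.assoc]; simp
    simp only []
    rw [tensorHom_comp_tensorHom_assoc, tensorHom_comp_tensorHom_assoc, h₁, h₂]
    exact h'
  let κ : b.colimitPresentation.Model K := ⟨i, fun {A B t τ σ} r => by
    cases r with
    | trans x y f h => exact hw (Lift.Hom.mk f h)
    | lax j s r t q h h' => exact (hlax t q s r h h').symm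
    | res j v u h h' e => exact (hres u v h h' e).symm⟩
  refine ⟨coconeOfModel κ, coconeOfModel_isUniversal κ fun H φ => ?_, fun {A B} t => ?_⟩
  · choose m hm using fun {A B : b.pt} (t : Chain b.pt A B) =>
      show ∃ m : K.val t ⟶ H.val t, ∀ x, i x ≫ m = φ.app x by
        obtain ⟨e, he⟩ := hi t
        obtain ⟨d, hd⟩ := (isGraphColimit_colim t).exists_desc (fun x => φ.app x)
          (fun {x y} f => φ.rel (ColimitRel.trans x y f.hom f.mapsTo))
        exact ⟨e.hom ≫ d, fun x => by rw [← Category.assoc, he, hd]⟩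
    refine ⟨PreCoSegal.homMk m ?_ ?_, fun x => hm _ x, ?_⟩
    · intro A B s t u
      let S : List b.pt := A :: B :: (s.inner ++ t.inner)
      have hs : s.Within S := ⟨by simp [S], by simp [S], fun x hx => by simp [S, hx]⟩
      have ht : t.Within S := ⟨by simp [S], by simp [S], fun x hx => by simp [S, hx]⟩
      refine hepi ht _ _ fun σ => ?_
      let u' : (σ.lift hs).chain ⟶ (σ.lift ht).chain := Del.map σ.fn u
      have e := hres u u' (σ.mapsTo hs) (σ.mapsTo ht) (σ.map_heq hs u)
      have e' := φ.rel (ColimitRel.res σ.stage u' u (σ.mapsTo hs) (σ.mapsTo ht) (σ.map_heq hs u))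
      rw [← Category.assoc, e, Category.assoc, hm, ← Category.assoc, hm]
      exact e'
    · intro A B C s t
      let S : List b.pt := A :: B :: C :: (s.inner ++ t.inner)
      have hs : s.Within S := ⟨by simp [S], by simp [S], fun x hx => by simp [S, hx]⟩
      have ht : t.Within S := ⟨by simp [S], by simp [S], fun x hx => by simp [S, hx]⟩
      refine hepi₂ hs ht _ _ fun σ => ?_
      have e := hlax s t _ _ (σ.mapsTo hs) (σ.mapsTo ht)
      have e' := φ.rel (ColimitRel.lax σ.stage _ _ s t (σ.mapsTo hs) (σ.mapsTo ht))
      simp only []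
      rw [← Category.assoc, e, Category.assoc, hm, tensorHom_comp_tensorHom_assoc, hm, hm]
      exact e'
    · intro m' hm'
      refine PreCoSegal.hom_ext fun {A B} t => ?_
      obtain ⟨e, he⟩ := hi t
      rw [← cancel_epi e.inv]
      refine (isGraphColimit_colim t).jointlyEpi _ _ fun x => ?_
      have h₁ : toColim x ≫ e.inv = i x := by rw [← he, Category.assoc]; simp
      rw [← Category.assoc, ← Category.assoc, h₁]
      exact (hm' x).trans (hm t x).symm
  · obtain ⟨e, he⟩ := hi t
    let e' : (coconeOfModel κ).eval t ≅ colimit.cocone (functor b t) := Cocone.ext e fun x =>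
      (congrArg (· ≫ e.hom) (at_legOfModel κ x.stage x.chain t x.mapsTo)).trans (he x)
    exact ⟨(colimit.isColimit (functor b t)).ofIsoColimit e'.symm⟩

end BaseCocone.IsFilteredColimit

open Chain TotalPreCoSegal

/-! ### Cardinal filteredness of the category of lifts -/

namespace Chain

/-- All the letters of a chain. -/
def word {X : Type w} {A B : X} (t : Chain X A B) : List X := A :: B :: t.inner

theorem mapsTo_iff_word {X Y : Type w} {f : X → Y} {A B : X} {s : Chain X A B} {A' B' : Y}
    {t : Chain Y A' B'} : MapsTo f s t ↔ s.word.map f = t.word := by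
  simp only [word, List.map_cons, List.cons.injEq]
  exact ⟨fun h => ⟨h.left, h.right, h.inner⟩, fun h => ⟨h.1, h.2.1, h.2.2⟩⟩

end Chain

section

variable {M : Type u} [Category.{v} M] [MonoidalCategory M]

variable {J : Type w} [Category.{w} J] {D : J ⥤ TotalPreCoSegal.{w} M} {b : BaseCocone D}

theorem BaseCocone.IsColimit.isFilteredColimit [IsFiltered J] (hb : b.IsColimit) :
    b.IsFilteredColimit := by
  let c : Cocone (D ⋙ carrierFunctor) :=
    { pt := b.pt
      ι := { app := fun j => ↾(b.ι j), naturality := fun i j f => by ext x; exact b.w f x } }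
  have hc : Limits.IsColimit c := IsColimit.ofExistsUnique fun s => by
    obtain ⟨f, hf, hf'⟩ := hb (fun j => s.ι.app j) (fun g x =>
      congrArg (fun φ : (D ⋙ carrierFunctor).obj _ ⟶ s.pt => φ x) (s.w g))
    refine ⟨↾f, fun j => ?_, fun g hg => ?_⟩
    · ext x; exact hf j x
    · ext x
      exact congrFun (hf' g fun j y =>
        congrArg (fun φ : (D ⋙ carrierFunctor).obj _ ⟶ s.pt => φ y) (hg j)) x
  exact ⟨fun x => Types.jointly_surjective_of_isColimit hc x,
    fun {j x y} h => (Types.FilteredColimit.isColimit_eq_iff' hc x y).1 h⟩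

namespace BaseCocone.IsFilteredColimit

variable (hb : b.IsFilteredColimit)

include hb

theorem nonempty_lift [IsFiltered J] {A B : b.pt} (t : Chain b.pt A B) : Nonempty (Lift b t) := by
  obtain ⟨σ⟩ := hb.nonempty_sec t.word
  exact ⟨σ.lift ⟨by simp [Chain.word], by simp [Chain.word], fun x hx => by simp [Chain.word, hx]⟩⟩

/-- A cocone on the stages is pushed further until every lift has become the image of one fixed lift
`y`. For each lift this needs one later stage, since words are finite, and fewer than `κ` stages
have a common bound. Naturality is inherited from the stages, as a morphism of lifts is determined
by its morphism of stages. -/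
theorem isCardinalFiltered_lift (κ : Cardinal.{w}) [Fact κ.IsRegular] [IsCardinalFiltered J κ]
    {A B : b.pt} (t : Chain b.pt A B) : IsCardinalFiltered (Lift b t) κ where
  nonempty_cocone {I _} F hI := by
    have := isFiltered_of_isCardinalFiltered J κ
    -- The apex will be the image of `y`, which is available even if `I` is empty.
    obtain ⟨y⟩ := hb.nonempty_lift t
    let U : I ⥤ J :=
      { obj := fun a => (F.obj a).stage
        map := fun f => (F.map f).hom
        map_id := fun a => by rw [F.map_id]; rfl
        map_comp := fun f g => by rw [F.map_comp]; rfl }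
    let c := IsCardinalFiltered.cocone U hI
    obtain ⟨k, α, β, -⟩ := IsFilteredOrEmpty.cocone_objs c.pt y.stage
    have hstable {a : I} {l : J} (g : k ⟶ l) {l' : J} (g' : l ⟶ l')
        (h : (F.obj a).chain.word.map (Hom.base (D.map (c.ι.app a ≫ α ≫ g))) =
          y.chain.word.map (Hom.base (D.map (β ≫ g)))) :
        (F.obj a).chain.word.map (Hom.base (D.map (c.ι.app a ≫ α ≫ g ≫ g'))) =
          y.chain.word.map (Hom.base (D.map (β ≫ g ≫ g'))) := by
      have h' := congrArg (List.map (Hom.base (D.map g'))) h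
      rw [List.map_map, List.map_map] at h'
      have e : c.ι.app a ≫ α ≫ g ≫ g' = (c.ι.app a ≫ α ≫ g) ≫ g' := by
        simp only [Category.assoc]
      have e' : β ≫ g ≫ g' = (β ≫ g) ≫ g' := (Category.assoc _ _ _).symm
      rw [e, e']
      exact (List.map_congr_left fun x _ => base_map_comp _ g' x).trans
        (h'.trans (List.map_congr_left fun x _ => (base_map_comp _ g' x).symm))
    have key (a : I) : ∃ (l : J) (g : k ⟶ l),
        (F.obj a).chain.word.map (Hom.base (D.map (c.ι.app a ≫ α ≫ g))) =
          y.chain.word.map (Hom.base (D.map (β ≫ g))) := by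
      obtain ⟨l, g, h⟩ := hb.exists_map_eq
        ((F.obj a).chain.word.map (Hom.base (D.map (c.ι.app a ≫ α))))
        (y.chain.word.map (Hom.base (D.map β))) (by
          rw [List.map_map, List.map_map]
          refine Eq.trans (List.map_congr_left fun x _ => b.w _ x) (Eq.trans ?_
            (List.map_congr_left fun x _ => (b.w _ x).symm))
          rw [mapsTo_iff_word.1 (F.obj a).mapsTo, mapsTo_iff_word.1 y.mapsTo])
      refine ⟨l, g, ?_⟩
      rw [List.map_map, List.map_map] at h
      rw [← Category.assoc (c.ι.app a)]
      exact (List.map_congr_left fun x _ => base_map_comp _ g x).trans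
        (h.trans (List.map_congr_left fun x _ => (base_map_comp _ g x).symm))
    choose l g hg using key
    obtain ⟨m, p, q, hpq⟩ := IsCardinalFiltered.wideSpan (κ := κ) g
      (hasCardinalLT_of_hasCardinalLT_arrow hI)
    refine ⟨⟨⟨m, _, _, (mapFunctor (Hom.base (D.map (β ≫ q))) _ _).obj y.chain, ?_⟩, ?_⟩⟩
    · rw [mapsTo_iff_word, ← mapsTo_iff_word.1 y.mapsTo]
      refine Eq.trans ?_ (List.map_congr_left fun x _ => b.w (β ≫ q) x)
      exact List.map_map (l := y.chain.word)
    · refine ⟨fun a => ⟨c.ι.app a ≫ α ≫ q, mapsTo_iff_word.2 ?_⟩, fun a a' f => ?_⟩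
      · have := hstable (g a) (p a) (hg a)
        rw [hpq] at this
        exact this
      · refine Lift.Hom.ext ?_
        change U.map f ≫ c.ι.app a' ≫ α ≫ q = (c.ι.app a ≫ α ≫ q) ≫ 𝟙 m
        rw [← Category.assoc, c.w, Category.comp_id]

end BaseCocone.IsFilteredColimit

end

/-! ## Free objects -/

section

variable {M : Type u} [Category.{v} M] [MonoidalCategory M] {X : Type w}

/-- The only generator of a free Pre-Co-Segal category. -/
inductive FreeGen {A₀ B₀ : X} (t₀ : Chain X A₀ B₀) : ∀ ⦃A B : X⦄, Chain X A B → Type w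
  | mk : FreeGen t₀ t₀

/-- A Pre-Co-Segal category freely generated by a morphism to its value at a chain. -/
def IsFree {A₀ B₀ : X} {t₀ : Chain X A₀ B₀} {G : M} {K : PreCoSegal M X} (η : G ⟶ K.val t₀) :
    Prop :=
  ∀ ⦃H : PreCoSegal M X⦄ (g : G ⟶ H.val t₀), ∃! m : K ⟶ H, η ≫ PreCoSegal.appAt m t₀ = g

/-- The presentation with one generator on `t₀` and no relations. -/
theorem exists_isFree [SymmetricCategory M] [MonoidalClosed M] [HasColimitsOfSize.{w, w} M]
    {A₀ B₀ : X} (t₀ : Chain X A₀ B₀) (G : M) :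
    ∃ (K : PreCoSegal M X) (η : G ⟶ K.val t₀), IsFree η := by
  let P : Presentation M X :=
    { Gen := FreeGen t₀, val := fun _ _ _ _ => G, Rel := fun _ _ _ _ _ => PEmpty,
      map := fun r => r.elim }
  obtain ⟨K, κ, hK⟩ := P.exists_presented
  refine ⟨K, κ.app (t := t₀) FreeGen.mk, fun H g => ?_⟩
  obtain ⟨m, hm, hm'⟩ := hK H ⟨fun _ _ t x => match t, x with | _, .mk => g, fun r => r.elim⟩
  refine ⟨m, hm (t := t₀) FreeGen.mk, fun m' h => hm' m' fun {A B t} x => ?_⟩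
  cases x
  exact h

namespace IsFree

variable {A₀ B₀ : X} {t₀ : Chain X A₀ B₀} {G : M} {K : PreCoSegal M X} {η : G ⟶ K.val t₀}
  (hη : IsFree η) {H : TotalPreCoSegal.{w} M}

include hη

/-- Freeness over `X`, applied to the pullback of `H` along `f`, is freeness in the total category
for morphisms over `f`. -/
theorem exists_hom (f : X → H.carrier) {A B : H.carrier} {t : Chain H.carrier A B}
    (h : MapsTo f t₀ t) (g : G ⟶ H.diagram.val t) :
    ∃ (φ : TotalPreCoSegal.mk X K ⟶ H) (hφ : Hom.base φ = f),
      η ≫ Hom.at φ t₀ t (hφ ▸ h) = g := by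
  induction h using MapsTo.ind with
  | refl =>
    obtain ⟨m, hm, -⟩ := hη (H := PreCoSegal.pullback f H.diagram) g
    refine ⟨Hom.mk f m, rfl, ?_⟩
    exact (congrArg (η ≫ ·) (at_refl (F := TotalPreCoSegal.mk X K) (Hom.mk f m) t₀)).trans hm

theorem hom_ext {φ ψ : TotalPreCoSegal.mk X K ⟶ H} (hb : Hom.base φ = Hom.base ψ)
    {A B : H.carrier} {t : Chain H.carrier A B} (h₁ : MapsTo (Hom.base φ) t₀ t)
    (h₂ : MapsTo (Hom.base ψ) t₀ t) (e : η ≫ Hom.at φ t₀ t h₁ = η ≫ Hom.at ψ t₀ t h₂) :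
    φ = ψ := by
  obtain ⟨f, m⟩ := φ
  obtain ⟨f', m'⟩ := ψ
  obtain rfl : f = f' := hb
  congr 1
  have h₃ : MapsTo f t₀ t := h₁
  induction h₃ using MapsTo.ind with
  | refl =>
    refine (hη (H := PreCoSegal.pullback f H.diagram) (η ≫ PreCoSegal.appAt m t₀)).unique rfl ?_
    have e₁ := at_refl (F := TotalPreCoSegal.mk X K) (Hom.mk f m) t₀
    have e₂ := at_refl (F := TotalPreCoSegal.mk X K) (Hom.mk f m') t₀
    exact (congrArg (η ≫ ·) e₂).symm.trans (e.symm.trans (congrArg (η ≫ ·) e₁))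

end IsFree

end

open Chain TotalPreCoSegal

/-! ### Presentability of free objects -/

section

variable {M : Type u} [Category.{w} M] [MonoidalCategory M] {X : Type w}

variable {J : Type w} [Category.{w} J] {D : J ⥤ TotalPreCoSegal.{w} M} {b : BaseCocone D}

theorem isCardinalPresentable_of_exists {C : Type u} [Category.{w} C] {F : C} {κ : Cardinal.{w}}
    [Fact κ.IsRegular]
    (h : ∀ (J : Type w) [SmallCategory J] [IsCardinalFiltered J κ] (D : J ⥤ C),
      ∃ c : Cocone D, Nonempty (IsColimit c) ∧
        (∀ φ : F ⟶ c.pt, ∃ (j : J) (ψ : F ⟶ D.obj j), ψ ≫ c.ι.app j = φ) ∧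
        (∀ (j : J) (φ ψ : F ⟶ D.obj j), φ ≫ c.ι.app j = ψ ≫ c.ι.app j →
          ∃ (k : J) (f : j ⟶ k), φ ≫ D.map f = ψ ≫ D.map f)) :
    IsCardinalPresentable F κ where
  preservesColimitOfShape J _ _ :=
    { preservesColimit := fun {D} => by
        have := isFiltered_of_isCardinalFiltered J κ
        obtain ⟨c, ⟨hc⟩, h₁, h₂⟩ := h J D
        refine preservesColimit_of_preserves_colimit_cocone hc
          (Types.FilteredColimit.isColimitOf'.{w, w} _ _ (fun φ => ?_) fun j φ ψ e => ?_)
        · obtain ⟨j, ψ, e⟩ := h₁ φ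
          exact ⟨j, ψ, e.symm⟩
        · exact h₂ j φ ψ e }

namespace IsFree

variable {A₀ B₀ : X} {t₀ : Chain X A₀ B₀} {G : M} {K : PreCoSegal M X} {η : G ⟶ K.val t₀}
  (hη : IsFree η) {κ : Cardinal.{w}} [Fact κ.IsRegular] [IsCardinalPresentable G κ]
  (hX : HasCardinalLT X κ) [IsCardinalFiltered J κ]

include hη hX

/-- A morphism from a free object is a function on `X` and a morphism from `G` to a value at one
chain. The function factors through a stage because `X` has fewer than `κ` elements. The morphism
factors through a lift because the value is a `κ`-filtered colimit over lifts. A lift dominating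
both factors them simultaneously. -/
theorem exists_factor (hb : b.IsFilteredColimit) {c : RelCocone b}
    (hc : ∀ {A B : b.pt} (t : Chain b.pt A B), Nonempty (IsColimit (c.eval t)))
    (φ : TotalPreCoSegal.mk X K ⟶ TotalPreCoSegal.mk b.pt c.diagram) :
    ∃ (j : J) (ψ : TotalPreCoSegal.mk X K ⟶ D.obj j), ψ ≫ c.leg j = φ := by
  have := isFiltered_of_isCardinalFiltered J κ
  choose j₀ y hy using fun x : X => hb.exists_lift (Hom.base φ x)
  let j := IsCardinalFiltered.max j₀ hX
  let f (x : X) : (D.obj j).carrier :=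
    Hom.base (D.map (IsCardinalFiltered.toMax j₀ hX x)) (y x)
  have hf (x : X) : b.ι j (f x) = Hom.base φ x := (b.w _ _).trans (hy x)
  let t : Chain b.pt (Hom.base φ A₀) (Hom.base φ B₀) := (mapFunctor (Hom.base φ) A₀ B₀).obj t₀
  have ht : MapsTo (Hom.base φ) t₀ t := MapsTo.refl _ _
  -- This lift records the factorization of the function. The lift `y` below comes from `G` alone
  -- and need not be an image of `t₀` under a map from `X`; the common target `z` is one.
  let x : Lift b t := ⟨j, _, _, (mapFunctor f A₀ B₀).obj t₀, (MapsTo.refl f t₀).factor hf ht⟩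
  have := hb.isCardinalFiltered_lift κ t
  have := isFiltered_of_isCardinalFiltered (Lift b t) κ
  obtain ⟨hct⟩ := hc t
  obtain ⟨y, g, hg⟩ := IsCardinalPresentable.exists_hom_of_isColimit κ hct (η ≫ Hom.at φ t₀ t ht)
  obtain ⟨z, p, q, -⟩ := IsFilteredOrEmpty.cocone_objs x y
  have hz : MapsTo (fun a => Hom.base (D.map p.hom) (f a)) t₀ z.chain :=
    (MapsTo.refl f t₀).comp p.mapsTo
  obtain ⟨ψ, hψ, e⟩ := hη.exists_hom (H := D.obj z.stage) _ hz (g ≫ (Lift.functor b t).map q)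
  have hψφ (a : X) : b.ι z.stage (Hom.base ψ a) = Hom.base φ a := by
    rw [hψ, b.w, hf]
  have hzψ : MapsTo (Hom.base ψ) t₀ z.chain := hψ ▸ hz
  have hbase : Hom.base (ψ ≫ c.leg z.stage) = Hom.base φ := funext fun a =>
    (congrFun (c.base_leg _) _).trans (hψφ a)
  have hbt : MapsTo (Hom.base (ψ ≫ c.leg z.stage)) t₀ t := ht.congr_fun hbase.symm
  refine ⟨z.stage, ψ, hη.hom_ext hbase (t := t) hbt ht ?_⟩
  have e₁ := at_comp ψ (c.leg z.stage) t₀ z.chain t hzψ (c.mapsTo_leg z) hbt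
  refine ((congrArg (η ≫ ·) e₁).trans (Category.assoc _ _ _).symm).trans ?_
  refine (congrArg (· ≫ (c.eval t).ι.app z) e).trans ((Category.assoc _ _ _).trans ?_)
  rw [(c.eval t).w q]
  exact hg

/-- First the functions on `X` are made equal at a later stage, one element at a time and then
jointly; only then do the two morphisms from `G` have the same target, and presentability of `G`
identifies them further on. -/
theorem exists_eq (hb : b.IsFilteredColimit) {c : RelCocone b}
    (hc : ∀ {A B : b.pt} (t : Chain b.pt A B), Nonempty (IsColimit (c.eval t))) {j : J}
    (φ ψ : TotalPreCoSegal.mk X K ⟶ D.obj j) (h : φ ≫ c.leg j = ψ ≫ c.leg j) :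
    ∃ (k : J) (f : j ⟶ k), φ ≫ D.map f = ψ ≫ D.map f := by
  have := isFiltered_of_isCardinalFiltered J κ
  have hb' (x : X) : ∃ (k : J) (f : j ⟶ k),
      Hom.base (D.map f) (Hom.base φ x) = Hom.base (D.map f) (Hom.base ψ x) := by
    refine hb.exists_eq ?_
    rw [← c.base_leg]
    exact congrArg (fun χ => Hom.base χ x) h
  choose k₀ f₀ hf₀ using hb'
  obtain ⟨k, p, f, hpf⟩ := IsCardinalFiltered.wideSpan f₀ hX
  let φ' := φ ≫ D.map f
  let ψ' := ψ ≫ D.map f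
  have hbase : Hom.base φ' = Hom.base ψ' := funext fun x => by
    change Hom.base (D.map f) (Hom.base φ x) = Hom.base (D.map f) (Hom.base ψ x)
    rw [← hpf x, base_map_comp, base_map_comp, hf₀]
  have h' : φ' ≫ c.leg k = ψ' ≫ c.leg k := by
    simp only [φ', ψ', Category.assoc, c.w, h]
  let s := (mapFunctor (Hom.base φ') A₀ B₀).obj t₀
  have hs : MapsTo (Hom.base φ') t₀ s := MapsTo.refl _ _
  have hs' : MapsTo (Hom.base ψ') t₀ s := hbase ▸ hs
  let t := (mapFunctor (b.ι k) _ _).obj s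
  let x : Lift b t := ⟨k, _, _, s, MapsTo.refl _ _⟩
  have := hb.isCardinalFiltered_lift κ t
  obtain ⟨hct⟩ := hc t
  have ht : MapsTo (Hom.base (φ' ≫ c.leg k)) t₀ t := hs.comp (c.mapsTo_leg x)
  obtain ⟨y, u, hu⟩ := IsCardinalPresentable.exists_eq_of_isColimit' κ hct (i := x)
    (η ≫ Hom.at φ' t₀ s hs) (η ≫ Hom.at ψ' t₀ s hs') (by
      rw [Category.assoc, Category.assoc]
      refine congrArg (η ≫ ·) ?_
      exact (at_comp φ' (c.leg k) t₀ s t hs (c.mapsTo_leg x) ht).symm.trans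
        ((at_congr h' t₀ t ht).trans (at_comp ψ' (c.leg k) t₀ s t hs' (c.mapsTo_leg x) (h' ▸ ht))))
  refine ⟨y.stage, f ≫ u.hom, ?_⟩
  rw [D.map_comp, ← Category.assoc, ← Category.assoc]
  have hφy : MapsTo (Hom.base (φ' ≫ D.map u.hom)) t₀ y.chain := hs.comp u.mapsTo
  have hψy : MapsTo (Hom.base (ψ' ≫ D.map u.hom)) t₀ y.chain := hs'.comp u.mapsTo
  refine hη.hom_ext (φ := φ' ≫ D.map u.hom) (ψ := ψ' ≫ D.map u.hom)
    (funext fun x => congrArg (Hom.base (D.map u.hom)) (congrFun hbase x)) hφy hψy ?_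
  rw [at_comp φ' (D.map u.hom) t₀ s y.chain hs u.mapsTo hφy,
    at_comp ψ' (D.map u.hom) t₀ s y.chain hs' u.mapsTo hψy, ← Category.assoc, ← Category.assoc]
  exact hu

omit [IsCardinalFiltered J κ]

variable [SymmetricCategory M] [MonoidalClosed M] [HasColimitsOfSize.{w, w} M]

theorem isCardinalPresentable : IsCardinalPresentable (TotalPreCoSegal.mk X K) κ := by
  refine isCardinalPresentable_of_exists fun J _ _ D => ?_
  have := isFiltered_of_isCardinalFiltered J κ
  obtain ⟨b, hb⟩ := exists_baseCocone_isColimit D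
  have hb' := hb.isFilteredColimit
  obtain ⟨c, hc, hc'⟩ := hb'.exists_isUniversal
  exact ⟨c.cocone, hc.nonempty_isColimit hb, fun φ => hη.exists_factor hX hb' hc' φ,
    fun j φ ψ h => hη.exists_eq hX hb' hc' φ ψ h⟩

/-- Filtered categories are connected, so the inclusion preserves the colimit and presentability in
the total category applies. The factorizations found there lie over the identity, since the legs do,
and hence come from the fibre. -/
theorem isCardinalPresentable_fiber : IsCardinalPresentable K κ := by
  refine isCardinalPresentable_of_exists fun J _ _ D => ?_
  have := isFiltered_of_isCardinalFiltered J κ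
  have : IsConnected J := IsFiltered.isConnected J
  have : IsCardinalPresentable ((inclusion M X).obj K) κ := hη.isCardinalPresentable hX
  have hc := isColimitOfPreserves (inclusion M X) (colimit.isColimit D)
  refine ⟨colimit.cocone D, ⟨colimit.isColimit D⟩, fun φ => ?_, fun j φ ψ h => ?_⟩
  · obtain ⟨j, ψ, hψ⟩ := IsCardinalPresentable.exists_hom_of_isColimit κ hc
      ((inclusion M X).map φ)
    obtain ⟨σ, rfl⟩ := exists_inclusion_map (F := K) (G := D.obj j) ψ (by
      exact congrArg Hom.base hψ)
    refine ⟨j, σ, (inclusion M X).map_injective ?_⟩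
    rw [Functor.map_comp]
    exact hψ
  · obtain ⟨k, f, hf⟩ := IsCardinalPresentable.exists_eq_of_isColimit' κ hc
      ((inclusion M X).map φ) ((inclusion M X).map ψ) (by
        have := congrArg (inclusion M X).map h
        rwa [Functor.map_comp, Functor.map_comp] at this)
    refine ⟨k, f, (inclusion M X).map_injective ?_⟩
    rw [Functor.map_comp, Functor.map_comp]
    exact hf

end IsFree

end

open Chain TotalPreCoSegal

/-! ## Strong generators -/

/-- The set of letters of the universal chain with `n` inner letters. -/
abbrev Letters (n : ℕ) : Type w := ULift.{w} (Bool ⊕ Fin n)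

/-- The universal chain with `n` inner letters. -/
def universalChain (n : ℕ) :
    Chain (Letters.{w} n) (ULift.up (Sum.inl false)) (ULift.up (Sum.inl true)) :=
  ⟨(List.finRange n).map fun i => ULift.up (Sum.inr i)⟩

theorem exists_mapsTo_universalChain {X : Type w} {A B : X} (s : Chain X A B) :
    ∃ (n : ℕ) (f : Letters.{w} n → X), MapsTo f (universalChain n) s := by
  refine ⟨s.inner.length, fun a => a.down.elim (fun c => if c then B else A) s.inner.get,
    rfl, rfl, ?_⟩
  refine List.map_map.trans ?_
  exact List.map_get_finRange s.inner

section

variable {M : Type u} [Category.{v} M] [MonoidalCategory M]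

/-- The inverse function and the inverses of the components form a morphism; its compatibilities are
those of `i`, checked after composing with the monomorphic components of `i`. -/
theorem TotalPreCoSegal.isIso_of_at {F H : TotalPreCoSegal.{w} M} (i : F ⟶ H)
    (hi : Function.Bijective (Hom.base i))
    (h : ∀ {A B : F.carrier} (s : Chain F.carrier A B) {A' B' : H.carrier}
      (t : Chain H.carrier A' B') (h : MapsTo (Hom.base i) s t), IsIso (Hom.at i s t h)) :
    IsIso i := by
  obtain ⟨g, hg, hg'⟩ := Function.bijective_iff_has_inverse.1 hi
  have hm {A B : H.carrier} {t : Chain H.carrier A B} {A' B' : F.carrier}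
      {s : Chain F.carrier A' B'} (h : MapsTo g t s) : MapsTo (Hom.base i) s t :=
    h.factor (f := g) (k := fun x => x) hg' (MapsTo.id t)
  have hj {A B : H.carrier} {t : Chain H.carrier A B} {A' B' : F.carrier}
      {s : Chain F.carrier A' B'} (h' : MapsTo g t s) :
      ∃ k : H.diagram.val t ⟶ F.diagram.val s, Hom.at i s t (hm h') ≫ k = 𝟙 _ ∧
        k ≫ Hom.at i s t (hm h') = 𝟙 _ := (h s t (hm h')).out
  choose k hk hk' using @hj
  have hmono {A B : H.carrier} {t : Chain H.carrier A B} {A' B' : F.carrier}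
      {s : Chain F.carrier A' B'} (h' : MapsTo g t s) : Mono (Hom.at i s t (hm h')) :=
    have := h s t (hm h')
    inferInstance
  let j : H ⟶ F := TotalPreCoSegal.homMk g (fun t _ _ s h' => k h')
    (fun {A B t t'} v {A' B' s s'} u h₁ h₂ e => by
      have := hmono h₁
      rw [← cancel_mono (Hom.at i s t (hm h₁)), Category.assoc, Category.assoc, hk',
        ← at_res i u v (hm h₁) (hm h₂), ← Category.assoc, hk', Category.id_comp, Category.comp_id]
      refine (Del.map_heq _ h₁.inner h₂.inner e).symm.trans ((Del.map_map g _ v).trans ?_)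
      exact (Del.map_congr v fun x _ => hg' x).trans (Del.map_id_fun v))
    (fun {A B C} t q {A' B' C'} s r h₁ h₂ => by
      have := hmono (h₁.hcomp h₂)
      rw [← cancel_mono (Hom.at i _ _ (hm (h₁.hcomp h₂))), Category.assoc, Category.assoc, hk',
        ← at_lax i s r t q (hm h₁) (hm h₂), ← Category.assoc, tensorHom_comp_tensorHom, hk', hk',
        id_tensorHom_id, Category.id_comp, Category.comp_id])
  have hat {A B : H.carrier} (t : Chain H.carrier A B) {A' B' : F.carrier}
      (s : Chain F.carrier A' B') (h' : MapsTo g t s) : Hom.at j t s h' = k h' :=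
    homMk_at _ _ _ _ t s h'
  refine ⟨j, TotalPreCoSegal.hom_ext (funext hg) fun s A' B' t h₁ h₂ => ?_,
    TotalPreCoSegal.hom_ext (funext hg') fun t A' B' t' h₁ h₂ => ?_⟩
  · have h₃ : MapsTo (fun x => x) s t := h₂
    induction h₃ using MapsTo.ind_id with
    | id =>
      have h₄ := (MapsTo.refl (Hom.base i) s).factor (g := g) (k := fun x => x) hg (MapsTo.id s)
      rw [at_comp i j s _ s (MapsTo.refl _ s) h₄ h₁, hat, at_id]
      exact hk h₄
  · have h₃ : MapsTo (fun x => x) t t' := h₂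
    induction h₃ using MapsTo.ind_id with
    | id =>
      have h₄ := hm (MapsTo.refl g t)
      refine (at_comp j i t _ t (MapsTo.refl g t) h₄ h₁).trans ?_
      rw [at_id]
      exact (congrArg (· ≫ Hom.at i _ t h₄) (hat t _ (MapsTo.refl g t))).trans
        (hk' (MapsTo.refl g t))

theorem PreCoSegal.isIso_of_appAt {X : Type w} {F H : PreCoSegal M X} (i : F ⟶ H)
    (h : ∀ {A B : X} (s : Chain X A B), IsIso (PreCoSegal.appAt i s)) : IsIso i := by
  have : IsIso ((inclusion M X).map i) := by
    refine TotalPreCoSegal.isIso_of_at _ Function.bijective_id fun s _ _ t h' => ?_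
    have h₃ : MapsTo (fun x => x) s t := h'
    induction h₃ using MapsTo.ind_id with
    | id =>
      have := h s
      exact (at_inclusionMap i s (MapsTo.id s)).symm ▸ this
  let k := inv ((inclusion M X).map i)
  obtain ⟨j, hj⟩ := exists_inclusion_map (F := H) (G := F) k
    (congrArg Hom.base (IsIso.hom_inv_id ((inclusion M X).map i)))
  refine ⟨j, (inclusion M X).map_injective ?_, (inclusion M X).map_injective ?_⟩
  · rw [Functor.map_comp, hj]
    exact (IsIso.hom_inv_id _).trans ((inclusion M X).map_id _).symm
  · rw [Functor.map_comp, hj]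
    exact (IsIso.inv_hom_id _).trans ((inclusion M X).map_id _).symm

theorem isCardinalPresentable_initial {C : Type u} [Category.{w} C] [HasColimitsOfSize.{w, w} C]
    [HasInitial C] (κ : Cardinal.{w}) [Fact κ.IsRegular] : IsCardinalPresentable (⊥_ C) κ :=
  isCardinalPresentable_of_exists fun J _ _ D =>
    ⟨colimit.cocone D, ⟨colimit.isColimit D⟩, fun φ =>
      ⟨(IsCardinalFiltered.nonempty J κ).some, initial.to _, initial.hom_ext _ _⟩,
      fun j φ ψ _ => ⟨j, 𝟙 j, by rw [initial.hom_ext φ ψ]⟩⟩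

end

section

variable {M : Type u} [Category.{w} M] [MonoidalCategory M] [SymmetricCategory M]
  [MonoidalClosed M] [HasColimitsOfSize.{w, w} M]

/-- The Pre-Co-Segal category freely generated by an object of `M` at a chain. -/
noncomputable def free {X : Type w} {A B : X} (t : Chain X A B) (G : M) : PreCoSegal M X :=
  (exists_isFree t G).choose

/-- The generating morphism. -/
noncomputable def freeUnit {X : Type w} {A B : X} (t : Chain X A B) (G : M) :
    G ⟶ (free t G).val t :=
  (exists_isFree t G).choose_spec.choose

theorem isFree_freeUnit {X : Type w} {A B : X} (t : Chain X A B) (G : M) :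
    IsFree (freeUnit t G) :=
  (exists_isFree t G).choose_spec.choose_spec

variable {P : ObjectProperty M} (hP : P.IsStrongGenerator)

/-- The free Pre-Co-Segal categories with set of objects `X`. -/
abbrev fiberGenerators (P : ObjectProperty M) (X : Type w) : ObjectProperty (PreCoSegal M X) :=
  .ofObj fun p : (Σ A B : X, Chain X A B) × Subtype P => free p.1.2.2 p.2.1

/-- The free Pre-Co-Segal categories on the universal chains. -/
abbrev totalGenerators (P : ObjectProperty M) : ObjectProperty (TotalPreCoSegal.{w} M) :=
  .ofObj fun p : ULift.{w} ℕ × Subtype P =>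
    TotalPreCoSegal.mk _ (free (universalChain p.1.down) p.2.1)

theorem totalGenerators_free (n : ℕ) {G : M} (hG : P G) :
    totalGenerators P (TotalPreCoSegal.mk _ (free (universalChain n) G)) :=
  ObjectProperty.ofObj_apply (fun p : ULift.{w} ℕ × Subtype P =>
    TotalPreCoSegal.mk _ (free (universalChain p.1.down) p.2.1)) (ULift.up n, ⟨G, hG⟩)

theorem fiberGenerators_free {X : Type w} {A B : X} (t : Chain X A B) {G : M} (hG : P G) :
    fiberGenerators P X (free t G) :=
  ObjectProperty.ofObj_apply (fun p : (Σ A B : X, Chain X A B) × Subtype P =>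
    free p.1.2.2 p.2.1) (⟨A, B, t⟩, ⟨G, hG⟩)

include hP

/-- Morphisms out of the free object on `G` at `s` are morphisms from `G` to the value at `s`.
Separation and lifting through a monomorphism therefore reduce to the strong generator `P` at each
chain. -/
theorem isStrongGenerator_fiberGenerators (X : Type w) :
    (fiberGenerators P X).IsStrongGenerator := by
  rw [ObjectProperty.isStrongGenerator_iff] at hP ⊢
  refine ⟨fun F H φ ψ h => PreCoSegal.hom_ext fun {A B} s => hP.1 _ _ fun G hG g => ?_,
    fun F H i _ h => PreCoSegal.isIso_of_appAt i fun {A B} s => ?_⟩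
  · obtain ⟨χ, rfl, -⟩ := isFree_freeUnit s G g
    have := h _ (fiberGenerators_free s hG) χ
    rw [Category.assoc, Category.assoc, ← PreCoSegal.appAt_comp, ← PreCoSegal.appAt_comp]
    exact congrArg (fun σ => freeUnit s G ≫ PreCoSegal.appAt σ s) this
  -- Free objects on arbitrary `Z`, not only on members of `P`, represent evaluation at `s`; so
  -- evaluation preserves monomorphisms.
  · have : Mono (PreCoSegal.appAt i s) := ⟨fun {Z} g₁ g₂ e => by
      obtain ⟨χ₁, rfl, -⟩ := isFree_freeUnit s Z g₁
      obtain ⟨χ₂, rfl, -⟩ := isFree_freeUnit s Z g₂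
      have : χ₁ ≫ i = χ₂ ≫ i := by
        refine (isFree_freeUnit s Z _).unique rfl ?_
        rw [PreCoSegal.appAt_comp, PreCoSegal.appAt_comp, ← Category.assoc, ← e, Category.assoc]
      rw [(cancel_mono i).1 this]⟩
    refine hP.2 _ fun G hG g => ?_
    obtain ⟨χ, rfl, -⟩ := isFree_freeUnit s G g
    obtain ⟨χ', e⟩ := h _ (fiberGenerators_free s hG) χ
    refine ⟨freeUnit s G ≫ PreCoSegal.appAt χ' s, ?_⟩
    simp only [Category.assoc]
    rw [← PreCoSegal.appAt_comp]
    exact congrArg (fun σ => freeUnit s G ≫ PreCoSegal.appAt σ s) e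

/-- Every chain is the image of a universal one, so the other generators control values as in the
fibre. The free object on the initial object carries no data beyond a function on letters and so
controls the sets of objects. -/
theorem isStrongGenerator_totalGenerators [HasInitial M] (hP' : P (⊥_ M)) :
    (totalGenerators P).IsStrongGenerator := by
  have hpt {F : TotalPreCoSegal.{w} M} (x : F.carrier) :
      ∃ χ : TotalPreCoSegal.mk _ (free (universalChain 0) (⊥_ M)) ⟶ F,
        Hom.base χ = fun _ => x := by
    obtain ⟨χ, hχ, -⟩ := (isFree_freeUnit (universalChain 0) (⊥_ M)).exists_hom (H := F)
      (fun _ => x) (MapsTo.refl _ _) (initial.to _)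
    exact ⟨χ, hχ⟩
  have hpt' := totalGenerators_free 0 hP'
  rw [ObjectProperty.isStrongGenerator_iff] at hP ⊢
  refine ⟨fun F H φ ψ h => ?_, fun F H i _ h => ?_⟩
  · have hbase : Hom.base φ = Hom.base ψ := funext fun x => by
      obtain ⟨χ, hχ⟩ := hpt x
      have := congrArg (fun σ => Hom.base σ (ULift.up (Sum.inl false))) (h _ hpt' χ)
      simpa only [base_comp, hχ] using this
    refine TotalPreCoSegal.hom_ext hbase fun s A' B' t h₁ h₂ => hP.1 _ _ fun G hG g => ?_
    obtain ⟨n, f, hf⟩ := exists_mapsTo_universalChain s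
    obtain ⟨χ, hχ, rfl⟩ := (isFree_freeUnit (universalChain n) G).exists_hom f hf g
    have hχs : MapsTo (Hom.base χ) (universalChain n) s := hχ ▸ hf
    have e := h _ (totalGenerators_free n hG) χ
    have e' := congrArg (freeUnit _ G ≫ ·) ((at_comp χ φ _ s t hχs h₁ (hχs.comp h₁)).symm.trans
      ((at_congr e _ t (hχs.comp h₁)).trans (at_comp χ ψ _ s t hχs h₂ (hχs.comp h₂))))
    simp only [Category.assoc]
    exact e'
  · have hinj : Function.Injective (Hom.base i) := fun x y hxy => by
      obtain ⟨χ₁, h₁⟩ := hpt x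
      obtain ⟨χ₂, h₂⟩ := hpt y
      have hb : Hom.base (χ₁ ≫ i) = Hom.base (χ₂ ≫ i) := funext fun z => by
        rw [base_comp, base_comp, h₁, h₂, hxy]
      have : χ₁ ≫ i = χ₂ ≫ i := (isFree_freeUnit _ _).hom_ext hb (MapsTo.refl _ _)
        ((MapsTo.refl _ _).congr_fun hb) (initial.hom_ext _ _)
      have := congrArg (fun σ => Hom.base σ (ULift.up (Sum.inl false))) ((cancel_mono i).1 this)
      simpa only [h₁, h₂] using this
    have hsurj : Function.Surjective (Hom.base i) := fun y => by
      obtain ⟨χ, hχ⟩ := hpt y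
      obtain ⟨χ', rfl⟩ := h _ hpt' χ
      exact ⟨_, congrFun hχ (ULift.up (Sum.inl false))⟩
    refine TotalPreCoSegal.isIso_of_at i ⟨hinj, hsurj⟩ fun s A' B' t hst => ?_
    obtain ⟨n, f, hf⟩ := exists_mapsTo_universalChain s
    have : Mono (Hom.at i s t hst) := ⟨fun {Z} g₁ g₂ e => by
      obtain ⟨χ₁, hχ₁, rfl⟩ := (isFree_freeUnit (universalChain n) Z).exists_hom f hf g₁
      obtain ⟨χ₂, hχ₂, rfl⟩ := (isFree_freeUnit (universalChain n) Z).exists_hom f hf g₂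
      have hf₁ : MapsTo (Hom.base χ₁) (universalChain n) s := hχ₁ ▸ hf
      have hf₂ : MapsTo (Hom.base χ₂) (universalChain n) s := hχ₂ ▸ hf
      have : χ₁ ≫ i = χ₂ ≫ i := by
        refine (isFree_freeUnit _ _).hom_ext (funext fun z => ?_) (hf₁.comp hst) (hf₂.comp hst) ?_
        · rw [base_comp, base_comp, hχ₁, hχ₂]
        · refine (congrArg (freeUnit _ Z ≫ ·) (at_comp χ₁ i _ s t hf₁ hst _)).trans ?_
          refine Eq.trans ?_ (congrArg (freeUnit _ Z ≫ ·) (at_comp χ₂ i _ s t hf₂ hst _)).symm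
          exact (Category.assoc _ _ _).symm.trans (e.trans (Category.assoc _ _ _))
      exact congrArg (freeUnit _ Z ≫ ·) (at_congr ((cancel_mono i).1 this) _ s hf₁)⟩
    refine hP.2 _ fun G hG g => ?_
    obtain ⟨χ, hχ, rfl⟩ := (isFree_freeUnit (universalChain n) G).exists_hom (H := H)
      (fun z => Hom.base i (f z)) (hf.comp hst) g
    obtain ⟨χ', rfl⟩ := h _ (totalGenerators_free n hG) χ
    -- The lift `χ'` is obtained without control on its function; injectivity of `i` on objects
    -- forces it to be `f`, so that it can be evaluated at `s`.
    have hχ' : Hom.base χ' = f := funext fun z => hinj (congrFun hχ z)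
    have hf' : MapsTo (Hom.base χ') (universalChain n) s := hχ' ▸ hf
    refine ⟨freeUnit _ G ≫ Hom.at χ' _ s hf', (Category.assoc _ _ _).trans ?_⟩
    exact congrArg (freeUnit _ G ≫ ·) (at_comp χ' i _ s t hf' hst (hf'.comp hst)).symm

end

/-! ### Local presentability -/

section

variable {M : Type u} [Category.{w} M] [MonoidalCategory M] [SymmetricCategory M]
  [MonoidalClosed M]

theorem isCardinalLocallyPresentable_fiber (κ : Cardinal.{w}) [Fact κ.IsRegular]
    [IsCardinalLocallyPresentable M κ] {X : Type w} (hX : HasCardinalLT X κ) :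
    IsCardinalLocallyPresentable (PreCoSegal M X) κ := by
  obtain ⟨P, _, hP, hP'⟩ := (IsCardinalLocallyPresentable.iff_exists_isStrongGenerator M κ).1
    inferInstance
  refine (IsCardinalLocallyPresentable.iff_exists_isStrongGenerator _ κ).2
    ⟨fiberGenerators P X, inferInstance, isStrongGenerator_fiberGenerators hP X, ?_⟩
  rw [ObjectProperty.ofObj_le_iff]
  rintro ⟨⟨A, B, t⟩, ⟨G, hG⟩⟩
  have : IsCardinalPresentable G κ := hP' _ hG
  exact (isFree_freeUnit t G).isCardinalPresentable_fiber hX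

theorem isCardinalLocallyPresentable_total (κ : Cardinal.{w}) [Fact κ.IsRegular]
    [IsCardinalLocallyPresentable M κ] :
    IsCardinalLocallyPresentable (TotalPreCoSegal.{w} M) κ := by
  obtain ⟨P₀, _, hP₀, hP₀'⟩ := (IsCardinalLocallyPresentable.iff_exists_isStrongGenerator M κ).1
    inferInstance
  have : HasInitial M :=
    have := hasColimitsOfSizeShrink.{0, 0, w, w} M
    inferInstance
  -- Enlarging a strong generator keeps it one, and the initial object is `κ`-presentable for every
  -- regular `κ`.
  let P : ObjectProperty M := P₀ ⊔ .singleton (⊥_ M)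
  have hP : P.IsStrongGenerator := by
    rw [ObjectProperty.isStrongGenerator_iff] at hP₀ ⊢
    exact ⟨fun X Y f g h => hP₀.1 f g fun G hG => h G (Or.inl hG),
      fun X Y i _ h => hP₀.2 i fun G hG => h G (Or.inl hG)⟩
  have hbot : P (⊥_ M) := Or.inr (by simp)
  refine (IsCardinalLocallyPresentable.iff_exists_isStrongGenerator _ κ).2
    ⟨totalGenerators P, inferInstance, isStrongGenerator_totalGenerators hP hbot, ?_⟩
  rw [ObjectProperty.ofObj_le_iff]
  rintro ⟨⟨n⟩, ⟨G, hG⟩⟩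
  have : IsCardinalPresentable G κ := by
    obtain hG | hG := hG
    · exact hP₀' _ hG
    · obtain rfl : (⊥_ M) = G := by simpa [eq_comm] using hG
      exact isCardinalPresentable_initial κ
  exact (isFree_freeUnit (universalChain n) G).isCardinalPresentable
    (hasCardinalLT_of_finite _ κ (Cardinal.IsRegular.aleph0_le Fact.out))

theorem isLocallyPresentable_fiber [IsLocallyPresentable.{w} M] (X : Type w) :
    IsLocallyPresentable.{w} (PreCoSegal M X) := by
  obtain ⟨κ, _, _⟩ := IsLocallyPresentable.exists_cardinal.{w} M
  -- The set of objects of the generators is all of `X`, so a regular cardinal above both `X` and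
  -- `κ` is needed; the second summand has cardinality `κ`.
  obtain ⟨κ', hκ', h⟩ := HasCardinalLT.exists_regular_cardinal.{w} (X ⊕ κ.ord.ToType)
  have : Fact κ'.IsRegular := ⟨hκ'⟩
  have hX : HasCardinalLT X κ' := h.of_injective _ Sum.inl_injective
  have hκ : κ ≤ κ' := by
    have := h.of_injective _ Sum.inr_injective
    rw [hasCardinalLT_iff_cardinal_mk_lt] at this
    simpa using this.le
  have := IsCardinalLocallyPresentable.of_le M hκ
  exact ⟨κ', inferInstance, isCardinalLocallyPresentable_fiber κ' hX⟩

theorem isLocallyPresentable_total [IsLocallyPresentable.{w} M] :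
    IsLocallyPresentable.{w} (TotalPreCoSegal.{w} M) := by
  obtain ⟨κ, _, _⟩ := IsLocallyPresentable.exists_cardinal.{w} M
  exact ⟨κ, inferInstance, isCardinalLocallyPresentable_total κ⟩

end

end CoSegal

theorem mainTheorem9 {M : Type u} [Category.{w} M] [MonoidalCategory M] [SymmetricCategory M]
    [MonoidalClosed M] :
    (HasColimitsOfSize.{w, w} M →
      (∀ (X : Type w) [Nonempty X], HasColimitsOfSize.{w, w} (CoSegal.PreCoSegal M X)) ∧
        HasColimitsOfSize.{w, w} (CoSegal.TotalPreCoSegal.{w} M)) ∧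
    (IsLocallyPresentable.{w} M →
      (∀ (X : Type w) [Nonempty X], IsLocallyPresentable.{w} (CoSegal.PreCoSegal M X)) ∧
        IsLocallyPresentable.{w} (CoSegal.TotalPreCoSegal.{w} M)) :=
  ⟨fun _ => ⟨fun _ _ => inferInstance, inferInstance⟩,
    fun _ => ⟨fun X _ => CoSegal.isLocallyPresentable_fiber X,
      CoSegal.isLocallyPresentable_total⟩⟩
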